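/- A function $f:\mathbb N\to\mathbb C$ belongs to the class $\mathcal C$ if it is multiplicative and $|\Lambda_f(n)|\le\Lambda(n)$ for all $n\ge 1$, where $\Lambda$ is the von Mangoldt function and $\Lambda_f$ is defined by $-F'(s)/F(s)=\sum_{n\ge 1}\Lambda_f(n)n^{-s}$ with $F(s)=\sum_{n\ge1} f(n)n^{-s}$ (equivalently, $f(n)\log n=\sum_{de=n}f(d)\Lambda_f(e)$ for all $n\geq 1$). For a function $h:\mathbb N\to\mathbb C$, a real number $X$, a Dirichlet character $\chi$, a finite set $\Xi$ of primitive Dirichlet characters and coprime integers $a$ and $q\ge1$, put $S_h(X,\chi)=\sum_{n\le X}h(n)\overline{\chi}(n)$ and $$\Delta_\Xi(h,X;q,a)=\sum_{\substack{n\le X\\ n\equiv a\,(\mathrm{mod}\ q)}}h(n)-\frac1{\varphi(q)}\sum_{\chi\in\Xi_q}\chi(a)S_h(X,\chi),$$ where $\Xi_q$ is the set of characters mod $q$ induced by the characters in $\Xi$. Let $1_{\mathcal P}$ denote the indicator function of the set of primes. Fix real numbers $A\ge0$, $B>A+5$ and $\gamma>2A+6$. For every real $K$ there is a constant $C>0$,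 depending only on $A,B,\gamma$ and $K$, such that the following holds for every real $x\ge2$ and every $f\in\mathcal C$. Let $Q=x^{1/2}/(\log x)^B$ and $y=x/(\log x)^\gamma$, and let $\mathcal A$ be the set of all primitive Dirichlet characters of conductor at most $(\log x)^B$. If $$\sum_{q\le Q}\ \max_{a:\,(a,q)=1}|\Delta_{\mathcal A}(f\cdot1_{\mathcal P},X;q,a)|\le K\,\frac{X}{(\log x)^A\log(x/y)}$$ for all real $X$ with $y\le X\le x$ (for the single value $x=e$, where $\log(x/y)=0$, the right-hand side is read as $0$), then $$\sum_{q\le Q}\ \max_{a:\,(a,q)=1}|\Delta_{\mathcal A}(f,x;q,a)|\le C\,\frac{x}{(\log x)^A}.$$ -/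

import Mathlib

/-- The class `𝒞`: multiplicative functions `f` (so `f 1 = 1`) with `|Λ_f(n)| ≤ Λ(n)` for all `n ≥ 1`,
where `-F'(s)/F(s) = ∑ Λ_f(n) n^{-s}` and `F(s) = ∑ f(n) n^{-s}`. Comparing the coefficients of
`-F' = F · ∑ Λ_f(n) n^{-s}`, the function `Λ_f` is determined by `f(n) log n = (f * Λ_f)(n)`, with
`*` the Dirichlet convolution; it exists and is unique because `f 1 = 1`. -/
structure IsClassC (f : ArithmeticFunction ℂ) : Prop where
  isMultiplicative : f.IsMultiplicative
  exists_vonMangoldt : ∃ L : ArithmeticFunction ℂ,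
    (∀ n : ℕ, 1 ≤ n → f n * (Real.log n : ℂ) = (f * L) n) ∧
    ∀ n : ℕ, 1 ≤ n → ‖L n‖ ≤ ArithmeticFunction.vonMangoldt n

/-- `f · 1_𝒫`, the restriction of `f` to the set of primes. -/
noncomputable def restrictPrimes (f : ℕ → ℂ) : ℕ → ℂ :=
  Set.indicator {p : ℕ | p.Prime} f

/-- `S_f(x, χ) = ∑_{n ≤ x} f(n) χ̄(n)`. -/
noncomputable def charSum (f : ℕ → ℂ) (x : ℝ) {q : ℕ} (χ : DirichletCharacter ℂ q) : ℂ :=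
  ∑ n ∈ Finset.Icc 1 ⌊x⌋₊, f n * (starRingEnd ℂ) (χ (n : ZMod q))

/-- `Ξ_q`: the characters mod `q` that are induced by a character in `Ξ`. A member of `Ξ` is a pair
consisting of a level and a character of that level. -/
def inducedChars (Ξ : Set (Σ r : ℕ, DirichletCharacter ℂ r)) (q : ℕ) :
    Set (DirichletCharacter ℂ q) :=
  {χ | ∃ ψ ∈ Ξ, ∃ h : ψ.1 ∣ q, DirichletCharacter.changeLevel h ψ.2 = χ}

open Classical in
/-- `Δ_Ξ(f, x; q, a)`, the sum of `f(n)` over `n ≤ x` with `n ≡ a (mod q)`, minus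
`φ(q)⁻¹ ∑_{χ ∈ Ξ_q} χ(a) S_f(x, χ)`. There are finitely many characters mod `q`, so the sum over
`Ξ_q` is a finite sum. -/
noncomputable def discrepancy (Ξ : Set (Σ r : ℕ, DirichletCharacter ℂ r)) (f : ℕ → ℂ) (x : ℝ)
    (q : ℕ) (a : ZMod q) : ℂ :=
  (∑ n ∈ (Finset.Icc 1 ⌊x⌋₊).filter (fun n : ℕ => (n : ZMod q) = a), f n) -
    (1 / (Nat.totient q : ℂ)) * ∑ᶠ χ ∈ inducedChars Ξ q, χ a * charSum f x χ

/-- `∑_{q ≤ Q} max_{(a,q)=1} |Δ_Ξ(f, x; q, a)|`. For each `q ≥ 1` the supremum is over the finite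
nonempty set of reduced residue classes mod `q`, so it is a maximum. -/
noncomputable def totalDiscrepancy (Ξ : Set (Σ r : ℕ, DirichletCharacter ℂ r)) (Q : ℝ)
    (f : ℕ → ℂ) (x : ℝ) : ℝ :=
  ∑ q ∈ Finset.Icc 1 ⌊Q⌋₊, ⨆ a : (ZMod q)ˣ, ‖discrepancy Ξ f x q (a : ZMod q)‖

/-- The set of all primitive Dirichlet characters of conductor at most `D`. A primitive character
is one whose conductor equals its level. -/
def primitiveCharsUpTo (D : ℝ) : Set (Σ r : ℕ, DirichletCharacter ℂ r) :=
  {ψ | 1 ≤ ψ.1 ∧ (ψ.1 : ℝ) ≤ D ∧ ψ.2.IsPrimitive}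

open Finset

/-! ### The large sieve -/

/-! Put `ℓ = log x` and `D = ℓ ^ B`. For large `ℓ` the integers up to `x` are split by the size of
their largest prime factor, with cut-offs `y = x / ℓ ^ γ` and `z = ℓ ^ (γ + 4)`
(`eq_dirichletConv_add_mediumPart_add_smoothPart`).

Largest prime above `y`. Since `x < y ^ 2`, such a prime is unique and divides `n` once, so this
part of `f` is the convolution of `f` with its restriction to primes above `y`. Multiplication by a
unit mod `q` only permutes the reduced classes, so the discrepancy of the convolution is at most the
sum over `m ≤ x / y` of the discrepancy of the second factor at `x / m`
(`totalDiscrepancy_dirichletConv_largePrimePart_le`). The harmonic sum over `m` costs a factor `log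
(x / y)`, which is what the hypothesis on primes saves.

Largest prime in `(z, y]`. Nothing about `f` at primes is assumed here. By orthogonality the
discrepancy is bounded by a mean of character sums over conductors above `D`
(`totalDiscrepancy_le_largeConductorMean`). The condition `|Λ_f| ≤ Λ` yields `v_p(n) f(n) = ∑ κ(p,
i) f(n / p ^ i)` with `|κ| ≤ 1`; dividing by the number of medium prime factors of `n` turns this
into an exact decomposition into bilinear sums of prime powers against cofactors
(`IsClassC.sum_dirichletConv_eq`). Binary digits separate the variables in `e d ≤ x`
(`hyperbolicSum_eq`), characters are reduced to primitive ones, and Cauchy–Schwarz with the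
multiplicative large sieve bounds everything, up to powers of `ℓ`, by `x / D + x / √z + √(x y)` and
a power-saving term (`IsClassC.largeConductorMean_mediumPart_le`). The lower bounds on `B` and `γ`
make this `O(x / ℓ ^ A)`.

No prime above `z`. Integers whose primes are at most a power of `ℓ` are so sparse, even in residue
classes, that Rankin's bound and trivial estimates suffice (`totalDiscrepancy_smooth_le`).

For bounded `x` the trivial bound `Q x` is absorbed in the constant. -/

/-- `e(θ) = exp(2πiθ)`. -/
noncomputable def circleExp (θ : ℝ) : ℂ := Complex.exp (2 * Real.pi * θ * Complex.I)

lemma circleExp_eq (θ : ℝ) : circleExp θ = Complex.exp (Complex.I * ((2 * Real.pi * θ : ℝ) : ℂ)) := by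
  unfold circleExp; congr 1; push_cast; ring

lemma circleExp_add (θ φ : ℝ) : circleExp (θ + φ) = circleExp θ * circleExp φ := by
  unfold circleExp; rw [← Complex.exp_add]; congr 1; push_cast; ring

lemma circleExp_nat_mul (n : ℕ) (θ : ℝ) : circleExp (n * θ) = circleExp θ ^ n := by
  unfold circleExp; rw [← Complex.exp_nat_mul]; congr 1; push_cast; ring

lemma norm_circleExp (θ : ℝ) : ‖circleExp θ‖ = 1 := by
  rw [circleExp_eq, mul_comm]; exact Complex.norm_exp_ofReal_mul_I _

lemma conj_circleExp (θ : ℝ) : (starRingEnd ℂ) (circleExp θ) = circleExp (-θ) := by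
  unfold circleExp
  rw [← Complex.exp_conj]
  congr 1
  simp [map_ofNat (starRingEnd ℂ) 2]

lemma norm_circleExp_sub_one (θ : ℝ) : ‖circleExp θ - 1‖ = 2 * |Real.sin (Real.pi * θ)| := by
  rw [circleExp_eq, Complex.norm_exp_I_mul_ofReal_sub_one, norm_mul, Real.norm_eq_abs, Real.norm_eq_abs]
  rw [abs_of_pos (by norm_num : (0:ℝ) < 2)]
  congr 3; ring

lemma four_mul_le_norm_circleExp_sub_one {θ : ℝ} (hθ : |θ| ≤ 1 / 2) :
    4 * |θ| ≤ ‖circleExp θ - 1‖ := by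
  rw [norm_circleExp_sub_one]
  have h := Real.mul_abs_le_abs_sin (x := Real.pi * θ) (by
    rw [abs_mul, abs_of_pos Real.pi_pos]; nlinarith [Real.pi_pos])
  rw [abs_mul, abs_of_pos Real.pi_pos] at h
  have : 2 / Real.pi * (Real.pi * |θ|) = 2 * |θ| := by
    field_simp
  linarith

lemma four_mul_one_sub_le_norm_circleExp_sub_one {θ : ℝ} (hθ : 1 / 2 ≤ |θ|) (hθ1 : |θ| ≤ 1) :
    4 * (1 - |θ|) ≤ ‖circleExp θ - 1‖ := by
  rw [norm_circleExp_sub_one]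
  have h0 : |Real.sin (Real.pi * θ)| = |Real.sin (Real.pi * (1 - |θ|))| := by
    rw [mul_sub, mul_one, Real.sin_pi_sub]
    rcases abs_choice θ with h | h <;> rw [h]
    rw [mul_neg, Real.sin_neg, abs_neg]
  have hn : |(1 - |θ|)| = 1 - |θ| := abs_of_nonneg (by linarith)
  have h := Real.mul_abs_le_abs_sin (x := Real.pi * (1 - |θ|)) (by
    rw [abs_mul, abs_of_pos Real.pi_pos, hn]; nlinarith [Real.pi_pos])
  rw [abs_mul, abs_of_pos Real.pi_pos, hn] at h
  have : 2 / Real.pi * (Real.pi * (1 - |θ|)) = 2 * (1 - |θ|) := by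
    field_simp
  rw [h0]
  linarith

lemma norm_sum_circleExp_le (M : ℕ) (θ : ℝ) : ‖∑ u ∈ range M, circleExp (u * θ)‖ ≤ M := by
  refine (norm_sum_le _ _).trans ?_
  simp [norm_circleExp]

lemma norm_sum_circleExp_mul_le (M : ℕ) (θ : ℝ) :
    ‖∑ u ∈ range M, circleExp (u * θ)‖ * ‖circleExp θ - 1‖ ≤ 2 := by
  have h : (∑ u ∈ range M, circleExp (u * θ)) * (circleExp θ - 1) = circleExp θ ^ M - 1 := by
    simp_rw [circleExp_nat_mul]
    exact geom_sum_mul _ _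
  rw [← norm_mul, h]
  refine (norm_sub_le _ _).trans ?_
  rw [norm_pow, norm_circleExp]; norm_num

/-- The geometric sum is at most `2 / ‖e(θ) - 1‖`, and `‖e(θ) - 1‖` is at least four times the
distance from `θ` to the nearest integer. Adding the terms for both candidate distances gives one
bound valid on both sides of `1 / 2`. -/
lemma sq_norm_sum_circleExp_le (M : ℕ) {θ : ℝ} (h0 : 0 < |θ|) (h1 : |θ| < 1) :
    ‖∑ u ∈ range M, circleExp (u * θ)‖ ^ 2 ≤ 1 / (4 * |θ| ^ 2) + 1 / (4 * (1 - |θ|) ^ 2) := by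
  have key : ∀ m : ℝ, 0 < m → 4 * m ≤ ‖circleExp θ - 1‖ →
      ‖∑ u ∈ range M, circleExp (u * θ)‖ ^ 2 ≤ 1 / (4 * m ^ 2) := by
    intro m hm h
    have h2 := norm_sum_circleExp_mul_le M θ
    have h3 : ‖∑ u ∈ range M, circleExp (u * θ)‖ * (4 * m) ≤ 2 :=
      (mul_le_mul_of_nonneg_left h (norm_nonneg _)).trans h2
    rw [le_div_iff₀ (by positivity)]
    have h4 := pow_le_pow_left₀ (by positivity) h3 2
    nlinarith
  rcases le_total |θ| (1 / 2) with h | h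
  · exact (key _ h0 (four_mul_le_norm_circleExp_sub_one h)).trans
      (le_add_of_nonneg_right (by positivity))
  · exact (key _ (by linarith) (four_mul_one_sub_le_norm_circleExp_sub_one h h1.le)).trans
      (le_add_of_nonneg_left (by positivity))

lemma sum_inv_sq_le_two {ι : Type*} (s : Finset ι) (g : ι → ℕ) (hg : Set.InjOn g s) :
    ∑ i ∈ s, 1 / (g i : ℝ) ^ 2 ≤ 2 := by
  classical
  rw [← sum_image (f := fun n : ℕ => 1 / (n : ℝ) ^ 2) hg]
  refine (sum_le_hasSum _ (fun i _ => by positivity) hasSum_zeta_two).trans ?_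
  have := Real.pi_lt_d2
  have := Real.pi_pos
  nlinarith

/-- A row sum of the Fejér kernel. Spaced points lie in distinct cells `⌊N α⌋`, and a point `t`
cells away contributes at most `N ^ 2 / t ^ 2 + N ^ 2 / (N - t) ^ 2`. The diagonal and the points on
either side each give at most `4 N ^ 2`. -/
lemma sum_sq_norm_sum_circleExp_sub_le {ι : Type*} [DecidableEq ι] (s : Finset ι) (α : ι → ℝ) (N : ℕ)
    (hN : 0 < N) (h0 : ∀ i ∈ s, 0 ≤ α i) (h1 : ∀ i ∈ s, α i < 1)
    (hsep : ∀ i ∈ s, ∀ j ∈ s, i ≠ j → 1 / (N : ℝ) ≤ |α i - α j| ∧ |α i - α j| ≤ 1 - 1 / (N : ℝ))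
    (i : ι) (hi : i ∈ s) :
    ∑ j ∈ s, ‖∑ u ∈ range (2 * N), circleExp (u * (α i - α j))‖ ^ 2 ≤ 12 * (N : ℝ) ^ 2 := by
  have hN' : (0 : ℝ) < N := by exact_mod_cast hN
  set k : ι → ℕ := fun j => ⌊N * α j⌋₊ with hk
  have kl : ∀ j ∈ s, (k j : ℝ) ≤ N * α j := fun j hj =>
    Nat.floor_le (mul_nonneg hN'.le (h0 j hj))
  have ku : ∀ j, N * α j < k j + 1 := fun j => Nat.lt_floor_add_one _
  have kN : ∀ j ∈ s, k j < N := fun j hj => by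
    have := kl j hj
    have := h1 j hj
    have : (k j : ℝ) < N := by nlinarith
    exact_mod_cast this
  have hsep' : ∀ a ∈ s, ∀ b ∈ s, a ≠ b → 1 ≤ |N * α a - N * α b| ∧ |N * α a - N * α b| ≤ N - 1 := by
    intro a ha b hb hab
    obtain ⟨h, h'⟩ := hsep a ha b hb hab
    rw [← mul_sub, abs_mul, abs_of_pos hN']
    rw [div_le_iff₀ hN'] at h
    constructor
    · linarith
    · have : (N : ℝ) * |α a - α b| ≤ N * (1 - 1 / N) := by gcongr
      rwa [mul_sub, mul_one, mul_one_div_cancel hN'.ne'] at this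
  have kinj : ∀ a ∈ s, ∀ b ∈ s, k a = k b → a = b := by
    intro a ha b hb hab
    by_contra hne
    have h := (hsep' a ha b hb hne).1
    have h1 := kl a ha; have h2 := kl b hb; have h3 := ku a; have h4 := ku b
    rw [hab] at h1 h3
    have : |N * α a - N * α b| < 1 := by rw [abs_lt]; constructor <;> linarith
    linarith
  -- the basic estimate for two points with `k a < k b`
  have basic : ∀ a ∈ s, ∀ b ∈ s, k a < k b → ∀ θ : ℝ, |θ| = |α a - α b| →
      ‖∑ u ∈ range (2 * N), circleExp (u * θ)‖ ^ 2 ≤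
        (N : ℝ) ^ 2 * (1 / ((k b - k a : ℕ) : ℝ) ^ 2) +
          (N : ℝ) ^ 2 * (1 / ((N - (k b - k a) : ℕ) : ℝ) ^ 2) := by
    intro a ha b hb hab θ hθ
    have hne : a ≠ b := fun h => by rw [h] at hab; exact lt_irrefl _ hab
    obtain ⟨h, h'⟩ := hsep' a ha b hb hne
    have hθN : |N * α a - N * α b| = N * |θ| := by rw [← mul_sub, abs_mul, abs_of_pos hN', hθ]
    rw [hθN] at h h'
    have hh1 := kl a ha; have hh2 := kl b hb; have hh3 := ku a; have hh4 := ku b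
    have hbN := kN b hb
    have hba : N * α b - N * α a ≤ N * |θ| := by
      rw [← hθN, abs_sub_comm]; exact le_abs_self _
    have t0 : (0:ℝ) < ((k b - k a : ℕ) : ℝ) := by exact_mod_cast Nat.sub_pos_of_lt hab
    have t1 : (0:ℝ) < ((N - (k b - k a) : ℕ) : ℝ) := by exact_mod_cast (by omega)
    have c0 : ((k b - k a : ℕ) : ℝ) = k b - k a := by push_cast [hab.le]; ring
    have c1 : ((N - (k b - k a) : ℕ) : ℝ) = N - (k b - k a) := by
      rw [Nat.cast_sub (by omega), c0]
    -- The cell distance exceeds `N |θ|` by less than one, and the separation `1 ≤ N |θ|` absorbs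
    -- this into the factor 2. For the wrap-around distance in `tu` the separation is `1 ≤ N (1 -
    -- |θ|)`.
    have tt : ((k b - k a : ℕ) : ℝ) ≤ 2 * (N * |θ|) := by
      rw [c0]; linarith
    have tu : ((N - (k b - k a) : ℕ) : ℝ) ≤ 2 * (N * (1 - |θ|)) := by
      rw [c1]
      have : N * |θ| ≤ k b - k a + 1 := by
        rw [← hθN, abs_le]
        have : (k a : ℝ) < k b := by exact_mod_cast hab
        constructor <;> linarith
      linarith
    have p0 : 0 < |θ| := by
      by_contra hc
      have : |θ| = 0 := le_antisymm (not_lt.mp hc) (abs_nonneg _)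
      rw [this] at h; linarith
    have p1 : 0 < 1 - |θ| := by
      by_contra hc
      have : (N:ℝ) * (1 - |θ|) ≤ 0 := mul_nonpos_of_nonneg_of_nonpos hN'.le (not_lt.mp hc)
      linarith
    refine (sq_norm_sum_circleExp_le (2 * N) p0 (by linarith)).trans ?_
    have gen : ∀ (T m : ℝ), 0 < T → 0 < m → T ≤ 2 * (N * m) →
        1 / (4 * m ^ 2) ≤ (N:ℝ) ^ 2 * (1 / T ^ 2) := by
      intro T m hT hm hTm
      rw [mul_one_div, div_le_div_iff₀ (by positivity) (by positivity)]
      nlinarith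
    exact add_le_add (gen _ _ t0 p0 tt) (gen _ _ t1 p1 tu)
  have hsplit : s = insert i ((s.filter (fun j => k i < k j)) ∪ (s.filter (fun j => k j < k i))) := by
    ext j
    simp only [mem_insert, mem_union, mem_filter]
    constructor
    · intro hj
      rcases lt_trichotomy (k i) (k j) with h | h | h
      · exact Or.inr (Or.inl ⟨hj, h⟩)
      · exact Or.inl (kinj i hi j hj h).symm
      · exact Or.inr (Or.inr ⟨hj, h⟩)
    · rintro (rfl | ⟨h, -⟩ | ⟨h, -⟩) <;> assumption
  rw [hsplit, sum_insert (by simp), sum_union (by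
    rw [disjoint_left]; intro j hj hj'; simp only [mem_filter] at hj hj'; omega)]
  have e0 : ‖∑ u ∈ range (2 * N), circleExp (u * (α i - α i))‖ ^ 2 ≤ 4 * (N:ℝ) ^ 2 := by
    have := norm_sum_circleExp_le (2 * N) (α i - α i)
    push_cast at this
    nlinarith [norm_nonneg (∑ u ∈ range (2 * N), circleExp (u * (α i - α i)))]
  have injN : ∀ t : Finset ι, t ⊆ s → ∀ g : ι → ℕ,
      (∀ a ∈ t, ∀ b ∈ t, g a = g b → k a = k b) → ∑ j ∈ t, 1 / (g j : ℝ) ^ 2 ≤ 2 := by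
    intro t ht g hg
    refine sum_inv_sq_le_two t g ?_
    intro a ha b hb hab
    exact kinj a (ht ha) b (ht hb) (hg a ha b hb hab)
  have e1 : ∑ j ∈ s.filter (fun j => k i < k j),
      ‖∑ u ∈ range (2 * N), circleExp (u * (α i - α j))‖ ^ 2 ≤ 4 * (N:ℝ) ^ 2 := by
    refine (sum_le_sum (fun j hj => basic i hi j (mem_filter.mp hj).1 (mem_filter.mp hj).2
      (α i - α j) rfl)).trans ?_
    rw [sum_add_distrib, ← mul_sum, ← mul_sum]
    have a1 := injN (s.filter (fun j => k i < k j)) (filter_subset _ _) (fun j => k j - k i) (by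
      intro a ha b hb h; simp only [mem_filter] at ha hb; have := kN a ha.1; have := kN b hb.1
      omega)
    have a2 := injN (s.filter (fun j => k i < k j)) (filter_subset _ _) (fun j => N - (k j - k i)) (by
      intro a ha b hb h; simp only [mem_filter] at ha hb; have := kN a ha.1; have := kN b hb.1
      omega)
    nlinarith [sq_nonneg (N:ℝ)]
  have e2 : ∑ j ∈ s.filter (fun j => k j < k i),
      ‖∑ u ∈ range (2 * N), circleExp (u * (α i - α j))‖ ^ 2 ≤ 4 * (N:ℝ) ^ 2 := by
    refine (sum_le_sum (fun j hj => basic j (mem_filter.mp hj).1 i hi (mem_filter.mp hj).2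
      (α i - α j) (abs_sub_comm _ _))).trans ?_
    rw [sum_add_distrib, ← mul_sum, ← mul_sum]
    have := kN i hi
    have a1 := injN (s.filter (fun j => k j < k i)) (filter_subset _ _) (fun j => k i - k j) (by
      intro a ha b hb h; simp only [mem_filter] at ha hb; omega)
    have a2 := injN (s.filter (fun j => k j < k i)) (filter_subset _ _) (fun j => N - (k i - k j)) (by
      intro a ha b hb h; simp only [mem_filter] at ha hb; omega)
    nlinarith [sq_nonneg (N:ℝ)]
  linarith

/-- A positive-weight count: each `n < N` is a difference `v - u` with `u, v < 2N` at least `N` times. -/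
lemma card_mul_sum_le_sum_sub (N : ℕ) (G : ℤ → ℝ) (hG : ∀ n, 0 ≤ G n) :
    N * ∑ n ∈ range N, G n ≤ ∑ u ∈ range (2 * N), ∑ v ∈ range (2 * N), G ((v : ℤ) - u) := by
  have h1 : N * ∑ n ∈ range N, G n = ∑ u ∈ range N, ∑ n ∈ range N, G n := by simp
  rw [h1]
  refine le_trans (sum_le_sum fun u hu => ?_)
    (sum_le_sum_of_subset_of_nonneg (range_subset_range.mpr (by omega)) fun u _ _ =>
      sum_nonneg fun v _ => hG _)
  have h2 : ∑ n ∈ range N, G n = ∑ v ∈ (range N).image (fun n => n + u), G ((v:ℤ) - u) := by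
    rw [sum_image (by intro a _ b _ h; simpa using h)]
    refine sum_congr rfl fun n _ => ?_
    congr 1; push_cast; ring
  rw [h2]
  refine sum_le_sum_of_subset_of_nonneg ?_ fun v _ _ => hG _
  intro v hv
  simp only [mem_image, mem_range] at hv hu ⊢
  obtain ⟨n, hn, rfl⟩ := hv
  omega

/-- Averaging over differences `v - u` majorizes the sum over `n` by one with Fejér weights. Its
expanded square has the nonnegative symmetric kernel `K i j`, so `2 ‖c i‖ ‖c j‖ ≤ ‖c i‖ ^ 2 + ‖c j‖
^ 2` (Schur's test) reduces the bound to row sums. -/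
lemma dual_large_sieve {ι : Type*} (s : Finset ι) (α : ι → ℝ) (N : ℕ)
    (hN : 0 < N) (h0 : ∀ i ∈ s, 0 ≤ α i) (h1 : ∀ i ∈ s, α i < 1)
    (hsep : ∀ i ∈ s, ∀ j ∈ s, i ≠ j → 1 / (N : ℝ) ≤ |α i - α j| ∧ |α i - α j| ≤ 1 - 1 / (N : ℝ))
    (c : ι → ℂ) :
    ∑ n ∈ range N, ‖∑ i ∈ s, c i * circleExp (n * α i)‖ ^ 2 ≤ 12 * N * ∑ i ∈ s, ‖c i‖ ^ 2 := by
  classical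
  have hN' : (0 : ℝ) < N := by exact_mod_cast hN
  have hw := card_mul_sum_le_sum_sub N (fun n => ‖∑ i ∈ s, c i * circleExp (n * α i)‖ ^ 2)
    (fun n => by positivity)
  simp only [Int.cast_natCast, Int.cast_sub] at hw
  -- expand the square
  have hexp : ((∑ u ∈ range (2 * N), ∑ v ∈ range (2 * N),
      ‖∑ i ∈ s, c i * circleExp (((v:ℝ) - u) * α i)‖ ^ 2 : ℝ) : ℂ) =
      ∑ i ∈ s, ∑ j ∈ s, c i * (starRingEnd ℂ) (c j) *
        ((‖∑ u ∈ range (2 * N), circleExp (u * (α i - α j))‖ ^ 2 : ℝ) : ℂ) := by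
    have hsq : ∀ w : ℂ, ((‖w‖ ^ 2 : ℝ) : ℂ) = w * (starRingEnd ℂ) w := fun w => by
      rw [Complex.mul_conj, Complex.normSq_eq_norm_sq]
    rw [Complex.ofReal_sum]
    simp_rw [Complex.ofReal_sum, hsq, map_sum, map_mul, conj_circleExp, sum_mul_sum]
    rw [sum_congr rfl fun u _ => sum_comm, sum_comm]
    refine sum_congr rfl fun i _ => ?_
    rw [sum_congr rfl fun u _ => sum_comm, sum_comm]
    refine sum_congr rfl fun j _ => ?_
    rw [sum_comm, mul_sum]
    refine sum_congr rfl fun u _ => ?_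
    rw [mul_sum]
    refine sum_congr rfl fun v _ => ?_
    rw [mul_mul_mul_comm, ← circleExp_add, ← circleExp_add]
    congr 2; ring
  have hle : ∑ u ∈ range (2 * N), ∑ v ∈ range (2 * N),
      ‖∑ i ∈ s, c i * circleExp (((v:ℝ) - u) * α i)‖ ^ 2 ≤ 12 * (N:ℝ) ^ 2 * ∑ i ∈ s, ‖c i‖ ^ 2 := by
    set K : ι → ι → ℝ := fun i j => ‖∑ u ∈ range (2 * N), circleExp (u * (α i - α j))‖ ^ 2 with hK
    have hKs : ∀ i j, K i j = K j i := fun i j => by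
      simp only [hK]
      congr 1
      rw [← Complex.norm_conj, map_sum]
      congr 1
      refine sum_congr rfl fun u _ => ?_
      rw [conj_circleExp]; congr 1; ring
    have hK0 : ∀ i j, 0 ≤ K i j := fun i j => by positivity
    have : ∑ u ∈ range (2 * N), ∑ v ∈ range (2 * N),
      ‖∑ i ∈ s, c i * circleExp (((v:ℝ) - u) * α i)‖ ^ 2 ≤
        ∑ i ∈ s, ∑ j ∈ s, ‖c i‖ * ‖c j‖ * K i j := by
      have h := congrArg norm hexp
      rw [Complex.norm_real, Real.norm_of_nonneg (by positivity)] at h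
      rw [h]
      refine (norm_sum_le _ _).trans (sum_le_sum fun i _ => (norm_sum_le _ _).trans
        (sum_le_sum fun j _ => ?_))
      rw [norm_mul, norm_mul, Complex.norm_conj, Complex.norm_real, Real.norm_of_nonneg (hK0 i j)]
    refine this.trans ?_
    have h2 : ∑ i ∈ s, ∑ j ∈ s, ‖c i‖ * ‖c j‖ * K i j ≤
        ∑ i ∈ s, ∑ j ∈ s, (‖c i‖ ^ 2 * K i j / 2 + ‖c j‖ ^ 2 * K i j / 2) := by
      refine sum_le_sum fun i _ => sum_le_sum fun j _ => ?_
      nlinarith [mul_nonneg (sq_nonneg (‖c i‖ - ‖c j‖)) (hK0 i j)]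
    refine h2.trans ?_
    have h3 : ∑ i ∈ s, ∑ j ∈ s, ‖c j‖ ^ 2 * K i j / 2 = ∑ i ∈ s, ∑ j ∈ s, ‖c i‖ ^ 2 * K i j / 2 := by
      rw [sum_comm]
      exact sum_congr rfl fun i _ => sum_congr rfl fun j _ => by rw [hKs]
    simp_rw [sum_add_distrib]
    rw [h3, ← sum_add_distrib, mul_sum]
    refine sum_le_sum fun i hi => ?_
    have h4 := sum_sq_norm_sum_circleExp_sub_le s α N hN h0 h1 hsep i hi
    have h5 : ∑ j ∈ s, ‖c i‖ ^ 2 * K i j / 2 = ‖c i‖ ^ 2 / 2 * ∑ j ∈ s, K i j := by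
      rw [mul_sum]; exact sum_congr rfl fun j _ => by ring
    rw [h5]
    nlinarith [sq_nonneg ‖c i‖]
  have h6 := hw.trans hle
  have h7 : (N:ℝ) * ∑ n ∈ range N, ‖∑ i ∈ s, c i * circleExp (n * α i)‖ ^ 2 ≤
      N * (12 * N * ∑ i ∈ s, ‖c i‖ ^ 2) := by
    calc _ ≤ _ := h6
      _ = _ := by ring
  exact le_of_mul_le_mul_left h7 hN'

/-- Duality: expand one factor of each `‖S i‖ ^ 2`, apply Cauchy–Schwarz in `n`, and use the dual
inequality with coefficients the conjugates of `S i`. This gives `T ^ 2 ≤ A * (12 N T)`, and one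
factor `T` cancels. -/
lemma additive_large_sieve {ι : Type*} (s : Finset ι) (α : ι → ℝ) (N : ℕ)
    (hN : 0 < N) (h0 : ∀ i ∈ s, 0 ≤ α i) (h1 : ∀ i ∈ s, α i < 1)
    (hsep : ∀ i ∈ s, ∀ j ∈ s, i ≠ j → 1 / (N : ℝ) ≤ |α i - α j| ∧ |α i - α j| ≤ 1 - 1 / (N : ℝ))
    (a : ℕ → ℂ) :
    ∑ i ∈ s, ‖∑ n ∈ range N, a n * circleExp (n * α i)‖ ^ 2 ≤ 12 * N * ∑ n ∈ range N, ‖a n‖ ^ 2 := by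
  set S : ι → ℂ := fun i => ∑ n ∈ range N, a n * circleExp (n * α i) with hS
  set T := ∑ i ∈ s, ‖S i‖ ^ 2 with hT
  set A := ∑ n ∈ range N, ‖a n‖ ^ 2 with hA
  have hT0 : 0 ≤ T := by positivity
  have hA0 : 0 ≤ A := by positivity
  have hTe : (T : ℂ) = ∑ n ∈ range N, a n * ∑ i ∈ s, (starRingEnd ℂ) (S i) * circleExp (n * α i) := by
    rw [hT, Complex.ofReal_sum]
    simp_rw [mul_sum]
    rw [sum_comm]
    refine sum_congr rfl fun i _ => ?_
    rw [← Complex.normSq_eq_norm_sq, Complex.normSq_eq_conj_mul_self, mul_comm]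
    conv_lhs => rw [hS]
    simp only
    rw [sum_mul]
    exact sum_congr rfl fun n _ => by ring
  have hd := dual_large_sieve s α N hN h0 h1 hsep (fun i => (starRingEnd ℂ) (S i))
  simp only [Complex.norm_conj] at hd
  have hle : T ≤ ∑ n ∈ range N, ‖a n‖ * ‖∑ i ∈ s, (starRingEnd ℂ) (S i) * circleExp (n * α i)‖ := by
    have h := congrArg norm hTe
    rw [Complex.norm_real, Real.norm_of_nonneg hT0] at h
    rw [h]
    exact (norm_sum_le _ _).trans (sum_le_sum fun n _ => (norm_mul _ _).le)
  have hcs := sum_mul_sq_le_sq_mul_sq (range N) (fun n => ‖a n‖)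
    (fun n => ‖∑ i ∈ s, (starRingEnd ℂ) (S i) * circleExp (n * α i)‖)
  have h2 : T ^ 2 ≤ A * (12 * N * T) :=
    (pow_le_pow_left₀ hT0 hle 2).trans (hcs.trans (mul_le_mul_of_nonneg_left hd hA0))
  rcases hT0.eq_or_lt with h | h
  · rw [← h]; positivity
  · have : T * T ≤ T * (12 * N * A) := by nlinarith
    exact le_of_mul_le_mul_left this h

/-- The integer `h s - k r` is nonzero and has absolute value at most `r s - 1`; divide by `r s ≤ R
^ 2 ≤ N`. The upper bound is the separation across the endpoint of the circle. -/
lemma sep_of_reduced_fractions {R N r s h k : ℕ} (hRN : R ^ 2 ≤ N) (hr : 1 ≤ r)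
    (hrR : r ≤ R) (hs : 1 ≤ s) (hsR : s ≤ R) (hhr : h < r) (hks : k < s) (hc : h.Coprime r)
    (kc : k.Coprime s) (hne : (r, h) ≠ (s, k)) :
    1 / (N : ℝ) ≤ |(h : ℝ) / r - k / s| ∧ |(h : ℝ) / r - k / s| ≤ 1 - 1 / (N : ℝ) := by
  have hr' : (0 : ℝ) < r := by exact_mod_cast hr
  have hs' : (0 : ℝ) < s := by exact_mod_cast hs
  have hrsN : (r : ℝ) * s ≤ N := by
    have : r * s ≤ N := (Nat.mul_le_mul hrR hsR).trans (by nlinarith)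
    exact_mod_cast this
  have hinv : 1 / (N : ℝ) ≤ 1 / (r * s) := one_div_le_one_div_of_le (by positivity) hrsN
  have hcross : (h : ℤ) * s ≠ k * r := by
    intro h0
    have h0' : h * s = k * r := by exact_mod_cast h0
    have d1 : r ∣ s := (hc.symm.dvd_of_dvd_mul_left (Dvd.intro_left k h0'.symm))
    have d2 : s ∣ r := (kc.symm.dvd_of_dvd_mul_left (Dvd.intro_left h h0'))
    have e : r = s := Nat.dvd_antisymm d1 d2
    subst e
    have : h = k := Nat.eq_of_mul_eq_mul_right (by omega) h0'
    subst this
    exact hne rfl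
  have hz1 : 1 ≤ |(h : ℤ) * s - k * r| := Int.one_le_abs (sub_ne_zero.mpr hcross)
  have hz2 : |(h : ℤ) * s - k * r| ≤ r * s - 1 := by
    have a1 : (h : ℤ) + 1 ≤ r := by exact_mod_cast hhr
    have a2 : (k : ℤ) + 1 ≤ s := by exact_mod_cast hks
    have : (0:ℤ) ≤ h := by positivity
    have : (0:ℤ) ≤ k := by positivity
    have : (1:ℤ) ≤ s := by exact_mod_cast hs
    have : (1:ℤ) ≤ r := by exact_mod_cast hr
    rw [abs_le]; constructor <;> nlinarith
  have hz1' : (1:ℝ) ≤ |(h : ℝ) * s - k * r| := by exact_mod_cast hz1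
  have hz2' : |(h : ℝ) * s - k * r| ≤ r * s - 1 := by exact_mod_cast hz2
  have he : |(h : ℝ) / r - k / s| = |(h : ℝ) * s - k * r| / (r * s) := by
    rw [div_sub_div _ _ hr'.ne' hs'.ne', abs_div, abs_of_pos (mul_pos hr' hs'), mul_comm (r:ℝ) k]
  rw [he]
  constructor
  · exact hinv.trans (div_le_div_of_nonneg_right hz1' (by positivity))
  · calc _ ≤ ((r:ℝ) * s - 1) / (r * s) := div_le_div_of_nonneg_right hz2' (by positivity)
      _ = 1 - 1 / (r * s) := by field_simp
      _ ≤ _ := by linarith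

/-! ### Orthogonality, Gauss sums and the multiplicative large sieve. -/

lemma conj_dirichletCharacter_apply_unit {r : ℕ} [NeZero r] (χ : DirichletCharacter ℂ r)
    (u : (ZMod r)ˣ) : (starRingEnd ℂ) (χ u) = χ ((u : ZMod r)⁻¹) := by
  have h1 : χ ((u : ZMod r)⁻¹) * χ u = 1 := by
    rw [← map_mul, ZMod.inv_mul_of_unit _ u.isUnit, map_one]
  have h2 : ‖χ u‖ = 1 := χ.unit_norm_eq_one u
  have h3 : (starRingEnd ℂ) (χ u) * χ u = 1 := by
    rw [← Complex.normSq_eq_conj_mul_self, Complex.normSq_eq_norm_sq, h2]; norm_num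
  have h4 : χ u ≠ 0 := by intro h; rw [h] at h2; norm_num at h2
  exact mul_right_cancel₀ h4 (h3.trans h1.symm)

lemma sum_dirichletCharacter_mul_conj {r : ℕ} [NeZero r] (u v : (ZMod r)ˣ) :
    ∑ χ : DirichletCharacter ℂ r, χ u * (starRingEnd ℂ) (χ v) =
      if u = v then (r.totient : ℂ) else 0 := by
  have h := DirichletCharacter.sum_char_inv_mul_char_eq ℂ v.isUnit (u : ZMod r)
  simp_rw [conj_dirichletCharacter_apply_unit]
  rw [sum_congr rfl fun χ _ => mul_comm _ _, h]
  simp only [Units.val_inj, eq_comm]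

lemma sum_sq_norm_dirichletCharacter_sum {r : ℕ} [NeZero r] (S : ZMod r → ℂ) :
    ∑ χ : DirichletCharacter ℂ r, ‖∑ u : (ZMod r)ˣ, χ u * S u‖ ^ 2 =
      r.totient * ∑ u : (ZMod r)ˣ, ‖S u‖ ^ 2 := by
  have hsq : ∀ w : ℂ, ((‖w‖ ^ 2 : ℝ) : ℂ) = w * (starRingEnd ℂ) w := fun w => by
    rw [Complex.mul_conj, Complex.normSq_eq_norm_sq]
  have h : ((∑ χ : DirichletCharacter ℂ r, ‖∑ u : (ZMod r)ˣ, χ u * S u‖ ^ 2 : ℝ) : ℂ) =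
      ((r.totient * ∑ u : (ZMod r)ˣ, ‖S u‖ ^ 2 : ℝ) : ℂ) := by
    rw [Complex.ofReal_mul, Complex.ofReal_sum, Complex.ofReal_sum]
    simp_rw [hsq, map_sum, map_mul, sum_mul_sum]
    rw [sum_comm, mul_sum]
    refine sum_congr rfl fun u _ => ?_
    rw [sum_comm]
    have : ∀ v : (ZMod r)ˣ, ∑ χ : DirichletCharacter ℂ r,
        χ u * S u * ((starRingEnd ℂ) (χ v) * (starRingEnd ℂ) (S v)) =
        (if u = v then (r.totient : ℂ) else 0) * (S u * (starRingEnd ℂ) (S v)) := by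
      intro v
      rw [← sum_dirichletCharacter_mul_conj, sum_mul]
      exact sum_congr rfl fun χ _ => by ring
    simp_rw [this]
    simp
  exact_mod_cast h

lemma sum_dirichletCharacter_mul_eq_sum_units {r : ℕ} [NeZero r] (χ : DirichletCharacter ℂ r)
    (S : ZMod r → ℂ) : ∑ b : ZMod r, χ b * S b = ∑ u : (ZMod r)ˣ, χ u * S u := by
  classical
  rw [← sum_filter_add_sum_filter_not univ (fun b : ZMod r => IsUnit b)]
  rw [sum_eq_zero (s := univ.filter fun b : ZMod r => ¬ IsUnit b), add_zero]
  · symm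
    refine sum_bij (fun u _ => (u : ZMod r)) ?_ ?_ ?_ ?_
    · intro u _; simp
    · intro u _ v _ h; exact Units.ext h
    · intro b hb
      exact ⟨(mem_filter.mp hb).2.unit, mem_univ _, rfl⟩
    · intro u _; rfl
  · intro b hb
    rw [χ.map_nonunit (mem_filter.mp hb).2, zero_mul]

/-- The mean square of the shifted Gauss sums is computed twice: orthogonality of additive
characters gives `r φ(r)`, and primitivity, which factors the `n`-th sum as `χ⁻¹ n` times the
unshifted one, gives `‖τ(χ)‖ ^ 2 φ(r)`. -/
lemma sq_norm_gaussSum_of_isPrimitive {r : ℕ} [NeZero r] {χ : DirichletCharacter ℂ r}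
    (hχ : χ.IsPrimitive) : ‖gaussSum χ ZMod.stdAddChar‖ ^ 2 = r := by
  have hsq : ∀ w : ℂ, ((‖w‖ ^ 2 : ℝ) : ℂ) = w * (starRingEnd ℂ) w := fun w => by
    rw [Complex.mul_conj, Complex.normSq_eq_norm_sq]
  have hψ := ZMod.isPrimitive_stdAddChar r
  have hu : ∀ χ : DirichletCharacter ℂ r, ∑ n : ZMod r, ‖χ n‖ ^ 2 = r.totient := by
    intro χ
    have h := sum_dirichletCharacter_mul_eq_sum_units χ (fun b => (starRingEnd ℂ) (χ b))
    simp_rw [← hsq] at h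
    have h2 : ∑ n : ZMod r, ‖χ n‖ ^ 2 = ∑ u : (ZMod r)ˣ, ‖χ u‖ ^ 2 := by exact_mod_cast h
    rw [h2]
    simp_rw [χ.unit_norm_eq_one]
    simp [ZMod.card_units_eq_totient]
  have h1 : ∑ n : ZMod r, ‖gaussSum χ (ZMod.stdAddChar.mulShift n)‖ ^ 2 = r * r.totient := by
    rw [← hu χ]
    have : ((∑ n : ZMod r, ‖gaussSum χ (ZMod.stdAddChar.mulShift n)‖ ^ 2 : ℝ) : ℂ) =
        ((r * ∑ n : ZMod r, ‖χ n‖ ^ 2 : ℝ) : ℂ) := by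
      rw [Complex.ofReal_mul, Complex.ofReal_sum, Complex.ofReal_sum]
      simp_rw [hsq, gaussSum, map_sum, map_mul, sum_mul_sum]
      rw [sum_comm, mul_sum]
      refine sum_congr rfl fun b _ => ?_
      rw [sum_comm]
      have : ∀ c : ZMod r, ∑ n : ZMod r, χ b * (ZMod.stdAddChar.mulShift n) b *
          ((starRingEnd ℂ) (χ c) * (starRingEnd ℂ) ((ZMod.stdAddChar.mulShift n) c)) =
          (χ b * (starRingEnd ℂ) (χ c)) * (if b - c = 0 then (r : ℂ) else 0) := by
        intro c
        have h := AddChar.sum_mulShift (b - c) hψ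
        rw [ZMod.card] at h
        have h' : (if b - c = 0 then (r : ℂ) else 0) = ∑ x : ZMod r, ZMod.stdAddChar (x * (b - c)) := by
          rw [h]; split_ifs <;> simp
        rw [h', mul_sum]
        refine sum_congr rfl fun n _ => ?_
        rw [AddChar.mulShift_apply, AddChar.mulShift_apply, ← AddChar.map_neg_eq_conj, mul_sub,
          sub_eq_add_neg, AddChar.map_add_eq_mul]
        ring
      simp_rw [this, sub_eq_zero]
      simp [mul_comm]
    exact_mod_cast this
  have h2 : ∑ n : ZMod r, ‖gaussSum χ (ZMod.stdAddChar.mulShift n)‖ ^ 2 =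
      ‖gaussSum χ ZMod.stdAddChar‖ ^ 2 * r.totient := by
    simp_rw [gaussSum_mulShift_of_isPrimitive _ hχ, norm_mul, mul_pow]
    rw [← sum_mul, hu χ⁻¹, mul_comm]
  have hφ : (0 : ℝ) < r.totient := by exact_mod_cast Nat.totient_pos.mpr (NeZero.pos r)
  exact mul_right_cancel₀ hφ.ne' (h2.symm.trans h1)

lemma conj_dirichletCharacter_apply {r : ℕ} [NeZero r] (χ : DirichletCharacter ℂ r) (b : ZMod r) :
    (starRingEnd ℂ) (χ b) = χ⁻¹ b := MulChar.star_apply' χ b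

open Classical in
/-- The primitive Dirichlet characters mod `r`. -/
noncomputable def primitiveChars (r : ℕ) : Finset (DirichletCharacter ℂ r) :=
  univ.filter (fun χ => χ.IsPrimitive)

lemma mem_primitiveChars {r : ℕ} {χ : DirichletCharacter ℂ r} :
    χ ∈ primitiveChars r ↔ χ.IsPrimitive := by
  simp [primitiveChars]

/-- For primitive `χ` the Gauss sum converts `χ̄(n)` into a combination of additive characters, with
`‖τ(χ)‖ ^ 2 = r`. By positivity the sum may then be extended to all characters mod `r`, where
Parseval applies. -/
lemma primitive_sum_le_sum_units {r : ℕ} [NeZero r] (N : ℕ) (a : ℕ → ℂ) :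
    (r : ℝ) * ∑ χ ∈ primitiveChars r,
      ‖∑ n ∈ range N, a n * (starRingEnd ℂ) (χ (n : ZMod r))‖ ^ 2 ≤
    r.totient * ∑ u : (ZMod r)ˣ,
      ‖∑ n ∈ range N, a n * ZMod.stdAddChar ((n : ZMod r) * (u : ZMod r))‖ ^ 2 := by
  rw [← sum_sq_norm_dirichletCharacter_sum
    (fun b => ∑ n ∈ range N, a n * ZMod.stdAddChar ((n : ZMod r) * b)), mul_sum]
  refine le_trans (sum_le_sum fun χ hχ => le_of_eq ?_)
    (sum_le_sum_of_subset_of_nonneg (subset_univ _) fun χ _ _ => by positivity)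
  have hp := mem_primitiveChars.mp hχ
  rw [← sum_dirichletCharacter_mul_eq_sum_units χ
    (fun b => ∑ n ∈ range N, a n * ZMod.stdAddChar ((n : ZMod r) * b)),
    ← sq_norm_gaussSum_of_isPrimitive hp, ← mul_pow, ← norm_mul]
  congr 2
  simp_rw [mul_sum]
  rw [sum_comm]
  refine sum_congr rfl fun n _ => ?_
  have h := gaussSum_mulShift_of_isPrimitive ZMod.stdAddChar hp (n : ZMod r)
  rw [conj_dirichletCharacter_apply, mul_left_comm, mul_comm (gaussSum χ _), ← h, gaussSum, mul_sum]
  refine sum_congr rfl fun b _ => ?_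
  rw [AddChar.mulShift_apply]
  ring

lemma stdAddChar_natCast_mul {r : ℕ} [NeZero r] (n : ℕ) (b : ZMod r) :
    ZMod.stdAddChar ((n : ZMod r) * b) = circleExp (n * ((b.val : ℝ) / r)) := by
  have : (n : ZMod r) * b = (((n * b.val : ℕ) : ℤ) : ZMod r) := by
    push_cast; rw [ZMod.natCast_zmod_val]
  rw [this, ZMod.stdAddChar_coe]
  unfold circleExp
  congr 1
  push_cast
  ring

lemma sum_units_eq_sum_coprime {r : ℕ} [NeZero r] (F : ℕ → ℝ) :
    ∑ u : (ZMod r)ˣ, F (u : ZMod r).val = ∑ h ∈ (range r).filter (fun h => h.Coprime r), F h := by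
  refine sum_bij (fun u _ => (u : ZMod r).val) ?_ ?_ ?_ ?_
  · intro u _
    simp only [mem_filter, mem_range]
    exact ⟨ZMod.val_lt _, ZMod.val_coe_unit_coprime u⟩
  · intro u _ v _ h
    exact Units.ext (ZMod.val_injective r h)
  · intro h hh
    simp only [mem_filter, mem_range] at hh
    exact ⟨ZMod.unitOfCoprime h hh.2, mem_univ _, by
      rw [ZMod.coe_unitOfCoprime, ZMod.val_natCast_of_lt hh.1]⟩
  · intro u _; rfl

/-- The additive sieve is applied at the reduced fractions `h / r` with `r ≤ R`, which
`sep_of_reduced_fractions` shows to be `1 / N`-spaced on the circle. -/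
theorem multiplicative_large_sieve (R N : ℕ) (hN : 0 < N) (hRN : R ^ 2 ≤ N) (a : ℕ → ℂ) :
    ∑ r ∈ Icc 1 R, (r : ℝ) / r.totient * ∑ χ ∈ primitiveChars r,
      ‖∑ n ∈ range N, a n * (starRingEnd ℂ) (χ (n : ZMod r))‖ ^ 2 ≤
      12 * N * ∑ n ∈ range N, ‖a n‖ ^ 2 := by
  set s : Finset (Σ _ : ℕ, ℕ) := (Icc 1 R).sigma fun r => (range r).filter (fun h => h.Coprime r)
  have mem : ∀ i ∈ s, 1 ≤ i.1 ∧ i.1 ≤ R ∧ i.2 < i.1 ∧ i.2.Coprime i.1 := by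
    intro i hi
    simp only [s, mem_sigma, mem_Icc, mem_filter, mem_range] at hi
    exact ⟨hi.1.1, hi.1.2, hi.2.1, hi.2.2⟩
  have hls := additive_large_sieve s (fun i => (i.2 : ℝ) / i.1) N hN
    (fun i _ => by positivity)
    (fun i hi => by
      obtain ⟨h1, -, h3, -⟩ := mem i hi
      rw [div_lt_one (by exact_mod_cast h1)]; exact_mod_cast h3)
    (fun i hi j hj hij => by
      obtain ⟨h1, h2, h3, h4⟩ := mem i hi
      obtain ⟨k1, k2, k3, k4⟩ := mem j hj
      refine sep_of_reduced_fractions hRN h1 h2 k1 k2 h3 k3 h4 k4 ?_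
      intro h
      simp only [Prod.mk.injEq] at h
      exact hij (Sigma.ext h.1 (heq_of_eq h.2))) a
  refine le_trans ?_ hls
  rw [sum_sigma]
  refine sum_le_sum fun r hr => ?_
  have hr1 := (mem_Icc.mp hr).1
  have : NeZero r := ⟨by omega⟩
  have hφ : (0 : ℝ) < r.totient := by exact_mod_cast Nat.totient_pos.mpr (NeZero.pos r)
  have h := primitive_sum_le_sum_units (r := r) N a
  simp_rw [stdAddChar_natCast_mul] at h
  rw [sum_units_eq_sum_coprime (r := r)
    (fun b => ‖∑ n ∈ range N, a n * circleExp (n * ((b : ℝ) / r))‖ ^ 2)] at h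
  rw [div_mul_eq_mul_div, div_le_iff₀ hφ, mul_comm _ (r.totient : ℝ)]
  exact h

/-! ### Bilinear character sums over primitive characters -/

/-- `∑_{n < N} a(n) χ̄(n)`. -/
noncomputable def conjCharSum (N : ℕ) (a : ℕ → ℂ) {r : ℕ} (χ : DirichletCharacter ℂ r) : ℂ :=
  ∑ n ∈ range N, a n * (starRingEnd ℂ) (χ (n : ZMod r))

/-- The `ℓ²` norm of `a` on `[0, N)`. -/
noncomputable def ell2Norm (N : ℕ) (a : ℕ → ℂ) : ℝ := √(∑ n ∈ range N, ‖a n‖ ^ 2)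

lemma ell2Norm_nonneg (N : ℕ) (a : ℕ → ℂ) : 0 ≤ ell2Norm N a := Real.sqrt_nonneg _

lemma sq_ell2Norm (N : ℕ) (a : ℕ → ℂ) : ell2Norm N a ^ 2 = ∑ n ∈ range N, ‖a n‖ ^ 2 :=
  Real.sq_sqrt (by positivity)

lemma ell2Norm_mono {N : ℕ} {a b : ℕ → ℂ} (h : ∀ n, ‖a n‖ ≤ ‖b n‖) :
    ell2Norm N a ≤ ell2Norm N b :=
  Real.sqrt_le_sqrt (sum_le_sum fun n _ => pow_le_pow_left₀ (norm_nonneg _) (h n) 2)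

/-- The condition `R ^ 2 ≤ N` is removed by extending `a` by zero to length `max (R ^ 2) N`, which
is at most `(R + √N) ^ 2`. The square form suits Cauchy–Schwarz. -/
lemma large_sieve_conjCharSum (R N : ℕ) (hR : 1 ≤ R) (a : ℕ → ℂ) :
    ∑ r ∈ Icc 1 R, (r : ℝ) / r.totient * ∑ χ ∈ primitiveChars r, ‖conjCharSum N a χ‖ ^ 2 ≤
      12 * (R + √N) ^ 2 * ell2Norm N a ^ 2 := by
  classical
  set K := max (R ^ 2) N with hK
  have hK1 : R ^ 2 ≤ K := le_max_left _ _
  have hK2 : N ≤ K := le_max_right _ _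
  have h := multiplicative_large_sieve R K (by nlinarith) hK1 (fun n => if n < N then a n else 0)
  have e : ∀ G : ℕ → ℂ, ∑ n ∈ range K, (if n < N then a n else 0) * G n =
      ∑ n ∈ range N, a n * G n := by
    intro G
    simp_rw [ite_mul, zero_mul]
    rw [← sum_filter]
    congr 1
    ext n; simp only [mem_filter, mem_range]; omega
  have e2 : ∑ n ∈ range K, ‖(if n < N then a n else 0)‖ ^ 2 = ell2Norm N a ^ 2 := by
    rw [sq_ell2Norm]
    have : ∀ n, ‖(if n < N then a n else 0)‖ ^ 2 = if n < N then ‖a n‖ ^ 2 else 0 := by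
      intro n; split_ifs <;> simp
    simp_rw [this]
    rw [← sum_filter]
    congr 1
    ext n; simp only [mem_filter, mem_range]; omega
  rw [e2] at h
  simp_rw [e] at h
  refine h.trans (mul_le_mul_of_nonneg_right ?_ (by positivity))
  have hKR : (K : ℝ) ≤ (R + √N) ^ 2 := by
    have hs := Real.sq_sqrt (Nat.cast_nonneg (α := ℝ) N)
    have hs0 := Real.sqrt_nonneg (N : ℝ)
    rw [hK]; push_cast
    refine max_le ?_ ?_ <;> nlinarith [Nat.cast_nonneg (α := ℝ) R, mul_nonneg (Nat.cast_nonneg (α := ℝ) R) hs0]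
  linarith

/-- The weighted mean value over primitive characters of the product of two character sums, over
moduli in a dyadic block. -/
lemma bilinear_block (S : Finset ℕ) {ρ : ℝ} (hρ : 1 / 2 ≤ ρ) (hS : ∀ r ∈ S, ρ < r ∧ (r : ℝ) ≤ 2 * ρ)
    (M N : ℕ) (a b : ℕ → ℂ) :
    ∑ r ∈ S, (1 : ℝ) / r.totient * ∑ χ ∈ primitiveChars r,
      ‖conjCharSum M a χ‖ * ‖conjCharSum N b χ‖ ≤
      12 * (4 * ρ + 2 * √M + 2 * √N + √M * √N / ρ) * (ell2Norm M a * ell2Norm N b) := by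
  have hρ0 : 0 < ρ := by linarith
  set R := ⌊2 * ρ⌋₊ with hR
  have hR1 : 1 ≤ R := Nat.le_floor (by push_cast; linarith)
  have hR2 : (R : ℝ) ≤ 2 * ρ := Nat.floor_le (by linarith)
  have hsub : S ⊆ Icc 1 R := by
    intro r hr
    obtain ⟨h1, h2⟩ := hS r hr
    refine mem_Icc.mpr ⟨?_, Nat.le_floor h2⟩
    have : (0:ℝ) < r := by linarith
    exact_mod_cast this
  set A : ∀ r : ℕ, DirichletCharacter ℂ r → ℝ := fun r χ => ‖conjCharSum M a χ‖
  set B : ∀ r : ℕ, DirichletCharacter ℂ r → ℝ := fun r χ => ‖conjCharSum N b χ‖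
  have e1 : ∑ r ∈ S, (1 : ℝ) / r.totient * ∑ χ ∈ primitiveChars r, A r χ * B r χ ≤
      1 / ρ * ∑ i ∈ (Icc 1 R).sigma primitiveChars,
        (√((i.1 : ℝ) / i.1.totient) * A i.1 i.2) * (√((i.1 : ℝ) / i.1.totient) * B i.1 i.2) := by
    rw [sum_sigma, mul_sum]
    refine le_trans (sum_le_sum fun r hr => ?_)
      (sum_le_sum_of_subset_of_nonneg hsub fun r _ _ => by positivity)
    rw [mul_sum, mul_sum]
    refine sum_le_sum fun χ _ => ?_
    have hs : √((r : ℝ) / r.totient) * √((r : ℝ) / r.totient) = (r : ℝ) / r.totient :=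
      Real.mul_self_sqrt (by positivity)
    -- Since `r > ρ` on the block, the weight `1 / φ(r)` can be traded for the sieve weight `r /
    -- φ(r)` at the price of `1 / ρ`.
    have : (1:ℝ) / r.totient ≤ 1 / ρ * ((r : ℝ) / r.totient) := by
      have h1 := (hS r hr).1
      have : (1:ℝ) ≤ r / ρ := by rw [le_div_iff₀ hρ0]; linarith
      calc (1:ℝ) / r.totient ≤ (r / ρ) / r.totient := by gcongr
        _ = _ := by rw [one_div_mul_eq_div, div_right_comm]
    calc (1:ℝ) / r.totient * (A r χ * B r χ)
        ≤ (1 / ρ * ((r : ℝ) / r.totient)) * (A r χ * B r χ) := by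
          refine mul_le_mul_of_nonneg_right this (by positivity)
      _ = 1 / ρ * ((√((r : ℝ) / r.totient) * √((r : ℝ) / r.totient)) * (A r χ * B r χ)) := by
          rw [hs]; ring
      _ = _ := by ring
  refine e1.trans ?_
  have hls : ∀ (K : ℕ) (c : ℕ → ℂ), ∑ i ∈ (Icc 1 R).sigma primitiveChars,
      (√((i.1 : ℝ) / i.1.totient) * ‖conjCharSum K c i.2‖) ^ 2 ≤
        12 * ((2 * ρ + √K) * ell2Norm K c) ^ 2 := by
    intro K c
    rw [sum_sigma]
    have h := large_sieve_conjCharSum R K hR1 c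
    have : (12:ℝ) * (R + √K) ^ 2 * ell2Norm K c ^ 2 ≤ 12 * ((2 * ρ + √K) * ell2Norm K c) ^ 2 := by
      rw [mul_pow, ← mul_assoc]
      gcongr
    refine le_trans (le_of_eq (sum_congr rfl fun r _ => ?_)) (h.trans this)
    rw [mul_sum]
    refine sum_congr rfl fun χ _ => ?_
    rw [mul_pow, Real.sq_sqrt (by positivity)]
  have hcs := sum_mul_sq_le_sq_mul_sq ((Icc 1 R).sigma primitiveChars)
    (fun i => √((i.1 : ℝ) / i.1.totient) * A i.1 i.2) (fun i => √((i.1 : ℝ) / i.1.totient) * B i.1 i.2)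
  have hA := hls M a
  have hB := hls N b
  have ha0 := ell2Norm_nonneg M a
  have hb0 := ell2Norm_nonneg N b
  set U := (2 * ρ + √M) * ell2Norm M a
  set V := (2 * ρ + √N) * ell2Norm N b
  have hU : 0 ≤ U := by positivity
  have hV : 0 ≤ V := by positivity
  have hfin : ∑ i ∈ (Icc 1 R).sigma primitiveChars,
      (√((i.1 : ℝ) / i.1.totient) * A i.1 i.2) * (√((i.1 : ℝ) / i.1.totient) * B i.1 i.2) ≤
      12 * (U * V) := by
    refine le_of_sq_le_sq ?_ (by positivity)
    refine hcs.trans ((mul_le_mul hA hB (sum_nonneg fun _ _ => sq_nonneg _) (by positivity)).trans ?_)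
    apply le_of_eq; ring
  calc _ ≤ 1 / ρ * (12 * (U * V)) := mul_le_mul_of_nonneg_left hfin (by positivity)
    _ = _ := by
      simp only [U, V]
      field_simp
      ring

/-- The moduli `r` with `D < r ≤ Q`. -/
noncomputable def moduliBetween (D Q : ℝ) : Finset ℕ := (Icc 1 ⌊Q⌋₊).filter fun r => D < (r : ℝ)

lemma mem_moduliBetween {D Q : ℝ} (hQ : 0 ≤ Q) {r : ℕ} :
    r ∈ moduliBetween D Q ↔ 1 ≤ r ∧ (r : ℝ) ≤ Q ∧ D < r := by
  simp only [moduliBetween, mem_filter, mem_Icc, Nat.le_floor_iff hQ, and_assoc]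

lemma sum_biUnion_le_sum_sum {ι : Type*} [DecidableEq ι] (s : Finset ι) (t : ι → Finset ℕ) (F : ℕ → ℝ)
    (hF : ∀ r, 0 ≤ F r) : ∑ r ∈ s.biUnion t, F r ≤ ∑ i ∈ s, ∑ r ∈ t i, F r := by
  induction s using Finset.induction_on with
  | empty => simp
  | insert i s hi ih =>
    rw [biUnion_insert, sum_insert hi]
    have h := sum_union_inter (s₁ := t i) (s₂ := s.biUnion t) (f := F)
    have h2 : 0 ≤ ∑ r ∈ t i ∩ s.biUnion t, F r := sum_nonneg fun r _ => hF r
    linarith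

/-- Dyadic blocks starting at `D`: the term in `ρ` is dominated by the last block, the term in `1 /
ρ` by the first, and the constant term is counted `J` times. The saving `1 / D` for large conductors
comes from here. -/
lemma sum_moduliBetween_le {D Q : ℝ} (hD : 1 / 2 ≤ D) {J : ℕ}
    (hJ1 : Q ≤ 2 ^ J * D) (hJ2 : 2 ^ J * D ≤ 2 * Q) (F : ℕ → ℝ) (hF : ∀ r, 0 ≤ F r)
    (c0 c1 c2 : ℝ) (hc0 : 0 ≤ c0) (hc2 : 0 ≤ c2)
    (hblock : ∀ (S : Finset ℕ) (ρ : ℝ), 1 / 2 ≤ ρ → (∀ r ∈ S, ρ < r ∧ (r : ℝ) ≤ 2 * ρ) →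
      ∑ r ∈ S, F r ≤ c0 * ρ + c1 + c2 / ρ) :
    ∑ r ∈ moduliBetween D Q, F r ≤ 2 * c0 * Q + J * c1 + 2 * c2 / D := by
  have hD0 : 0 < D := by linarith
  have hQ : 0 ≤ Q := by
    have : 0 < 2 ^ J * D := by positivity
    linarith
  have hsub : moduliBetween D Q ⊆ (range J).biUnion fun j =>
      (Icc 1 ⌊Q⌋₊).filter fun r : ℕ => 2 ^ j * D < (r : ℝ) ∧ (r : ℝ) ≤ 2 * (2 ^ j * D) := by
    intro r hr
    rw [mem_moduliBetween hQ] at hr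
    obtain ⟨h1, h2, h3⟩ := hr
    have hex : ∃ j, (r : ℝ) ≤ 2 ^ j * D := ⟨J, h2.trans hJ1⟩
    classical
    have hfind := Nat.find_spec hex
    have hle : Nat.find hex ≤ J := Nat.find_min' hex (h2.trans hJ1)
    have hpos : Nat.find hex ≠ 0 := by
      intro h0
      rw [h0] at hfind
      norm_num at hfind
      linarith
    obtain ⟨k, hk⟩ := Nat.exists_eq_succ_of_ne_zero hpos
    have hlt : ¬ (r : ℝ) ≤ 2 ^ k * D := Nat.find_min hex (by omega)
    simp only [mem_biUnion, mem_range, mem_filter, mem_Icc]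
    refine ⟨k, by omega, ⟨h1, Nat.le_floor h2⟩, not_le.mp hlt, ?_⟩
    rw [hk, Nat.succ_eq_add_one, pow_succ] at hfind
    linarith
  refine (sum_le_sum_of_subset_of_nonneg hsub fun r _ _ => hF r).trans ?_
  refine (sum_biUnion_le_sum_sum _ _ F hF).trans ?_
  have hterm : ∀ j ∈ range J, ∑ r ∈ (Icc 1 ⌊Q⌋₊).filter
      (fun r : ℕ => 2 ^ j * D < (r : ℝ) ∧ (r : ℝ) ≤ 2 * (2 ^ j * D)), F r ≤
      c0 * D * 2 ^ j + c1 + c2 / D * (1 / 2) ^ j := by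
    intro j _
    have h1 : (1:ℝ) ≤ 2 ^ j := one_le_pow₀ (by norm_num)
    refine (hblock _ (2 ^ j * D) (by nlinarith) fun r hr => (mem_filter.mp hr).2).trans (le_of_eq ?_)
    rw [one_div, inv_pow]
    field_simp
  refine (sum_le_sum hterm).trans ?_
  rw [sum_add_distrib, sum_add_distrib, ← mul_sum, ← mul_sum, sum_const, card_range, nsmul_eq_mul]
  have g1 : ∑ j ∈ range J, (2:ℝ) ^ j ≤ 2 ^ J := by
    rw [geom_sum_eq (by norm_num)]; norm_num
  have g2 : ∑ j ∈ range J, ((1:ℝ) / 2) ^ j ≤ 2 := by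
    have := geom_sum_eq (x := (1:ℝ) / 2) (by norm_num) J
    rw [this, div_le_iff_of_neg (by norm_num)]
    have : (0:ℝ) ≤ (1 / 2) ^ J := by positivity
    linarith
  have h1 : c0 * D * ∑ j ∈ range J, (2:ℝ) ^ j ≤ 2 * c0 * Q := by
    calc _ ≤ c0 * D * 2 ^ J := by gcongr
      _ = c0 * (2 ^ J * D) := by ring
      _ ≤ c0 * (2 * Q) := by gcongr
      _ = _ := by ring
  have h2 : c2 / D * ∑ j ∈ range J, ((1:ℝ) / 2) ^ j ≤ 2 * c2 / D := by
    calc _ ≤ c2 / D * 2 := by gcongr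
      _ = _ := by ring
  linarith

/-- Binary expansion of the condition `e < v`. -/
lemma sum_binary_separation (L e v : ℕ) :
    ∑ l ∈ range L, (if e / 2 ^ l % 2 = 0 ∧ v / 2 ^ l = e / 2 ^ l + 1 then (1 : ℂ) else 0) =
      if e < v ∧ e / 2 ^ L = v / 2 ^ L then 1 else 0 := by
  induction L with
  | zero =>
    simp only [range_zero, sum_empty, pow_zero, Nat.div_one]
    rw [if_neg (by omega)]
  | succ L ih =>
    rw [sum_range_succ, ih, pow_succ, ← Nat.div_div_eq_div_mul, ← Nat.div_div_eq_div_mul]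
    have hlt : e / 2 ^ L < v / 2 ^ L → e < v := fun h => by
      by_contra hc
      exact absurd (Nat.div_le_div_right (c := 2 ^ L) (not_lt.mp hc)) (by omega)
    have hle : e < v → e / 2 ^ L ≤ v / 2 ^ L := fun h => Nat.div_le_div_right h.le
    -- Only the truncations `E` and `V` matter now. If they agree after dropping one more digit,
    -- then either `E = V`, or, when `e < v`, `E` is even and `V = E + 1`, which is the new term of
    -- the sum.
    generalize e / 2 ^ L = E at *
    generalize v / 2 ^ L = V at *
    by_cases hev : e < v
    · have := hle hev
      by_cases hEV : E = V
      · rw [if_pos ⟨hev, hEV⟩, if_neg (by omega), if_pos ⟨hev, by rw [hEV]⟩, add_zero]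
      · rw [if_neg (by tauto)]
        by_cases h : E % 2 = 0 ∧ V = E + 1
        · rw [if_pos h, if_pos ⟨hev, by omega⟩, zero_add]
        · rw [if_neg h, if_neg (by omega), zero_add]
    · rw [if_neg (by tauto), if_neg (by
        rintro ⟨-, h⟩; exact hev (hlt (by omega))), if_neg (by tauto), zero_add]

/-- If `e < v`, there is exactly one highest digit `l` where the expansions differ, with `0` in `e`
and `1` in `v`; `b` is the common prefix above it. Each summand is a product of a function of `e`
and a function of `v`, so the inequality is separated exactly. -/
lemma sum_binary_separation_blocks (L e v : ℕ) (hv : v < 2 ^ L) :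
    (if e < v then (1 : ℂ) else 0) =
      ∑ l ∈ range L, ∑ b ∈ range (2 ^ L),
        (if e / 2 ^ l = 2 * b then 1 else 0) * (if v / 2 ^ l = 2 * b + 1 then 1 else 0) := by
  have h1 : (if e < v then (1 : ℂ) else 0) = if e < v ∧ e / 2 ^ L = v / 2 ^ L then 1 else 0 := by
    by_cases h : e < v
    · rw [if_pos h, if_pos ⟨h, by rw [Nat.div_eq_of_lt hv, Nat.div_eq_of_lt (h.trans hv)]⟩]
    · rw [if_neg h, if_neg (by tauto)]
  rw [h1, ← sum_binary_separation]
  refine sum_congr rfl fun l _ => ?_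
  by_cases h : e / 2 ^ l % 2 = 0 ∧ v / 2 ^ l = e / 2 ^ l + 1
  · rw [if_pos h, sum_eq_single (e / 2 ^ l / 2)]
    · rw [if_pos (by omega), if_pos (by omega), mul_one]
    · intro b _ hb
      rw [if_neg (by omega), zero_mul]
    · intro hb
      exfalso
      apply hb
      rw [mem_range]
      have : v / 2 ^ l ≤ v := Nat.div_le_self _ _
      omega
  · rw [if_neg h]
    symm
    refine sum_eq_zero fun b _ => ?_
    by_cases h2 : e / 2 ^ l = 2 * b
    · rw [if_neg (by omega : ¬ v / 2 ^ l = 2 * b + 1), mul_zero]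
    · rw [if_neg h2, zero_mul]

/-- The bilinear character sum `∑_{ed ≤ X} a(e) b(d) χ̄(e) χ̄(d)` with `e < M`, `d < N`. -/
noncomputable def hyperbolicSum (X M N : ℕ) (a b : ℕ → ℂ) {r : ℕ} (χ : DirichletCharacter ℂ r) : ℂ :=
  ∑ e ∈ range M, ∑ d ∈ range N, if e * d ≤ X then
    (a e * (starRingEnd ℂ) (χ (e : ZMod r))) * (b d * (starRingEnd ℂ) (χ (d : ZMod r))) else 0

/-- The part of `a` on the integers whose quotient by `2 ^ l` is `2 b`. -/
def leftPart (a : ℕ → ℂ) (l k : ℕ) : ℕ → ℂ := fun e => if e / 2 ^ l = 2 * k then a e else 0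

/-- The part of `b` on the integers `d` for which the quotient of `X / d + 1` by `2 ^ l` is
`2 k + 1`. -/
def rightPart (X : ℕ) (b : ℕ → ℂ) (l k : ℕ) : ℕ → ℂ :=
  fun d => if (X / d + 1) / 2 ^ l = 2 * k + 1 then b d else 0

/-- For `d > 0`, `e d ≤ X` means `e < X / d + 1`, and the binary separation applies to `e` and `v =
X / d + 1 ≤ X + 1`. At `d = 0` the equivalence fails, hence `b 0 = 0`. -/
lemma hyperbolicSum_eq (X M N L : ℕ) (hL : X + 1 < 2 ^ L) (a b : ℕ → ℂ) (hb : b 0 = 0) {r : ℕ}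
    (χ : DirichletCharacter ℂ r) :
    hyperbolicSum X M N a b χ = ∑ l ∈ range L, ∑ k ∈ range (2 ^ L),
      conjCharSum M (leftPart a l k) χ * conjCharSum N (rightPart X b l k) χ := by
  have hterm : ∀ e d : ℕ, (if e * d ≤ X then
      (a e * (starRingEnd ℂ) (χ (e : ZMod r))) * (b d * (starRingEnd ℂ) (χ (d : ZMod r))) else 0) =
      ∑ l ∈ range L, ∑ k ∈ range (2 ^ L),
        (leftPart a l k e * (starRingEnd ℂ) (χ (e : ZMod r))) *
        (rightPart X b l k d * (starRingEnd ℂ) (χ (d : ZMod r))) := by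
    intro e d
    rcases Nat.eq_zero_or_pos d with rfl | hd
    · simp [rightPart, hb]
    have hiff : e * d ≤ X ↔ e < X / d + 1 := by
      rw [Nat.lt_succ_iff, Nat.le_div_iff_mul_le hd]
    have hv : X / d + 1 < 2 ^ L := by
      have := Nat.div_le_self X d; omega
    have h := sum_binary_separation_blocks L e (X / d + 1) hv
    have h2 : (if e * d ≤ X then
      (a e * (starRingEnd ℂ) (χ (e : ZMod r))) * (b d * (starRingEnd ℂ) (χ (d : ZMod r))) else 0) =
      (if e < X / d + 1 then (1:ℂ) else 0) *
      ((a e * (starRingEnd ℂ) (χ (e : ZMod r))) * (b d * (starRingEnd ℂ) (χ (d : ZMod r)))) := by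
      simp only [hiff, ite_mul, one_mul, zero_mul]
    rw [h2, h, sum_mul]
    refine sum_congr rfl fun l _ => ?_
    rw [sum_mul]
    refine sum_congr rfl fun k _ => ?_
    simp only [leftPart, rightPart]
    split_ifs <;> ring
  unfold hyperbolicSum conjCharSum
  simp_rw [hterm, sum_mul_sum]
  rw [sum_congr rfl fun e _ => sum_comm, sum_comm]
  refine sum_congr rfl fun l _ => ?_
  rw [sum_congr rfl fun e _ => sum_comm, sum_comm]

lemma sum_sq_ell2Norm_part_le (N B : ℕ) (b : ℕ → ℂ) (w : ℕ → ℕ) (c : ℕ) :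
    ∑ k ∈ range B, ell2Norm N (fun d => if w d = 2 * k + c then b d else 0) ^ 2 ≤ ell2Norm N b ^ 2 := by
  simp_rw [sq_ell2Norm]
  rw [sum_comm]
  refine sum_le_sum fun d _ => ?_
  by_cases h : ∃ k, w d = 2 * k + c
  · obtain ⟨k0, hk0⟩ := h
    calc _ ≤ ∑ k ∈ range B, if k = k0 then ‖b d‖ ^ 2 else 0 := by
          refine sum_le_sum fun k _ => ?_
          by_cases hk : k = k0
          · rw [if_pos hk, if_pos (by omega)]
          · rw [if_neg hk, if_neg (by omega)]; simp
      _ ≤ _ := by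
          rw [sum_ite_eq']
          split_ifs <;> simp
  · push Not at h
    rw [sum_eq_zero]
    · positivity
    · intro k _
      rw [if_neg (h k)]; simp

/-- For fixed `l` the parts have disjoint supports as `k` varies, so their squared norms sum to at
most the whole. Hence separating the variables costs only the factor `L`, not the number of pieces
`2 ^ L`. -/
lemma sum_ell2Norm_parts_le (X M N B l : ℕ) (a b : ℕ → ℂ) :
    ∑ k ∈ range B, ell2Norm M (leftPart a l k) * ell2Norm N (rightPart X b l k) ≤
      ell2Norm M a * ell2Norm N b := by
  have hcs := sum_mul_sq_le_sq_mul_sq (range B) (fun k => ell2Norm M (leftPart a l k))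
    (fun k => ell2Norm N (rightPart X b l k))
  have h1 := sum_sq_ell2Norm_part_le M B a (fun e => e / 2 ^ l) 0
  have h2 := sum_sq_ell2Norm_part_le N B b (fun d => (X / d + 1) / 2 ^ l) 1
  have h0 := ell2Norm_nonneg M a
  have h0' := ell2Norm_nonneg N b
  refine le_of_sq_le_sq ?_ (by positivity)
  rw [mul_pow]
  exact hcs.trans (mul_le_mul h1 h2 (sum_nonneg fun _ _ => sq_nonneg _) (by positivity))

lemma sum_hyperbolicSum_block (S : Finset ℕ) {ρ : ℝ} (hρ : 1 / 2 ≤ ρ)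
    (hS : ∀ r ∈ S, ρ < r ∧ (r : ℝ) ≤ 2 * ρ)
    (X M N L : ℕ) (hL : X + 1 < 2 ^ L) (a b : ℕ → ℂ) (hb : b 0 = 0) :
    ∑ r ∈ S, (1 : ℝ) / r.totient * ∑ χ ∈ primitiveChars r, ‖hyperbolicSum X M N a b χ‖ ≤
      12 * (4 * ρ + 2 * √M + 2 * √N + √M * √N / ρ) * (L * (ell2Norm M a * ell2Norm N b)) := by
  have h1 : ∑ r ∈ S, (1 : ℝ) / r.totient * ∑ χ ∈ primitiveChars r, ‖hyperbolicSum X M N a b χ‖ ≤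
      ∑ l ∈ range L, ∑ k ∈ range (2 ^ L), ∑ r ∈ S, (1 : ℝ) / r.totient * ∑ χ ∈ primitiveChars r,
        ‖conjCharSum M (leftPart a l k) χ‖ * ‖conjCharSum N (rightPart X b l k) χ‖ := by
    have h2 : ∑ r ∈ S, (1 : ℝ) / r.totient * ∑ χ ∈ primitiveChars r, ‖hyperbolicSum X M N a b χ‖ ≤
        ∑ r ∈ S, (1 : ℝ) / r.totient * ∑ χ ∈ primitiveChars r, ∑ l ∈ range L, ∑ k ∈ range (2 ^ L),
        ‖conjCharSum M (leftPart a l k) χ‖ * ‖conjCharSum N (rightPart X b l k) χ‖ := by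
      gcongr with r _ χ _
      rw [hyperbolicSum_eq X M N L hL a b hb]
      refine (norm_sum_le _ _).trans (sum_le_sum fun l _ => (norm_sum_le _ _).trans
        (sum_le_sum fun k _ => (norm_mul _ _).le))
    refine h2.trans (le_of_eq ?_)
    have h3 : ∀ r ∈ S, (1 : ℝ) / r.totient * ∑ χ ∈ primitiveChars r, ∑ l ∈ range L,
        ∑ k ∈ range (2 ^ L),
        ‖conjCharSum M (leftPart a l k) χ‖ * ‖conjCharSum N (rightPart X b l k) χ‖ =
        ∑ l ∈ range L, ∑ k ∈ range (2 ^ L), (1 : ℝ) / r.totient * ∑ χ ∈ primitiveChars r,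
        ‖conjCharSum M (leftPart a l k) χ‖ * ‖conjCharSum N (rightPart X b l k) χ‖ := by
      intro r _
      rw [sum_comm, mul_sum]
      refine sum_congr rfl fun l _ => ?_
      rw [sum_comm, mul_sum]
    rw [sum_congr rfl h3, sum_comm]
    refine sum_congr rfl fun l _ => ?_
    rw [sum_comm]
  refine h1.trans ?_
  have hc : 0 ≤ 12 * (4 * ρ + 2 * √M + 2 * √N + √M * √N / ρ) := by
    have : 0 < ρ := by linarith
    positivity
  have h4 : ∀ l ∈ range L, ∑ k ∈ range (2 ^ L), ∑ r ∈ S, (1 : ℝ) / r.totient *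
      ∑ χ ∈ primitiveChars r,
        ‖conjCharSum M (leftPart a l k) χ‖ * ‖conjCharSum N (rightPart X b l k) χ‖ ≤
      12 * (4 * ρ + 2 * √M + 2 * √N + √M * √N / ρ) * (ell2Norm M a * ell2Norm N b) := by
    intro l _
    refine (sum_le_sum fun k _ => bilinear_block S hρ hS M N _ _).trans ?_
    rw [← mul_sum]
    exact mul_le_mul_of_nonneg_left (sum_ell2Norm_parts_le X M N _ l a b) hc
  refine (sum_le_sum h4).trans (le_of_eq ?_)
  rw [sum_const, card_range, nsmul_eq_mul]
  ring

lemma sum_hyperbolicSum_primitive_le {D Q : ℝ} (hD : 1 / 2 ≤ D) {J : ℕ}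
    (hJ1 : Q ≤ 2 ^ J * D) (hJ2 : 2 ^ J * D ≤ 2 * Q)
    (X M N L : ℕ) (hL : X + 1 < 2 ^ L) (a b : ℕ → ℂ) (hb : b 0 = 0) :
    ∑ r ∈ moduliBetween D Q, (1 : ℝ) / r.totient * ∑ χ ∈ primitiveChars r,
      ‖hyperbolicSum X M N a b χ‖ ≤
      24 * L * (4 * Q + J * (√M + √N) + √M * √N / D) * (ell2Norm M a * ell2Norm N b) := by
  have h0 := mul_nonneg (ell2Norm_nonneg M a) (ell2Norm_nonneg N b)
  set A := ell2Norm M a * ell2Norm N b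
  have h := sum_moduliBetween_le hD hJ1 hJ2
    (fun r => (1 : ℝ) / r.totient * ∑ χ ∈ primitiveChars r, ‖hyperbolicSum X M N a b χ‖)
    (fun r => by positivity) (48 * (L * A)) (24 * (√M + √N) * (L * A)) (12 * (√M * √N) * (L * A))
    (by positivity) (by positivity) (fun S ρ hρ hS => by
      refine (sum_hyperbolicSum_block S hρ hS X M N L hL a b hb).trans (le_of_eq ?_)
      ring)
  refine h.trans (le_of_eq ?_)
  ring

/-! ### Sums over divisor pairs -/

lemma sum_divisorsAntidiagonal_eq_hyperbola {M : Type*} [AddCommMonoid M] (X : ℕ) (F : ℕ → ℕ → M) :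
    ∑ n ∈ Icc 1 X, ∑ p ∈ n.divisorsAntidiagonal, F p.1 p.2 =
      ∑ e ∈ Icc 1 X, ∑ d ∈ Icc 1 X, if e * d ≤ X then F e d else 0 := by
  rw [sum_congr rfl fun e _ => (sum_filter (s := Icc 1 X) (fun d => e * d ≤ X) (F e)).symm,
    sum_sigma', sum_sigma']
  refine sum_bij' (fun i _ => ⟨i.2.1, i.2.2⟩) (fun i _ => ⟨i.1 * i.2, (i.1, i.2)⟩) ?_ ?_ ?_ ?_ ?_
  · rintro ⟨n, e, d⟩ h
    simp only [mem_sigma, mem_Icc, Nat.mem_divisorsAntidiagonal, mem_filter] at h ⊢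
    obtain ⟨⟨h1, h2⟩, h3, h4⟩ := h
    have he : 0 < e := Nat.pos_of_ne_zero (by rintro rfl; simp at h3; omega)
    have hd : 0 < d := Nat.pos_of_ne_zero (by rintro rfl; simp at h3; omega)
    have := Nat.le_mul_of_pos_right e hd
    have := Nat.le_mul_of_pos_left d he
    omega
  · rintro ⟨e, d⟩ h
    simp only [mem_sigma, mem_Icc, Nat.mem_divisorsAntidiagonal, mem_filter] at h ⊢
    have := Nat.mul_pos (Nat.lt_of_lt_of_le Nat.zero_lt_one h.1.1)
      (Nat.lt_of_lt_of_le Nat.zero_lt_one h.2.1.1)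
    exact ⟨⟨this, h.2.2⟩, trivial, by omega⟩
  · rintro ⟨n, e, d⟩ h
    simp only [mem_sigma, mem_Icc, Nat.mem_divisorsAntidiagonal] at h
    simp only [h.2.1]
  · rintro ⟨e, d⟩ _; rfl
  · rintro ⟨n, e, d⟩ _; rfl

lemma sum_divisorsAntidiagonal_le_mul (X : ℕ) (F G : ℕ → ℝ) (hF : ∀ n, 0 ≤ F n) (hG : ∀ n, 0 ≤ G n) :
    ∑ n ∈ Icc 1 X, ∑ p ∈ n.divisorsAntidiagonal, F p.1 * G p.2 ≤
      (∑ e ∈ Icc 1 X, F e) * ∑ d ∈ Icc 1 X, G d := by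
  rw [sum_divisorsAntidiagonal_eq_hyperbola X (fun e d => F e * G d), sum_mul_sum]
  refine sum_le_sum fun e _ => sum_le_sum fun d _ => ?_
  split_ifs
  · exact le_rfl
  · exact mul_nonneg (hF e) (hG d)

lemma sum_one_div_le_one_add_log (n : ℕ) : ∑ d ∈ Icc 1 n, 1 / (d : ℝ) ≤ 1 + Real.log n := by
  have h := harmonic_le_one_add_log n
  rw [harmonic_eq_sum_Icc] at h
  push_cast at h
  simpa [one_div] using h

/-! ### The sum of the reciprocals of the totients -/

/-- The arithmetic function `n ↦ 1 / n`. -/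
noncomputable def recipArith : ArithmeticFunction ℝ := ⟨fun n => 1 / (n : ℝ), by simp⟩

lemma recipArith_apply (n : ℕ) : recipArith n = 1 / (n : ℝ) := rfl

lemma recipArith_isMultiplicative : recipArith.IsMultiplicative :=
  ⟨by simp [recipArith_apply], fun {m n} _ => by
    simp only [recipArith_apply]; push_cast; rw [one_div_mul_one_div]⟩

/-- Both sides are multiplicative. At `p ^ k` the left is `p / (p - 1) ≤ 1 + 2 / p`, and the right
already reaches `1 + 2 / p` from the divisors `1` and `p`. -/
lemma div_totient_le (n : ℕ) (hn : 0 < n) : (n : ℝ) / n.totient ≤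
    (recipArith * recipArith * (ArithmeticFunction.zeta : ArithmeticFunction ℝ)) n := by
  have hG : (recipArith * recipArith *
      (ArithmeticFunction.zeta : ArithmeticFunction ℝ)).IsMultiplicative :=
    (recipArith_isMultiplicative.mul recipArith_isMultiplicative).mul
      ArithmeticFunction.isMultiplicative_zeta.natCast
  set G := recipArith * recipArith * (ArithmeticFunction.zeta : ArithmeticFunction ℝ) with hGdef
  induction n using Nat.recOnPosPrimePosCoprime with
  | zero => omega
  | one => rw [hG.map_one]; simp
  | prime_pow p k hp hk =>
    have hp2 : (2:ℝ) ≤ p := by exact_mod_cast hp.two_le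
    have h0 : ∀ d, 0 ≤ (recipArith * recipArith) d := fun d => by
      rw [ArithmeticFunction.mul_apply]
      exact sum_nonneg fun x _ => by simp only [recipArith_apply]; positivity
    have h1 : (1:ℝ) + 2 / p ≤ G (p ^ k) := by
      rw [hGdef, ArithmeticFunction.coe_mul_zeta_apply]
      have hsub : ({1, p} : Finset ℕ) ⊆ (p ^ k).divisors := by
        intro d hd
        rw [Nat.mem_divisors]
        refine ⟨?_, (pow_pos hp.pos k).ne'⟩
        simp only [mem_insert, mem_singleton] at hd
        rcases hd with rfl | rfl
        · exact one_dvd _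
        · exact dvd_pow_self _ hk.ne'
      refine le_trans ?_ (sum_le_sum_of_subset_of_nonneg hsub fun d _ _ => h0 d)
      rw [sum_pair hp.one_lt.ne, (recipArith_isMultiplicative.mul recipArith_isMultiplicative).map_one]
      have : (recipArith * recipArith) p = 2 / p := by
        rw [ArithmeticFunction.mul_apply,
          Nat.sum_divisorsAntidiagonal (f := fun x y => recipArith x * recipArith y), hp.divisors,
          sum_pair hp.one_lt.ne]
        simp only [recipArith_apply, Nat.div_one, Nat.div_self hp.pos]
        push_cast
        ring
      rw [this]
    refine le_trans ?_ h1
    rw [Nat.totient_prime_pow hp hk]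
    push_cast [hp.one_lt.le]
    have hpk : (p:ℝ) ^ k = p ^ (k - 1) * p := by
      rw [← pow_succ]; congr 1; omega
    have hpp : (0:ℝ) < p ^ (k - 1) := by positivity
    rw [hpk, mul_div_mul_left _ _ hpp.ne', div_le_iff₀ (by linarith)]
    have : (1 + 2 / (p:ℝ)) * (p - 1) = p + 1 - 2 / p := by field_simp; ring
    rw [this]
    have : 2 / (p:ℝ) ≤ 1 := by rw [div_le_one (by linarith)]; exact hp2
    linarith
  | coprime a b ha hb hab iha ihb =>
    rw [hG.map_mul_of_coprime hab, Nat.totient_mul hab]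
    push_cast
    rw [mul_div_mul_comm]
    have h1 := iha (by omega)
    have h2 := ihb (by omega)
    exact mul_le_mul h1 h2 (by positivity) (le_trans (by positivity) h1)

/-- Dividing the majorant of `s / φ(s)` by `s` gives a triple convolution of `1 / d ^ 2`, `1 / d ^
2` and `1 / d`. The first two sums are at most 2 each, the last is harmonic. -/
lemma sum_one_div_totient_le (n : ℕ) :
    ∑ s ∈ Icc 1 n, 1 / (s.totient : ℝ) ≤ 4 * (1 + Real.log n) := by
  have hH : ∀ d, (recipArith * recipArith) d * (1 / (d:ℝ)) =
      ∑ x ∈ d.divisorsAntidiagonal, (1 / (x.1:ℝ) ^ 2) * (1 / (x.2:ℝ) ^ 2) := by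
    intro d
    rw [ArithmeticFunction.mul_apply, sum_mul]
    refine sum_congr rfl fun x hx => ?_
    rw [← (Nat.mem_divisorsAntidiagonal.mp hx).1]
    simp only [recipArith_apply]
    push_cast
    simp only [one_div, mul_inv]
    ring
  have h1 : ∑ s ∈ Icc 1 n, 1 / (s.totient : ℝ) ≤
      ∑ s ∈ Icc 1 n, ∑ x ∈ s.divisorsAntidiagonal,
        ((recipArith * recipArith) x.1 * (1 / (x.1:ℝ))) * (1 / (x.2:ℝ)) := by
    refine sum_le_sum fun s hs => ?_
    have hs1 := (mem_Icc.mp hs).1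
    have hs0 : (0:ℝ) < s := by exact_mod_cast hs1
    have h := div_totient_le s hs1
    rw [ArithmeticFunction.mul_apply] at h
    have : 1 / (s.totient : ℝ) = (s : ℝ) / s.totient * (1 / s) := by field_simp
    rw [this]
    refine (mul_le_mul_of_nonneg_right h (by positivity)).trans (le_of_eq ?_)
    rw [sum_mul]
    refine sum_congr rfl fun x hx => ?_
    obtain ⟨hx1, hx2⟩ := Nat.mem_divisorsAntidiagonal.mp hx
    have hx3 : x.2 ≠ 0 := by rintro h0; rw [h0] at hx1; omega
    rw [← hx1, ArithmeticFunction.natCoe_apply, ArithmeticFunction.zeta_apply_ne hx3]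
    push_cast
    simp only [one_div, mul_inv]
    ring
  have h0 : ∀ d, 0 ≤ (recipArith * recipArith) d * (1 / (d:ℝ)) := fun d => by
    rw [hH]; positivity
  refine h1.trans ((sum_divisorsAntidiagonal_le_mul n
    (fun d => (recipArith * recipArith) d * (1 / (d:ℝ))) (fun d => 1 / (d:ℝ)) h0
    (fun d => by positivity)).trans ?_)
  have hsq : ∑ d ∈ Icc 1 n, 1 / (d:ℝ) ^ 2 ≤ 2 :=
    sum_inv_sq_le_two (Icc 1 n) id (Set.injOn_id _)
  have h2 : ∑ d ∈ Icc 1 n, (recipArith * recipArith) d * (1 / (d:ℝ)) ≤ 4 := by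
    simp_rw [hH]
    refine (sum_divisorsAntidiagonal_le_mul n (fun d => 1 / (d:ℝ) ^ 2) (fun d => 1 / (d:ℝ) ^ 2)
      (fun d => by positivity) (fun d => by positivity)).trans ?_
    have : 0 ≤ ∑ d ∈ Icc 1 n, 1 / (d:ℝ) ^ 2 := by positivity
    nlinarith
  exact mul_le_mul h2 (sum_one_div_le_one_add_log n) (by positivity) (by norm_num)

/-! ### Descent to primitive characters -/

open Classical in
/-- The characters mod `q` of conductor larger than `D`. -/
noncomputable def charsAbove (D : ℝ) (q : ℕ) : Finset (DirichletCharacter ℂ q) :=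
  univ.filter fun χ => D < (χ.conductor : ℝ)

lemma mem_charsAbove {D : ℝ} {q : ℕ} {χ : DirichletCharacter ℂ q} :
    χ ∈ charsAbove D q ↔ D < (χ.conductor : ℝ) := by
  simp [charsAbove]

/-- The restriction of `a` to the integers coprime to `s`. -/
def coprimePart (s : ℕ) (a : ℕ → ℂ) : ℕ → ℂ := fun n => if n.Coprime s then a n else 0

lemma norm_coprimePart_le (s : ℕ) (a : ℕ → ℂ) (n : ℕ) : ‖coprimePart s a n‖ ≤ ‖a n‖ := by
  unfold coprimePart; split_ifs <;> simp

lemma dirichletCharacter_apply_eq_zero {q : ℕ} (χ : DirichletCharacter ℂ q) {n : ℕ}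
    (h : ¬ n.Coprime q) : χ (n : ZMod q) = 0 :=
  χ.map_nonunit (by rwa [ZMod.isUnit_iff_coprime])

lemma mul_conj_apply_eq_primitive {q : ℕ} (χ : DirichletCharacter ℂ q) (a : ℕ → ℂ) (n : ℕ) :
    a n * (starRingEnd ℂ) (χ (n : ZMod q)) = coprimePart (q / χ.conductor) a n *
      (starRingEnd ℂ) (χ.primitiveCharacter (n : ZMod χ.conductor)) := by
  have hq : q = χ.conductor * (q / χ.conductor) := (Nat.mul_div_cancel' χ.conductor_dvd_level).symm
  unfold coprimePart
  by_cases h : n.Coprime q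
  · have h1 : n.Coprime (q / χ.conductor) := by
      refine Nat.Coprime.coprime_dvd_right ?_ h
      exact Nat.div_dvd_of_dvd χ.conductor_dvd_level
    have h2 := χ.primitiveCharacter_apply_of_isCoprime (a := (n : ℤ)) (Nat.isCoprime_iff_coprime.mpr h)
    push_cast at h2
    rw [if_pos h1, h2]
  · rw [dirichletCharacter_apply_eq_zero χ h]
    by_cases h1 : n.Coprime (q / χ.conductor)
    · have h2 : ¬ n.Coprime χ.conductor := by
        intro h2; apply h; rw [hq]; exact Nat.Coprime.mul_right h2 h1
      rw [dirichletCharacter_apply_eq_zero _ h2]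
      simp
    · rw [if_neg h1]; simp

lemma hyperbolicSum_eq_primitive {q : ℕ} (χ : DirichletCharacter ℂ q) (X M N : ℕ) (a b : ℕ → ℂ) :
    hyperbolicSum X M N a b χ = hyperbolicSum X M N (coprimePart (q / χ.conductor) a)
      (coprimePart (q / χ.conductor) b) χ.primitiveCharacter := by
  unfold hyperbolicSum
  refine sum_congr rfl fun e _ => sum_congr rfl fun d _ => ?_
  rw [mul_conj_apply_eq_primitive χ a, mul_conj_apply_eq_primitive χ b]

lemma changeLevel_eq_of_sigma_eq {q c c' : ℕ} (h : c ∣ q) (h' : c' ∣ q)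
    (ψ : DirichletCharacter ℂ c) (ψ' : DirichletCharacter ℂ c')
    (he : (⟨c, ψ⟩ : Σ r : ℕ, DirichletCharacter ℂ r) = ⟨c', ψ'⟩) :
    DirichletCharacter.changeLevel h ψ = DirichletCharacter.changeLevel h' ψ' := by
  cases he; rfl

lemma sum_le_sum_of_injOn_image {ι κ : Type*} [DecidableEq κ] (s : Finset ι) (t : Finset κ)
    (g : ι → κ) (hg : ∀ i ∈ s, g i ∈ t) (hinj : Set.InjOn g s) (F : ι → ℝ) (G : κ → ℝ)
    (hF : ∀ i ∈ s, F i ≤ G (g i)) (hG : ∀ k, 0 ≤ G k) : ∑ i ∈ s, F i ≤ ∑ k ∈ t, G k := by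
  refine (sum_le_sum hF).trans ?_
  rw [← sum_image hinj]
  exact sum_le_sum_of_subset_of_nonneg (image_subset_iff.mpr hg) fun k _ _ => hG k

/-- A character mod `q` is determined by its primitive character `ψ` mod `r` and the quotient `s = q
/ r`, and it equals `ψ` cut off to integers coprime to `s`. The weight splits because `φ(r) φ(s) ≤
φ(q)`. -/
lemma sum_hyperbolicSum_charsAbove_le (D Q : ℝ) (hD : 0 ≤ D) (hQ : 0 ≤ Q) (X M N : ℕ) (a b : ℕ → ℂ) :
    ∑ q ∈ Icc 1 ⌊Q⌋₊, (1 : ℝ) / q.totient * ∑ χ ∈ charsAbove D q, ‖hyperbolicSum X M N a b χ‖ ≤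
    ∑ s ∈ Icc 1 ⌊Q⌋₊, (1 : ℝ) / s.totient * ∑ r ∈ moduliBetween D Q,
      (1 : ℝ) / r.totient * ∑ ψ ∈ primitiveChars r,
        ‖hyperbolicSum X M N (coprimePart s a) (coprimePart s b) ψ‖ := by
  classical
  have e1 : ∑ q ∈ Icc 1 ⌊Q⌋₊, (1 : ℝ) / q.totient *
      ∑ χ ∈ charsAbove D q, ‖hyperbolicSum X M N a b χ‖ =
      ∑ i ∈ (Icc 1 ⌊Q⌋₊).sigma (charsAbove D),
        (1 : ℝ) / i.1.totient * ‖hyperbolicSum X M N a b i.2‖ := by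
    rw [sum_sigma]; simp_rw [mul_sum]
  have e2 : ∑ s ∈ Icc 1 ⌊Q⌋₊, (1 : ℝ) / s.totient * ∑ r ∈ moduliBetween D Q,
      (1 : ℝ) / r.totient * ∑ ψ ∈ primitiveChars r,
        ‖hyperbolicSum X M N (coprimePart s a) (coprimePart s b) ψ‖ =
      ∑ j ∈ (Icc 1 ⌊Q⌋₊) ×ˢ ((moduliBetween D Q).sigma primitiveChars),
        (1 : ℝ) / j.1.totient * ((1 : ℝ) / j.2.1.totient *
        ‖hyperbolicSum X M N (coprimePart j.1 a) (coprimePart j.1 b) j.2.2‖) := by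
    rw [sum_product]
    simp_rw [sum_sigma, mul_sum]
  rw [e1, e2]
  refine sum_le_sum_of_injOn_image _ _
    (fun i => (i.1 / i.2.conductor, ⟨i.2.conductor, i.2.primitiveCharacter⟩)) ?_ ?_ _ _ ?_ ?_
  · rintro ⟨q, χ⟩ h
    simp only [mem_sigma, mem_product, mem_Icc, mem_charsAbove, mem_primitiveChars,
      mem_moduliBetween hQ] at h ⊢
    obtain ⟨⟨h1, h2⟩, h3⟩ := h
    have hc0 : 0 < χ.conductor := by
      have : (0:ℝ) < χ.conductor := by linarith
      exact_mod_cast this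
    have hcq : χ.conductor ≤ q := Nat.le_of_dvd (by omega) χ.conductor_dvd_level
    refine ⟨⟨Nat.div_pos hcq hc0, (Nat.div_le_self _ _).trans h2⟩, ⟨hc0, ?_, h3⟩,
      χ.primitiveCharacter_isPrimitive⟩
    exact (Nat.le_floor_iff hQ).mp (hcq.trans h2)
  · rintro ⟨q, χ⟩ h ⟨q', χ'⟩ h' heq
    simp only [Prod.mk.injEq] at heq
    obtain ⟨h1, h2⟩ := heq
    have hc : χ.conductor = χ'.conductor := congrArg Sigma.fst h2
    have hq : q = q' := by
      have a1 := Nat.mul_div_cancel' χ.conductor_dvd_level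
      have a2 := Nat.mul_div_cancel' χ'.conductor_dvd_level
      rw [← a1, ← a2, h1, hc]
    subst hq
    have := changeLevel_eq_of_sigma_eq χ.conductor_dvd_level χ'.conductor_dvd_level _ _ h2
    rw [χ.changeLevel_primitiveCharacter, χ'.changeLevel_primitiveCharacter] at this
    rw [this]
  · rintro ⟨q, χ⟩ h
    simp only [mem_sigma, mem_Icc] at h
    have hq : q = (q / χ.conductor) * χ.conductor := (Nat.div_mul_cancel χ.conductor_dvd_level).symm
    simp only
    rw [← hyperbolicSum_eq_primitive, ← mul_assoc, one_div_mul_one_div]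
    refine mul_le_mul_of_nonneg_right ?_ (norm_nonneg _)
    have hs : (q / χ.conductor).totient * χ.conductor.totient ≤ q.totient := by
      conv_rhs => rw [hq]
      exact Nat.totient_super_multiplicative _ _
    have hpos : 0 < (q / χ.conductor).totient * χ.conductor.totient := by
      have hq0 : 0 < q := h.1.1
      refine Nat.mul_pos (Nat.totient_pos.mpr ?_) (Nat.totient_pos.mpr ?_)
      · exact Nat.pos_of_ne_zero fun h0 => by rw [h0] at hq; omega
      · exact Nat.pos_of_ne_zero fun h0 => by rw [h0] at hq; omega
    refine one_div_le_one_div_of_le (by exact_mod_cast hpos) (by exact_mod_cast hs)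
  · intro k; positivity

/-- The mean value of a hyperbolic bilinear sum over all characters of large conductor. -/
lemma sum_hyperbolicSum_charsAbove_le' {D Q : ℝ} (hD : 1 / 2 ≤ D) {J : ℕ}
    (hJ1 : Q ≤ 2 ^ J * D) (hJ2 : 2 ^ J * D ≤ 2 * Q)
    (X M N L : ℕ) (hL : X + 1 < 2 ^ L) (a b : ℕ → ℂ) (hb : b 0 = 0) :
    ∑ q ∈ Icc 1 ⌊Q⌋₊, (1 : ℝ) / q.totient * ∑ χ ∈ charsAbove D q, ‖hyperbolicSum X M N a b χ‖ ≤
      4 * (1 + Real.log ⌊Q⌋₊) *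
      (24 * L * (4 * Q + J * (√M + √N) + √M * √N / D) * (ell2Norm M a * ell2Norm N b)) := by
  have hQ : 0 ≤ Q := by
    have : 0 < 2 ^ J * D := by positivity
    linarith
  refine (sum_hyperbolicSum_charsAbove_le D Q (by linarith) hQ X M N a b).trans ?_
  have hD0 : 0 < D := by linarith
  have hc : (0:ℝ) ≤ 24 * L * (4 * Q + J * (√M + √N) + √M * √N / D) := by positivity
  have h0 := ell2Norm_nonneg M a
  have h0' := ell2Norm_nonneg N b
  have hs : ∀ s, ∑ r ∈ moduliBetween D Q, (1 : ℝ) / r.totient * ∑ ψ ∈ primitiveChars r,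
        ‖hyperbolicSum X M N (coprimePart s a) (coprimePart s b) ψ‖ ≤
      24 * L * (4 * Q + J * (√M + √N) + √M * √N / D) * (ell2Norm M a * ell2Norm N b) := by
    intro s
    refine (sum_hyperbolicSum_primitive_le hD hJ1 hJ2 X M N L hL _ _ (by simp [coprimePart, hb])).trans ?_
    refine mul_le_mul_of_nonneg_left ?_ hc
    exact mul_le_mul (ell2Norm_mono (norm_coprimePart_le s a)) (ell2Norm_mono (norm_coprimePart_le s b))
      (ell2Norm_nonneg _ _) h0
  refine (sum_le_sum fun s _ => mul_le_mul_of_nonneg_left (hs s) (by positivity)).trans ?_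
  rw [← sum_mul]
  exact mul_le_mul_of_nonneg_right (sum_one_div_totient_le _) (by positivity)

/-! ### Discrepancies -/

/-- Dirichlet convolution of two functions. -/
def dirichletConv (f g : ℕ → ℂ) : ℕ → ℂ := fun n => ∑ p ∈ n.divisorsAntidiagonal, f p.1 * g p.2

open Classical in
/-- The weight with which `f n` enters `discrepancy Ξ f x q a`. -/
noncomputable def discrepancyWeight (Ξ : Set (Σ r : ℕ, DirichletCharacter ℂ r)) (q : ℕ)
    (a b : ZMod q) : ℂ :=
  (if b = a then 1 else 0) -
    (1 / (Nat.totient q : ℂ)) * ∑ᶠ χ ∈ inducedChars Ξ q, χ a * (starRingEnd ℂ) (χ b)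

lemma finite_inducedChars (Ξ : Set (Σ r : ℕ, DirichletCharacter ℂ r)) (q : ℕ) :
    (inducedChars Ξ q).Finite := Set.toFinite _

lemma discrepancy_eq_sum (Ξ : Set (Σ r : ℕ, DirichletCharacter ℂ r)) (f : ℕ → ℂ) (x : ℝ)
    (q : ℕ) (a : ZMod q) :
    discrepancy Ξ f x q a = ∑ n ∈ Icc 1 ⌊x⌋₊, f n * discrepancyWeight Ξ q a (n : ZMod q) := by
  classical
  unfold discrepancy discrepancyWeight charSum
  simp_rw [mul_sub, sum_sub_distrib]
  congr 1
  · rw [sum_filter]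
    exact sum_congr rfl fun n _ => by split_ifs <;> simp
  · rw [finsum_mem_eq_finite_toFinset_sum _ (finite_inducedChars Ξ q)]
    simp_rw [finsum_mem_eq_finite_toFinset_sum _ (finite_inducedChars Ξ q), mul_sum]
    rw [sum_comm]
    exact sum_congr rfl fun n _ => sum_congr rfl fun χ _ => by ring

/-- A unit factor only moves the target class. Together with the vanishing at non-units, this lets
the maximum over classes absorb a convolution factor. -/
lemma discrepancyWeight_mul {Ξ : Set (Σ r : ℕ, DirichletCharacter ℂ r)} {q : ℕ} [NeZero q]
    (a m : (ZMod q)ˣ) (b : ZMod q) :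
    discrepancyWeight Ξ q a (m * b) = discrepancyWeight Ξ q ((a * m⁻¹ : (ZMod q)ˣ) : ZMod q) b := by
  classical
  unfold discrepancyWeight
  congr 1
  · have : (m : ZMod q) * b = a ↔ b = ((a * m⁻¹ : (ZMod q)ˣ) : ZMod q) := by
      rw [Units.val_mul, Units.eq_mul_inv_iff_mul_eq, mul_comm]
    simp only [this]
  · congr 1
    refine finsum_mem_congr rfl fun χ _ => ?_
    rw [map_mul, map_mul, conj_dirichletCharacter_apply_unit, Units.val_mul, map_mul,
      ZMod.inv_coe_unit]
    ring

lemma discrepancyWeight_nonunit {Ξ : Set (Σ r : ℕ, DirichletCharacter ℂ r)} {q : ℕ}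
    (a : (ZMod q)ˣ) {b : ZMod q} (hb : ¬ IsUnit b) : discrepancyWeight Ξ q a b = 0 := by
  classical
  unfold discrepancyWeight
  rw [if_neg (by rintro rfl; exact hb a.isUnit)]
  have : ∀ χ ∈ inducedChars Ξ q, χ a * (starRingEnd ℂ) (χ b) = 0 := fun χ _ => by
    rw [χ.map_nonunit hb]; simp
  rw [finsum_mem_congr rfl this]
  simp

lemma norm_discrepancy_le_iSup (Ξ : Set (Σ r : ℕ, DirichletCharacter ℂ r)) (f : ℕ → ℂ) (x : ℝ)
    (q : ℕ) [NeZero q] (a : (ZMod q)ˣ) :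
    ‖discrepancy Ξ f x q a‖ ≤ ⨆ a : (ZMod q)ˣ, ‖discrepancy Ξ f x q (a : ZMod q)‖ :=
  le_ciSup (f := fun a : (ZMod q)ˣ => ‖discrepancy Ξ f x q (a : ZMod q)‖)
    (Set.finite_range _).bddAbove a

lemma iSup_norm_discrepancy_nonneg (Ξ : Set (Σ r : ℕ, DirichletCharacter ℂ r)) (f : ℕ → ℂ) (x : ℝ)
    (q : ℕ) : 0 ≤ ⨆ a : (ZMod q)ˣ, ‖discrepancy Ξ f x q (a : ZMod q)‖ :=
  Real.iSup_nonneg fun _ => norm_nonneg _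

lemma totalDiscrepancy_nonneg (Ξ : Set (Σ r : ℕ, DirichletCharacter ℂ r)) (Q : ℝ) (f : ℕ → ℂ)
    (x : ℝ) : 0 ≤ totalDiscrepancy Ξ Q f x :=
  sum_nonneg fun q _ => iSup_norm_discrepancy_nonneg Ξ f x q

lemma totalDiscrepancy_le {Ξ : Set (Σ r : ℕ, DirichletCharacter ℂ r)} {Q : ℝ} {f : ℕ → ℂ} {x : ℝ}
    (B : ℕ → ℝ)
    (h : ∀ q : ℕ, 1 ≤ q → (q : ℝ) ≤ Q → ∀ a : (ZMod q)ˣ, ‖discrepancy Ξ f x q a‖ ≤ B q) :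
    totalDiscrepancy Ξ Q f x ≤ ∑ q ∈ Icc 1 ⌊Q⌋₊, B q := by
  refine sum_le_sum fun q hq => ciSup_le fun a => h q (mem_Icc.mp hq).1 ?_ a
  have h1 := (mem_Icc.mp hq)
  rcases le_or_gt 0 Q with hQ | hQ
  · exact (Nat.le_floor_iff hQ).mp h1.2
  · rw [Nat.floor_of_nonpos hQ.le] at h1; omega

lemma discrepancy_congr {Ξ : Set (Σ r : ℕ, DirichletCharacter ℂ r)} {f g : ℕ → ℂ} {x : ℝ}
    (h : ∀ n, 1 ≤ n → n ≤ ⌊x⌋₊ → f n = g n) (q : ℕ) (a : ZMod q) :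
    discrepancy Ξ f x q a = discrepancy Ξ g x q a := by
  rw [discrepancy_eq_sum, discrepancy_eq_sum]
  exact sum_congr rfl fun n hn => by rw [h n (mem_Icc.mp hn).1 (mem_Icc.mp hn).2]

lemma totalDiscrepancy_congr {Ξ : Set (Σ r : ℕ, DirichletCharacter ℂ r)} {Q : ℝ} {f g : ℕ → ℂ}
    {x : ℝ} (h : ∀ n, 1 ≤ n → n ≤ ⌊x⌋₊ → f n = g n) :
    totalDiscrepancy Ξ Q f x = totalDiscrepancy Ξ Q g x := by
  unfold totalDiscrepancy
  simp_rw [discrepancy_congr h]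

lemma totalDiscrepancy_add_le (Ξ : Set (Σ r : ℕ, DirichletCharacter ℂ r)) (Q : ℝ) (f g : ℕ → ℂ)
    (x : ℝ) : totalDiscrepancy Ξ Q (f + g) x ≤ totalDiscrepancy Ξ Q f x + totalDiscrepancy Ξ Q g x := by
  unfold totalDiscrepancy
  rw [← sum_add_distrib]
  refine totalDiscrepancy_le _ fun q hq _ a => ?_
  have : NeZero q := ⟨by omega⟩
  have : discrepancy Ξ (f + g) x q a = discrepancy Ξ f x q a + discrepancy Ξ g x q a := by
    simp_rw [discrepancy_eq_sum, ← sum_add_distrib, Pi.add_apply, add_mul]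
  rw [this]
  exact (norm_add_le _ _).trans
    (add_le_add (norm_discrepancy_le_iSup Ξ f x q a) (norm_discrepancy_le_iSup Ξ g x q a))

/-- The discrepancy of `f` over `(y, x]` is bounded by those at the endpoints. -/
lemma totalDiscrepancy_indicator_gt_le (Ξ : Set (Σ r : ℕ, DirichletCharacter ℂ r)) (Q : ℝ)
    (f : ℕ → ℂ) {x y : ℝ} (hy : 0 ≤ y) (hyx : y ≤ x) :
    totalDiscrepancy Ξ Q (fun n => if y < (n : ℝ) then f n else 0) x ≤
      totalDiscrepancy Ξ Q f x + totalDiscrepancy Ξ Q f y := by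
  unfold totalDiscrepancy
  rw [← sum_add_distrib]
  refine totalDiscrepancy_le _ fun q hq _ a => ?_
  have : NeZero q := ⟨by omega⟩
  have : discrepancy Ξ (fun n => if y < (n : ℝ) then f n else 0) x q a =
      discrepancy Ξ f x q a - discrepancy Ξ f y q a := by
    simp_rw [discrepancy_eq_sum]
    have hsub : Icc 1 ⌊y⌋₊ ⊆ Icc 1 ⌊x⌋₊ := Icc_subset_Icc le_rfl (Nat.floor_le_floor hyx)
    rw [eq_sub_iff_add_eq, ← sum_sdiff hsub, ← sum_sdiff hsub]
    rw [sum_eq_zero (s := Icc 1 ⌊y⌋₊), add_zero]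
    · congr 1
      refine sum_congr rfl fun n hn => ?_
      rw [if_pos]
      rw [mem_sdiff, mem_Icc, mem_Icc, Nat.le_floor_iff hy] at hn
      by_contra hc
      exact hn.2 ⟨hn.1.1, not_lt.mp hc⟩
    · intro n hn
      rw [mem_Icc, Nat.le_floor_iff hy] at hn
      rw [if_neg (not_lt.mpr hn.2), zero_mul]
  rw [this]
  exact (norm_sub_le _ _).trans
    (add_le_add (norm_discrepancy_le_iSup Ξ f x q a) (norm_discrepancy_le_iSup Ξ f y q a))

lemma sum_Icc_mul_le {M : Type*} [AddCommMonoid M] {x : ℝ} {m : ℕ} (hm : 1 ≤ m) (F : ℕ → M) :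
    ∑ d ∈ Icc 1 ⌊x⌋₊, (if m * d ≤ ⌊x⌋₊ then F d else 0) = ∑ d ∈ Icc 1 ⌊x / m⌋₊, F d := by
  rw [← sum_filter, Nat.floor_div_natCast]
  congr 1
  ext d
  simp only [mem_filter, mem_Icc, Nat.le_div_iff_mul_le (by omega : 0 < m)]
  constructor
  · rintro ⟨⟨h1, -⟩, h2⟩; exact ⟨h1, by rwa [mul_comm]⟩
  · rintro ⟨h1, h2⟩
    refine ⟨⟨h1, ?_⟩, by rwa [mul_comm]⟩
    exact (Nat.le_mul_of_pos_right d (by omega)).trans h2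

/-- With `m` fixed, the inner sum over `d ≤ x / m` is the discrepancy of `g` in the class `a m⁻¹`
when `m` is a unit mod `q`, and zero otherwise. -/
lemma totalDiscrepancy_dirichletConv_le (Ξ : Set (Σ r : ℕ, DirichletCharacter ℂ r)) (Q : ℝ)
    (f g : ℕ → ℂ) (x : ℝ) :
    totalDiscrepancy Ξ Q (dirichletConv f g) x ≤
      ∑ m ∈ Icc 1 ⌊x⌋₊, ‖f m‖ * totalDiscrepancy Ξ Q g (x / m) := by
  unfold totalDiscrepancy
  simp_rw [mul_sum]
  rw [sum_comm]
  refine totalDiscrepancy_le _ fun q hq _ a => ?_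
  have : NeZero q := ⟨by omega⟩
  have h1 : discrepancy Ξ (dirichletConv f g) x q a = ∑ m ∈ Icc 1 ⌊x⌋₊, f m *
      ∑ d ∈ Icc 1 ⌊x / m⌋₊, g d * discrepancyWeight Ξ q a ((m : ZMod q) * (d : ZMod q)) := by
    rw [discrepancy_eq_sum]
    have h2 : ∀ n, dirichletConv f g n * discrepancyWeight Ξ q a (n : ZMod q) =
        ∑ p ∈ n.divisorsAntidiagonal, f p.1 * g p.2 *
          discrepancyWeight Ξ q a ((p.1 : ZMod q) * (p.2 : ZMod q)) := by
      intro n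
      unfold dirichletConv
      rw [sum_mul]
      refine sum_congr rfl fun p hp => ?_
      rw [← Nat.cast_mul, (Nat.mem_divisorsAntidiagonal.mp hp).1]
    simp_rw [h2]
    rw [sum_divisorsAntidiagonal_eq_hyperbola ⌊x⌋₊ (fun e d => f e * g d *
          discrepancyWeight Ξ q a ((e : ZMod q) * (d : ZMod q)))]
    refine sum_congr rfl fun m hm => ?_
    rw [sum_Icc_mul_le (mem_Icc.mp hm).1, mul_sum]
    exact sum_congr rfl fun d _ => by ring
  rw [h1]
  refine (norm_sum_le _ _).trans (sum_le_sum fun m _ => ?_)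
  rw [norm_mul]
  refine mul_le_mul_of_nonneg_left ?_ (norm_nonneg _)
  by_cases hm : IsUnit (m : ZMod q)
  · obtain ⟨u, hu⟩ := hm
    simp_rw [← hu, discrepancyWeight_mul]
    rw [← discrepancy_eq_sum]
    exact norm_discrepancy_le_iSup Ξ g (x / m) q (a * u⁻¹)
  · have : ∀ d : ℕ, discrepancyWeight Ξ q a ((m : ZMod q) * (d : ZMod q)) = 0 := fun d =>
      discrepancyWeight_nonunit a fun h => hm (isUnit_of_mul_isUnit_left h)
    simp_rw [this, mul_zero, sum_const_zero, norm_zero]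
    exact iSup_norm_discrepancy_nonneg _ _ _ _

/-! ### Discrepancies and characters of large conductor -/

lemma mem_inducedChars_primitiveCharsUpTo {D : ℝ} {q : ℕ} (hq : 1 ≤ q) (χ : DirichletCharacter ℂ q) :
    χ ∈ inducedChars (primitiveCharsUpTo D) q ↔ (χ.conductor : ℝ) ≤ D := by
  have : NeZero q := ⟨by omega⟩
  constructor
  · rintro ⟨⟨r, ψ⟩, ⟨h1, h2, h3⟩, h, rfl⟩
    rw [DirichletCharacter.conductor_changeLevel]
    have : ψ.conductor = r := h3
    rw [this]; exact h2
  · intro h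
    exact ⟨⟨χ.conductor, χ.primitiveCharacter⟩, ⟨Nat.one_le_iff_ne_zero.mpr χ.conductor_ne_zero, h,
      χ.primitiveCharacter_isPrimitive⟩, χ.conductor_dvd_level, χ.changeLevel_primitiveCharacter⟩

/-- Orthogonality expresses the congruence sum through all characters mod `q`. The subtracted main
term consists exactly of those with conductor at most `D`. -/
lemma discrepancy_eq_sum_charsAbove (D : ℝ) (f : ℕ → ℂ) (x : ℝ) (q : ℕ) [NeZero q] (a : (ZMod q)ˣ) :
    discrepancy (primitiveCharsUpTo D) f x q a =
      (1 / (q.totient : ℂ)) * ∑ χ ∈ charsAbove D q, χ a * charSum f x χ := by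
  classical
  have hq : 1 ≤ q := NeZero.one_le
  have hφ : (q.totient : ℂ) ≠ 0 := by
    exact_mod_cast (Nat.totient_pos.mpr (NeZero.pos q)).ne'
  have hset : (finite_inducedChars (primitiveCharsUpTo D) q).toFinset =
      univ.filter fun χ => ¬ D < (χ.conductor : ℝ) := by
    ext χ
    simp [mem_inducedChars_primitiveCharsUpTo hq]
  unfold discrepancy
  rw [finsum_mem_eq_finite_toFinset_sum _ (finite_inducedChars _ q), hset]
  have hall : ∑ n ∈ (Icc 1 ⌊x⌋₊).filter (fun n : ℕ => (n : ZMod q) = a), f n =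
      (1 / (q.totient : ℂ)) * ∑ χ : DirichletCharacter ℂ q, χ a * charSum f x χ := by
    have horth : ∀ n : ℕ, ∑ χ : DirichletCharacter ℂ q, χ a * (starRingEnd ℂ) (χ (n : ZMod q)) =
        if (n : ZMod q) = a then (q.totient : ℂ) else 0 := by
      intro n
      by_cases hn : IsUnit (n : ZMod q)
      · obtain ⟨u, hu⟩ := hn
        rw [← hu, sum_dirichletCharacter_mul_conj]
        simp only [Units.val_inj, eq_comm]
      · rw [if_neg (by intro h; rw [h] at hn; exact hn a.isUnit)]
        refine sum_eq_zero fun χ _ => ?_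
        rw [χ.map_nonunit hn]; simp
    unfold charSum
    simp_rw [mul_sum]
    rw [sum_comm, sum_filter]
    refine sum_congr rfl fun n _ => ?_
    have : ∀ χ : DirichletCharacter ℂ q, 1 / (q.totient : ℂ) *
        (χ a * (f n * (starRingEnd ℂ) (χ (n : ZMod q)))) =
        1 / (q.totient : ℂ) * f n * (χ a * (starRingEnd ℂ) (χ (n : ZMod q))) := fun χ => by ring
    simp_rw [this]
    rw [← mul_sum, horth]
    split_ifs
    · field_simp
    · simp
  rw [hall, ← mul_sub]
  congr 1
  rw [← sum_filter_add_sum_filter_not univ (fun χ : DirichletCharacter ℂ q => D < (χ.conductor : ℝ)),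
    add_sub_cancel_right]
  refine sum_congr ?_ fun _ _ => rfl
  ext χ; simp [mem_charsAbove]

/-- The mean over the moduli `q ≤ Q` of the character sums of `f` to characters mod `q` of conductor
larger than `D`. -/
noncomputable def largeConductorMean (D Q : ℝ) (f : ℕ → ℂ) (x : ℝ) : ℝ :=
  ∑ q ∈ Icc 1 ⌊Q⌋₊, (1 : ℝ) / q.totient * ∑ χ ∈ charsAbove D q, ‖charSum f x χ‖

lemma totalDiscrepancy_le_largeConductorMean (D Q : ℝ) (f : ℕ → ℂ) (x : ℝ) :
    totalDiscrepancy (primitiveCharsUpTo D) Q f x ≤ largeConductorMean D Q f x := by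
  refine totalDiscrepancy_le _ fun q hq _ a => ?_
  have : NeZero q := ⟨by omega⟩
  rw [discrepancy_eq_sum_charsAbove, norm_mul]
  have h1 : ‖(1 / (q.totient : ℂ))‖ = 1 / (q.totient : ℝ) := by
    rw [norm_div, norm_one, Complex.norm_natCast]
  rw [h1]
  refine mul_le_mul_of_nonneg_left ((norm_sum_le _ _).trans (sum_le_sum fun χ _ => ?_)) (by positivity)
  rw [norm_mul, χ.unit_norm_eq_one, one_mul]

lemma charSum_congr {f g : ℕ → ℂ} {x : ℝ} (h : ∀ n, 1 ≤ n → n ≤ ⌊x⌋₊ → f n = g n) {q : ℕ}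
    (χ : DirichletCharacter ℂ q) : charSum f x χ = charSum g x χ :=
  sum_congr rfl fun n hn => by rw [h n (mem_Icc.mp hn).1 (mem_Icc.mp hn).2]

lemma charSum_sum {ι : Type*} (s : Finset ι) (f : ι → ℕ → ℂ) (x : ℝ) {q : ℕ}
    (χ : DirichletCharacter ℂ q) :
    charSum (fun n => ∑ i ∈ s, f i n) x χ = ∑ i ∈ s, charSum (f i) x χ := by
  unfold charSum
  simp_rw [sum_mul]
  exact sum_comm

lemma largeConductorMean_le_sum {ι : Type*} (s : Finset ι) (f : ℕ → ℂ) (g : ι → ℕ → ℂ) (D Q x : ℝ)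
    (h : ∀ n, 1 ≤ n → n ≤ ⌊x⌋₊ → f n = ∑ i ∈ s, g i n) :
    largeConductorMean D Q f x ≤ ∑ i ∈ s, largeConductorMean D Q (g i) x := by
  unfold largeConductorMean
  rw [sum_comm]
  refine sum_le_sum fun q _ => ?_
  rw [← mul_sum, sum_comm]
  refine mul_le_mul_of_nonneg_left (sum_le_sum fun χ _ => ?_) (by positivity)
  rw [charSum_congr h, charSum_sum]
  exact norm_sum_le _ _

lemma charSum_dirichletConv (a b : ℕ → ℂ) (x : ℝ) (M N : ℕ) (ha0 : a 0 = 0) (hb0 : b 0 = 0)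
    (haM : ∀ e, a e ≠ 0 → e < M) (hbN : ∀ e d, a e ≠ 0 → e * d ≤ ⌊x⌋₊ → d < N) {q : ℕ}
    (χ : DirichletCharacter ℂ q) :
    charSum (dirichletConv a b) x χ = hyperbolicSum ⌊x⌋₊ M N a b χ := by
  set X := ⌊x⌋₊
  have h1 : charSum (dirichletConv a b) x χ = ∑ n ∈ Icc 1 X, ∑ p ∈ n.divisorsAntidiagonal,
      (a p.1 * (starRingEnd ℂ) (χ (p.1 : ZMod q))) * (b p.2 * (starRingEnd ℂ) (χ (p.2 : ZMod q))) := by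
    unfold charSum dirichletConv
    refine sum_congr rfl fun n _ => ?_
    rw [sum_mul]
    refine sum_congr rfl fun p hp => ?_
    rw [← (Nat.mem_divisorsAntidiagonal.mp hp).1]
    push_cast
    rw [map_mul, map_mul]
    ring
  rw [h1, sum_divisorsAntidiagonal_eq_hyperbola X (fun e d =>
    (a e * (starRingEnd ℂ) (χ (e : ZMod q))) * (b d * (starRingEnd ℂ) (χ (d : ZMod q))))]
  unfold hyperbolicSum
  rw [← sum_product', ← sum_product']
  refine sum_congr_of_eq_on_inter ?_ ?_ fun _ _ _ => rfl
  · rintro ⟨e, d⟩ h1 h2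
    simp only [mem_product, mem_Icc, mem_range, not_and] at h1 h2 ⊢
    by_cases hae : a e = 0
    · simp [hae]
    · rw [if_neg]
      intro hle
      exact h2 (haM e hae) (hbN e d hae hle)
  · rintro ⟨e, d⟩ h1 h2
    simp only [mem_product, mem_Icc, mem_range] at h1 h2 ⊢
    by_cases hae : a e = 0
    · simp [hae]
    by_cases hbd : b d = 0
    · simp [hbd]
    rw [if_neg]
    intro hle
    have he : 0 < e := Nat.pos_of_ne_zero (by rintro rfl; exact hae ha0)
    have hd : 0 < d := Nat.pos_of_ne_zero (by rintro rfl; exact hbd hb0)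
    have := Nat.le_mul_of_pos_right e hd
    have := Nat.le_mul_of_pos_left d he
    omega

lemma largeConductorMean_dirichletConv_le {D Q : ℝ} (hD : 1 / 2 ≤ D) {J : ℕ}
    (hJ1 : Q ≤ 2 ^ J * D) (hJ2 : 2 ^ J * D ≤ 2 * Q)
    (a b : ℕ → ℂ) (x : ℝ) (M N L : ℕ) (hL : ⌊x⌋₊ + 1 < 2 ^ L) (ha0 : a 0 = 0) (hb0 : b 0 = 0)
    (haM : ∀ e, a e ≠ 0 → e < M) (hbN : ∀ e d, a e ≠ 0 → e * d ≤ ⌊x⌋₊ → d < N) :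
    largeConductorMean D Q (dirichletConv a b) x ≤ 4 * (1 + Real.log ⌊Q⌋₊) *
      (24 * L * (4 * Q + J * (√M + √N) + √M * √N / D) * (ell2Norm M a * ell2Norm N b)) := by
  refine le_trans (le_of_eq ?_)
    (sum_hyperbolicSum_charsAbove_le' hD hJ1 hJ2 ⌊x⌋₊ M N L hL a b hb0)
  unfold largeConductorMean
  simp_rw [charSum_dirichletConv a b x M N ha0 hb0 haM hbN]

/-! ### The class `𝒞` -/

namespace IsClassC

variable {f : ArithmeticFunction ℂ}

/-- Strong induction: `|f(n)| log n ≤ ∑ |f(d)| Λ(e) ≤ ∑ Λ(e) = log n`. The term `e = 1`, which would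
involve `f n` itself, vanishes since `Λ(1) = 0`. -/
lemma norm_le_one (hf : IsClassC f) (n : ℕ) : ‖f n‖ ≤ 1 := by
  obtain ⟨L, hL, hLn⟩ := hf.exists_vonMangoldt
  induction n using Nat.strong_induction_on with
  | _ n ih =>
    rcases Nat.lt_or_ge n 2 with hn | hn
    · interval_cases n
      · simp
      · rw [hf.isMultiplicative.map_one]; simp
    have hlog : 0 < Real.log n := Real.log_pos (by exact_mod_cast hn)
    have h1 := congrArg norm (hL n (by omega))
    rw [norm_mul, Complex.norm_real, Real.norm_of_nonneg hlog.le, ArithmeticFunction.mul_apply] at h1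
    have h2 : ‖∑ x ∈ n.divisorsAntidiagonal, f x.1 * L x.2‖ ≤
        ∑ x ∈ n.divisorsAntidiagonal, ArithmeticFunction.vonMangoldt x.2 := by
      refine (norm_sum_le _ _).trans (sum_le_sum fun x hx => ?_)
      obtain ⟨hx1, hx2⟩ := Nat.mem_divisorsAntidiagonal.mp hx
      have hx20 : 1 ≤ x.2 := Nat.one_le_iff_ne_zero.mpr fun h => by rw [h] at hx1; omega
      have hx10 : 1 ≤ x.1 := Nat.one_le_iff_ne_zero.mpr fun h => by rw [h] at hx1; omega
      have hL2 := hLn x.2 hx20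
      rw [norm_mul]
      rcases hx20.eq_or_lt with h | h
      · rw [← h] at hL2 ⊢
        rw [ArithmeticFunction.vonMangoldt_apply_one] at hL2 ⊢
        have : ‖L 1‖ = 0 := le_antisymm hL2 (norm_nonneg _)
        rw [this, mul_zero]
      · have hlt : x.1 < n := by nlinarith
        calc ‖f x.1‖ * ‖L x.2‖ ≤ 1 * ArithmeticFunction.vonMangoldt x.2 :=
              mul_le_mul (ih x.1 hlt) hL2 (norm_nonneg _) zero_le_one
          _ = _ := one_mul _
    have h3 : ∑ x ∈ n.divisorsAntidiagonal, ArithmeticFunction.vonMangoldt x.2 = Real.log n := by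
      rw [← ArithmeticFunction.vonMangoldt_sum,
        Nat.sum_divisorsAntidiagonal' (f := fun _ y => ArithmeticFunction.vonMangoldt y)]
    rw [h3] at h2
    rw [← h1] at h2
    exact le_of_mul_le_mul_right (by linarith) hlog

/-- The local form of the relation between `f` and `Λ_f`. -/
lemma exists_local_coefficients (hf : IsClassC f) : ∃ κ : ℕ → ℕ → ℂ,
    (∀ p i, p.Prime → 1 ≤ i → ‖κ p i‖ ≤ 1) ∧
    ∀ p n, p.Prime → n ≠ 0 → (n.factorization p : ℂ) * f n =
      ∑ i ∈ Icc 1 (n.factorization p), κ p i * f (n / p ^ i) := by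
  obtain ⟨L, hL, hLn⟩ := hf.exists_vonMangoldt
  -- The bound holds because `Λ(p ^ i) = log p`. The relation is the defining one for `Λ_f` at `p ^
  -- v`, divided by `log p` and multiplied by `f` at the part of `n` prime to `p`.
  refine ⟨fun p i => L (p ^ i) / (Real.log p : ℂ), ?_, ?_⟩
  · intro p i hp hi
    have hlog : 0 < Real.log p := Real.log_pos (by exact_mod_cast hp.one_lt)
    have h := hLn (p ^ i) (Nat.one_le_pow _ _ hp.pos)
    rw [ArithmeticFunction.vonMangoldt_apply_pow (by omega),
      ArithmeticFunction.vonMangoldt_apply_prime hp] at h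
    rw [norm_div, Complex.norm_real, Real.norm_of_nonneg hlog.le, div_le_one hlog]
    exact h
  · intro p n hp hn
    have hlog : 0 < Real.log p := Real.log_pos (by exact_mod_cast hp.one_lt)
    have hlogC : (Real.log p : ℂ) ≠ 0 := by exact_mod_cast hlog.ne'
    set v := n.factorization p with hv
    have hnm : p ^ v * (n / p ^ v) = n := Nat.ordProj_mul_ordCompl_eq_self n p
    set m := n / p ^ v with hm
    have hcop : Nat.Coprime p m := Nat.coprime_ordCompl hp hn
    have hfn : f n = f (p ^ v) * f m := by
      conv_lhs => rw [← hnm]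
      exact hf.isMultiplicative.map_mul_of_coprime (hcop.pow_left v)
    have hL1 : L 1 = 0 := by
      have := hLn 1 le_rfl
      rw [ArithmeticFunction.vonMangoldt_apply_one] at this
      exact norm_le_zero_iff.mp this
    have hpow : (v : ℂ) * f (p ^ v) * (Real.log p : ℂ) =
        ∑ i ∈ Icc 1 v, L (p ^ i) * f (p ^ (v - i)) := by
      have h := hL (p ^ v) (Nat.one_le_pow _ _ hp.pos)
      rw [ArithmeticFunction.mul_apply,
        Nat.sum_divisorsAntidiagonal' (f := fun x y => f x * L y), Nat.sum_divisors_prime_pow hp] at h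
      have hlp : ((Real.log ((p ^ v : ℕ) : ℝ) : ℝ) : ℂ) = v * (Real.log p : ℂ) := by
        rw [Nat.cast_pow, Real.log_pow]; push_cast; rfl
      have h2 : (v : ℂ) * f (p ^ v) * (Real.log p : ℂ) = f (p ^ v) * (v * (Real.log p : ℂ)) := by ring
      have hins : range (v + 1) = insert 0 (Icc 1 v) := by
        ext i; simp only [mem_range, mem_insert, mem_Icc]; omega
      rw [h2, ← hlp, h, hins, sum_insert (by simp), pow_zero, hL1, mul_zero, zero_add]
      refine sum_congr rfl fun i hi => ?_
      rw [Nat.pow_div (mem_Icc.mp hi).2 hp.pos, mul_comm]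
    have hterm : ∀ i ∈ Icc 1 v, L (p ^ i) / (Real.log p : ℂ) * f (n / p ^ i) =
        (L (p ^ i) * f (p ^ (v - i))) * (f m / (Real.log p : ℂ)) := by
      intro i hi
      have hiv := (mem_Icc.mp hi).2
      have : n / p ^ i = p ^ (v - i) * m := by
        conv_lhs => rw [← hnm]
        rw [Nat.mul_div_right_comm (pow_dvd_pow p hiv), Nat.pow_div hiv hp.pos]
      rw [this, hf.isMultiplicative.map_mul_of_coprime (hcop.pow_left _)]
      ring
    rw [sum_congr rfl hterm, ← sum_mul, ← hpow, hfn]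
    field_simp

end IsClassC

/-! ### Counting prime factors with multiplicity in a set of primes -/

open Classical in
/-- The number of prime factors `p` of `n` with `P p`, counted with multiplicity. -/
noncomputable def omegaOn (P : ℕ → Prop) (n : ℕ) : ℕ :=
  n.factorization.sum fun p k => if P p then k else 0

lemma omegaOn_mul (P : ℕ → Prop) {m n : ℕ} (hm : m ≠ 0) (hn : n ≠ 0) :
    omegaOn P (m * n) = omegaOn P m + omegaOn P n := by
  classical
  unfold omegaOn
  rw [Nat.factorization_mul hm hn]
  refine Finsupp.sum_add_index' (fun p => by simp) fun p a b => ?_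
  split_ifs <;> simp

lemma omegaOn_prime_pow {P : ℕ → Prop} {p : ℕ} (hp : p.Prime) (hP : P p) (i : ℕ) :
    omegaOn P (p ^ i) = i := by
  classical
  unfold omegaOn
  rw [hp.factorization_pow, Finsupp.sum_single_index (by simp), if_pos hP]

open Classical in
lemma omegaOn_eq_sum (P : ℕ → Prop) (n : ℕ) :
    omegaOn P n = ∑ p ∈ n.primeFactors.filter P, n.factorization p := by
  unfold omegaOn
  rw [Finsupp.sum, Nat.support_factorization, sum_filter]

lemma omegaOn_pos {P : ℕ → Prop} {n p : ℕ} (hn : n ≠ 0) (hp : p.Prime) (hpn : p ∣ n) (hP : P p) :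
    0 < omegaOn P n := by
  classical
  rw [omegaOn_eq_sum]
  refine lt_of_lt_of_le (hp.factorization_pos_of_dvd hn hpn) ?_
  exact single_le_sum (f := fun p => n.factorization p) (fun _ _ => Nat.zero_le _)
    (mem_filter.mpr ⟨Nat.mem_primeFactors.mpr ⟨hp, hpn, hn⟩, hP⟩)

/-! ### Ramaré's identity -/

open Classical in
/-- The coefficients `κ p i` placed at the powers `p ^ i` of the primes `p` with `P p`. -/
noncomputable def primePowerCoeff (κ : ℕ → ℕ → ℂ) (P : ℕ → Prop) (i : ℕ) : ℕ → ℂ := fun e =>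
  if e.minFac.Prime ∧ P e.minFac ∧ e = e.minFac ^ i then κ e.minFac i else 0

/-- The part of `a` on the dyadic interval `[2 ^ l, 2 ^ (l + 1))`. -/
def dyadicPart (a : ℕ → ℂ) (l : ℕ) : ℕ → ℂ := fun e => if Nat.log 2 e = l then a e else 0

open Classical in
/-- The weighted restriction of `f` to the integers all whose prime factors satisfy `S`. -/
noncomputable def cofactorCoeff (f : ℕ → ℂ) (S P : ℕ → Prop) (i : ℕ) : ℕ → ℂ := fun d =>
  if d ≠ 0 ∧ ∀ p, p.Prime → p ∣ d → S p then f d / (omegaOn P d + i : ℕ) else 0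

lemma primePowerCoeff_prime_pow {κ : ℕ → ℕ → ℂ} {P : ℕ → Prop} {p i : ℕ} (hp : p.Prime) (hP : P p)
    (hi : 1 ≤ i) : primePowerCoeff κ P i (p ^ i) = κ p i := by
  unfold primePowerCoeff
  rw [hp.pow_minFac (by omega), if_pos ⟨hp, hP, rfl⟩]

lemma sum_dyadicPart_dirichletConv (a b : ℕ → ℂ) (L n : ℕ) (hn : n < 2 ^ L) :
    ∑ l ∈ range L, dirichletConv (dyadicPart a l) b n = dirichletConv a b n := by
  unfold dirichletConv dyadicPart
  rw [sum_comm]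
  refine sum_congr rfl fun x hx => ?_
  rw [← sum_mul, sum_ite_eq, if_pos]
  obtain ⟨h1, h2⟩ := Nat.mem_divisorsAntidiagonal.mp hx
  have hx1 : x.1 ≤ n := Nat.le_of_dvd (by omega) (Dvd.intro _ h1)
  have hx0 : x.1 ≠ 0 := by rintro h; rw [h] at h1; omega
  exact mem_range.mpr (Nat.log_lt_of_lt_pow hx0 (by omega))

open Classical in
lemma dirichletConv_primePowerCoeff (κ : ℕ → ℕ → ℂ) (P : ℕ → Prop) (b : ℕ → ℂ) {i n : ℕ}
    (hi : 1 ≤ i) (hn : n ≠ 0) :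
    dirichletConv (primePowerCoeff κ P i) b n =
      ∑ p ∈ n.primeFactors.filter P, if i ≤ n.factorization p then κ p i * b (n / p ^ i) else 0 := by
  unfold dirichletConv
  rw [← sum_filter]
  symm
  refine sum_of_injOn (fun p => (p ^ i, n / p ^ i)) ?_ ?_ ?_ ?_
  · intro p _ p' _ h
    simp only [Prod.mk.injEq] at h
    exact Nat.pow_left_injective (by omega) h.1
  · intro p hp
    simp only [coe_filter, mem_filter, Nat.mem_primeFactors, Set.mem_ofPred_eq] at hp
    obtain ⟨⟨⟨hp1, -, -⟩, -⟩, hp3⟩ := hp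
    rw [mem_coe, Nat.mem_divisorsAntidiagonal]
    exact ⟨Nat.mul_div_cancel' ((hp1.pow_dvd_iff_le_factorization hn).mpr hp3), hn⟩
  · rintro ⟨e, d⟩ hed hnot
    obtain ⟨h1, -⟩ := Nat.mem_divisorsAntidiagonal.mp hed
    simp only at h1
    unfold primePowerCoeff
    simp only
    split_ifs with h
    · exfalso
      obtain ⟨hp, hP, he⟩ := h
      apply hnot
      have hdvd : e.minFac ^ i ∣ n := by rw [← he]; exact Dvd.intro _ h1
      refine ⟨e.minFac, ?_, ?_⟩
      · simp only [coe_filter, mem_filter, Nat.mem_primeFactors, Set.mem_ofPred_eq]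
        exact ⟨⟨⟨hp, (dvd_pow_self _ (by omega)).trans hdvd, hn⟩, hP⟩,
          (hp.pow_dvd_iff_le_factorization hn).mp hdvd⟩
      · simp only [Prod.mk.injEq]
        refine ⟨he.symm, ?_⟩
        rw [← he]
        have he0 : 0 < e := Nat.pos_of_ne_zero (by rintro rfl; simp at h1; omega)
        exact Nat.div_eq_of_eq_mul_right he0 h1.symm
    · rw [zero_mul]
  · intro p hp
    simp only [mem_filter, Nat.mem_primeFactors] at hp
    simp only
    rw [primePowerCoeff_prime_pow hp.1.1.1 hp.1.2 hi]

open Classical in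
/-- Ramaré's identity: the part of `f` on the integers all of whose prime factors satisfy `S`, and
some prime factor of which satisfies `P`, is a sum of convolutions with functions supported on
powers of primes satisfying `P`. -/
lemma IsClassC.sum_dirichletConv_eq {f : ArithmeticFunction ℂ} {κ : ℕ → ℕ → ℂ}
    (hκ : ∀ p n, p.Prime → n ≠ 0 → (n.factorization p : ℂ) * f n =
      ∑ i ∈ Icc 1 (n.factorization p), κ p i * f (n / p ^ i))
    (S P : ℕ → Prop) (hPS : ∀ p, P p → S p) {L n : ℕ} (hn : n ≠ 0) (hnL : n < 2 ^ L) :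
    ∑ i ∈ Icc 1 L, ∑ l ∈ range L,
      dirichletConv (dyadicPart (primePowerCoeff κ P i) l) (cofactorCoeff f S P i) n =
    if (∀ p, p.Prime → p ∣ n → S p) ∧ ∃ p, p.Prime ∧ p ∣ n ∧ P p then f n else 0 := by
  simp_rw [sum_dyadicPart_dirichletConv _ _ L n hnL]
  rw [sum_congr rfl fun i hi => dirichletConv_primePowerCoeff κ P _ (mem_Icc.mp hi).1 hn, sum_comm]
  have hinner : ∀ p ∈ n.primeFactors.filter P, ∑ i ∈ Icc 1 L, (if i ≤ n.factorization p then
      κ p i * cofactorCoeff f S P i (n / p ^ i) else 0) =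
      if (∀ p, p.Prime → p ∣ n → S p) then (n.factorization p : ℂ) * f n / (omegaOn P n : ℂ) else 0 := by
    intro p hp
    simp only [mem_filter, Nat.mem_primeFactors] at hp
    obtain ⟨⟨hp1, hp2, -⟩, hpP⟩ := hp
    -- Truncating the exponent at `L` loses nothing, because `2 ^ v ≤ p ^ v ≤ n < 2 ^ L`.
    have hvL : n.factorization p ≤ L := by
      have h1 : p ^ n.factorization p ≤ n := Nat.ordProj_le p hn
      have h2 : 2 ^ n.factorization p ≤ p ^ n.factorization p := Nat.pow_le_pow_left hp1.two_le _
      exact (Nat.pow_lt_pow_iff_right (by norm_num : 1 < 2)).mp (lt_of_le_of_lt (h2.trans h1) hnL) |>.le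
    rw [← sum_filter]
    have hfil : (Icc 1 L).filter (fun i => i ≤ n.factorization p) = Icc 1 (n.factorization p) := by
      ext i; simp only [mem_filter, mem_Icc]; omega
    rw [hfil]
    have hdec : ∀ i ∈ Icc 1 (n.factorization p), p ^ i * (n / p ^ i) = n := fun i hi =>
      Nat.mul_div_cancel' ((hp1.pow_dvd_iff_le_factorization hn).mpr (mem_Icc.mp hi).2)
    have hne : ∀ i ∈ Icc 1 (n.factorization p), n / p ^ i ≠ 0 := fun i hi h0 => by
      have := hdec i hi; rw [h0] at this; omega
    split_ifs with hS
    · rw [hκ p n hp1 hn, sum_div]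
      refine sum_congr rfl fun i hi => ?_
      -- Counting with multiplicity makes the weight `1 / ω_P(n)` a function of the cofactor and `i`
      -- alone, even when `p` still divides the cofactor; the decomposition is therefore exactly
      -- bilinear.
      have hom : omegaOn P n = omegaOn P (n / p ^ i) + i := by
        conv_lhs => rw [← hdec i hi]
        rw [omegaOn_mul P (pow_pos hp1.pos i).ne' (hne i hi), omegaOn_prime_pow hp1 hpP, add_comm]
      unfold cofactorCoeff
      rw [if_pos ⟨hne i hi, fun r hr hrd => hS r hr (hrd.trans (Dvd.intro_left _ (hdec i hi)))⟩, hom]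
      ring
    · refine sum_eq_zero fun i hi => ?_
      unfold cofactorCoeff
      rw [if_neg, mul_zero]
      rintro ⟨-, h⟩
      apply hS
      intro r hr hrn
      rw [← hdec i hi] at hrn
      rcases (Nat.Prime.dvd_mul hr).mp hrn with h1 | h1
      · have := (Nat.prime_dvd_prime_iff_eq hr hp1).mp (hr.dvd_of_dvd_pow h1)
        rw [this]; exact hPS p hpP
      · exact h r hr h1
  rw [sum_congr rfl hinner]
  by_cases hS : ∀ p, p.Prime → p ∣ n → S p
  · simp only [if_pos hS]
    by_cases hex : ∃ p, p.Prime ∧ p ∣ n ∧ P p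
    · rw [if_pos ⟨hS, hex⟩, ← sum_div, ← sum_mul]
      obtain ⟨p, hp, hpn, hP⟩ := hex
      have hpos := omegaOn_pos hn hp hpn hP
      have h0 : (omegaOn P n : ℂ) ≠ 0 := by exact_mod_cast hpos.ne'
      have : ∑ p ∈ n.primeFactors.filter P, (n.factorization p : ℂ) = (omegaOn P n : ℂ) := by
        rw [omegaOn_eq_sum]; push_cast; rfl
      rw [this]
      field_simp
    · rw [if_neg fun h => hex h.2]
      refine sum_eq_zero fun p hp => ?_
      simp only [mem_filter, Nat.mem_primeFactors] at hp
      exact absurd ⟨p, hp.1.1, hp.1.2.1, hp.2⟩ hex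
  · simp only [if_neg hS, sum_const_zero]
    rw [if_neg fun h => hS h.1]

/-! ### Smooth numbers -/

/-- `n ↦ n ^ (-σ)` as a monoid homomorphism. -/
noncomputable def natRpowNegHom (σ : ℝ) : ℕ →* ℝ where
  toFun n := (n : ℝ) ^ (-σ)
  map_one' := by simp
  map_mul' m n := by push_cast; exact Real.mul_rpow (by positivity) (by positivity)

lemma natRpowNegHom_apply (σ : ℝ) (n : ℕ) : natRpowNegHom σ n = (n : ℝ) ^ (-σ) := rfl

lemma inv_one_sub_le_exp {u : ℝ} (h0 : 0 ≤ u) (h1 : u ≤ 3 / 4) : (1 - u)⁻¹ ≤ Real.exp (4 * u) := by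
  have h2 : 0 < 1 - u := by linarith
  have h3 : (1 - u)⁻¹ ≤ 1 + 4 * u := by
    rw [inv_le_iff_one_le_mul₀ h2]
    nlinarith
  have := Real.add_one_le_exp (4 * u)
  linarith

/-- Rankin's bound. -/
lemma sum_smooth_recip_le {k : ℕ} (hk : 1 ≤ k) {η T : ℝ} (hη : 0 < η) (hη2 : η ≤ 1 / 2) (hT : 0 < T)
    (F : Finset ℕ) (hF : ∀ d ∈ F, d ∈ Nat.smoothNumbers k ∧ T < d) :
    ∑ d ∈ F, 1 / (d : ℝ) ≤ T ^ (-η) * Real.exp (4 * ((k : ℝ) ^ η * (1 + Real.log k))) := by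
  have hp34 : ∀ p : ℕ, p.Prime → (p : ℝ) ^ (-(1 - η)) ≤ 3 / 4 := by
    intro p hp
    have h2 : (2:ℝ) ≤ p := by exact_mod_cast hp.two_le
    have h3 : (p : ℝ) ^ (-(1 - η)) ≤ (2:ℝ) ^ (-(1 - η)) :=
      Real.rpow_le_rpow_of_nonpos (by norm_num) h2 (by linarith)
    have h4 : (2:ℝ) ^ (-(1 - η)) ≤ (2:ℝ) ^ (-(1/2 : ℝ)) :=
      Real.rpow_le_rpow_of_exponent_le (by norm_num) (by linarith)
    have h5 : (2:ℝ) ^ (-(1/2 : ℝ)) ≤ 3 / 4 := by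
      rw [Real.rpow_neg (by norm_num), ← Real.sqrt_eq_rpow]
      rw [inv_le_comm₀ (by positivity) (by norm_num)]
      refine Real.le_sqrt_of_sq_le (by norm_num)
    linarith
  have hnorm : ∀ {p : ℕ}, p.Prime → ‖natRpowNegHom (1 - η) p‖ < 1 := by
    intro p hp
    rw [natRpowNegHom_apply, Real.norm_of_nonneg (by positivity)]
    linarith [hp34 p hp]
  obtain ⟨hsum, hhas⟩ :=
    EulerProduct.summable_and_hasSum_smoothNumbers_prod_primesBelow_geometric hnorm k
  -- Rankin's trick: `d > T` extracts `T ^ (-η)`, and the remaining sum of `d ^ (-(1 - η))` is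
  -- completed to an Euler product over primes below `k`.
  have h1 : ∑ d ∈ F, 1 / (d : ℝ) ≤ ∑ d ∈ F, T ^ (-η) * natRpowNegHom (1 - η) d := by
    refine sum_le_sum fun d hd => ?_
    have hTd := (hF d hd).2
    have hd0 : (0:ℝ) < d := hT.trans hTd
    have e : 1 / (d : ℝ) = (d:ℝ) ^ (-η) * (d:ℝ) ^ (-(1 - η)) := by
      rw [← Real.rpow_add hd0]
      have : -η + -(1 - η) = -1 := by ring
      rw [this, Real.rpow_neg_one, one_div]
    rw [e, natRpowNegHom_apply]
    refine mul_le_mul_of_nonneg_right ?_ (by positivity)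
    exact Real.rpow_le_rpow_of_nonpos hT hTd.le (by linarith)
  refine h1.trans ?_
  rw [← mul_sum]
  refine mul_le_mul_of_nonneg_left ?_ (by positivity)
  have h2 : ∑ d ∈ F, natRpowNegHom (1 - η) d ≤
      ∏ p ∈ k.primesBelow, (1 - natRpowNegHom (1 - η) p)⁻¹ := by
    have h3 := sum_le_hasSum (F.subtype (· ∈ Nat.smoothNumbers k)) (fun d _ => by
      rw [natRpowNegHom_apply]; positivity) hhas
    refine le_trans (le_of_eq ?_) h3
    rw [sum_subtype_of_mem (fun d => natRpowNegHom (1 - η) d) (fun d hd => (hF d hd).1)]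
  refine h2.trans ?_
  have h3 : ∏ p ∈ k.primesBelow, (1 - natRpowNegHom (1 - η) p)⁻¹ ≤
      ∏ p ∈ k.primesBelow, Real.exp (4 * natRpowNegHom (1 - η) p) := by
    refine prod_le_prod (fun p hp => ?_) (fun p hp => ?_)
    · have := hp34 p (Nat.prime_of_mem_primesBelow hp)
      rw [natRpowNegHom_apply, inv_nonneg]; linarith
    · exact inv_one_sub_le_exp (by rw [natRpowNegHom_apply]; positivity)
        (hp34 p (Nat.prime_of_mem_primesBelow hp))
  refine h3.trans ?_
  rw [← Real.exp_sum, ← mul_sum]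
  refine Real.exp_le_exp.mpr (mul_le_mul_of_nonneg_left ?_ (by norm_num))
  -- The primes are replaced by all integers up to `k`. The loss in the exponent is harmless, since
  -- only smoothness bounds that are powers of `log x` occur.
  have hsub : k.primesBelow ⊆ Icc 1 k := by
    intro p hp
    have := Nat.lt_of_mem_primesBelow hp
    have := (Nat.prime_of_mem_primesBelow hp).one_lt
    rw [mem_Icc]; omega
  refine (sum_le_sum_of_subset_of_nonneg hsub fun n _ _ => by
    rw [natRpowNegHom_apply]; positivity).trans ?_
  refine le_trans (sum_le_sum fun n hn => ?_) (le_trans (le_of_eq (mul_sum _ _ _).symm)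
    (mul_le_mul_of_nonneg_left (sum_one_div_le_one_add_log k) (by positivity : (0:ℝ) ≤ (k:ℝ) ^ η)))
  have hn1 := mem_Icc.mp hn
  have hn0 : (0:ℝ) < n := by exact_mod_cast hn1.1
  have e : natRpowNegHom (1 - η) n = (n:ℝ) ^ η * (1 / n) := by
    rw [natRpowNegHom_apply, neg_sub, Real.rpow_sub hn0, Real.rpow_one]; ring
  rw [e]
  refine mul_le_mul_of_nonneg_right ?_ (by positivity)
  exact Real.rpow_le_rpow hn0.le (by exact_mod_cast hn1.2) hη.le

/-! ### Smooth numbers in residue classes. -/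

lemma card_residue_class_le {q : ℕ} (Y : ℕ) (c : ZMod q) :
    (((Icc 1 Y).filter fun m : ℕ => (m : ZMod q) = c).card : ℝ) ≤ (Y : ℝ) / q + 1 := by
  have h : ((Icc 1 Y).filter fun m : ℕ => (m : ZMod q) = c).card ≤ (range (Y / q + 1)).card := by
    refine card_le_card_of_injOn (fun m => m / q) ?_ ?_
    · intro m hm
      simp only [coe_filter, mem_Icc, Set.mem_ofPred_eq] at hm
      simp only [coe_range, Set.mem_Iio]
      exact Nat.lt_succ_of_le (Nat.div_le_div_right hm.1.2)
    · intro m hm m' hm' h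
      simp only [coe_filter, mem_Icc, Set.mem_ofPred_eq] at hm hm'
      have h2 : m % q = m' % q := (ZMod.natCast_eq_natCast_iff' m m' q).mp (hm.2.trans hm'.2.symm)
      rw [← Nat.div_add_mod m q, ← Nat.div_add_mod m' q, h2]
      simp only at h
      rw [h]
  rw [card_range] at h
  have h3 : ((Y / q : ℕ) : ℝ) ≤ (Y : ℝ) / q := Nat.cast_div_le
  have h4 : (((Icc 1 Y).filter fun m : ℕ => (m : ZMod q) = c).card : ℝ) ≤ ((Y / q + 1 : ℕ) : ℝ) := by
    exact_mod_cast h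
  push_cast at h4
  linarith

lemma card_multiples_residue_class_le {q : ℕ} (hq : 1 ≤ q) {x : ℝ} (hx : 0 ≤ x) {d : ℕ} (hd : 1 ≤ d)
    (a : (ZMod q)ˣ) :
    (((Icc 1 ⌊x⌋₊).filter fun n : ℕ => (n : ZMod q) = a ∧ d ∣ n).card : ℝ) ≤ x / (d * q) + 1 := by
  have hd0 : (0:ℝ) < d := by exact_mod_cast hd
  have hq0 : (0:ℝ) < q := by exact_mod_cast hq
  by_cases hdq : IsUnit (d : ZMod q)
  · obtain ⟨u, hu⟩ := hdq
    have h1 : ((Icc 1 ⌊x⌋₊).filter fun n : ℕ => (n : ZMod q) = a ∧ d ∣ n).card ≤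
        ((Icc 1 ⌊x / d⌋₊).filter fun m : ℕ => (m : ZMod q) = ((a * u⁻¹ : (ZMod q)ˣ) : ZMod q)).card := by
      refine card_le_card_of_injOn (fun n => n / d) ?_ ?_
      · intro n hn
        simp only [coe_filter, mem_Icc, Set.mem_ofPred_eq] at hn ⊢
        obtain ⟨⟨h1, h2⟩, h3, m, rfl⟩ := hn
        rw [Nat.mul_div_cancel_left _ (by omega), Nat.floor_div_natCast,
          Nat.le_div_iff_mul_le (by omega), mul_comm m]
        refine ⟨⟨Nat.pos_of_ne_zero (by rintro rfl; simp at h1), h2⟩, ?_⟩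
        rw [Nat.cast_mul, ← hu] at h3
        rw [Units.val_mul, Units.eq_mul_inv_iff_mul_eq, mul_comm]
        exact h3
      · intro n hn n' hn' h
        simp only [coe_filter, mem_Icc, Set.mem_ofPred_eq] at hn hn'
        simp only at h
        rw [← Nat.mul_div_cancel' hn.2.2, h, Nat.mul_div_cancel' hn'.2.2]
    have h2 := card_residue_class_le ⌊x / d⌋₊ ((a * u⁻¹ : (ZMod q)ˣ) : ZMod q)
    have h3 : ((⌊x / d⌋₊ : ℕ) : ℝ) ≤ x / d := Nat.floor_le (by positivity)
    calc _ ≤ ((⌊x / d⌋₊ : ℕ) : ℝ) / q + 1 := le_trans (by exact_mod_cast h1) h2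
      _ ≤ x / d / q + 1 := by gcongr
      _ = _ := by rw [div_div]
  · rw [filter_false_of_mem]
    · simp; positivity
    · rintro n - ⟨h1, m, rfl⟩
      apply hdq
      have := a.isUnit
      rw [← h1, Nat.cast_mul] at this
      exact isUnit_of_mul_isUnit_left this

/-- Take the least divisor of `n` exceeding `T`. Removing one of its primes, which is less than `k`,
gives a divisor at most `T`. -/
lemma exists_smooth_divisor {k n : ℕ} {T : ℝ} (hT : 1 ≤ T) (hn : n ∈ Nat.smoothNumbers k) (hTn : T < n) :
    ∃ d, d ∣ n ∧ d ∈ Nat.smoothNumbers k ∧ T < d ∧ (d : ℝ) ≤ T * k := by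
  classical
  have hex : ∃ d, d ∣ n ∧ T < (d : ℝ) := ⟨n, dvd_rfl, hTn⟩
  obtain ⟨h1, h2⟩ := Nat.find_spec hex
  set d := Nat.find hex with hd
  have hds := Nat.mem_smoothNumbers_of_dvd hn h1
  refine ⟨d, h1, hds, h2, ?_⟩
  have hd1 : d ≠ 1 := by rintro h; rw [h] at h2; norm_num at h2; linarith
  obtain ⟨p, hp, m, hm⟩ := Nat.exists_prime_and_dvd hd1
  have hd0 : d ≠ 0 := hds.1
  have hm0 : 0 < m := Nat.pos_of_ne_zero (by rintro rfl; simp at hm; exact hd0 hm)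
  have hmd : m < d := by rw [hm]; nlinarith [hp.two_le]
  have hmT : (m : ℝ) ≤ T := by
    by_contra hc
    exact Nat.find_min hex hmd ⟨(Dvd.intro_left p hm.symm).trans h1, not_le.mp hc⟩
  have hpk : p < k := (Nat.mem_smoothNumbers'.mp hds) p hp (Dvd.intro m hm.symm)
  have hpk' : (p : ℝ) ≤ k := by exact_mod_cast hpk.le
  have : (d : ℝ) = p * m := by rw [hm]; push_cast; rfl
  rw [this, mul_comm]
  exact mul_le_mul hmT hpk' (by positivity) (by linarith)

open Classical in
lemma card_smooth_le {k : ℕ} {x T ρ : ℝ} (hx : 0 ≤ x) (hT : 1 ≤ T)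
    (hρ : ∀ F : Finset ℕ, (∀ d ∈ F, d ∈ Nat.smoothNumbers k ∧ T < d) → ∑ d ∈ F, 1 / (d : ℝ) ≤ ρ) :
    (((Icc 1 ⌊x⌋₊).filter fun n : ℕ => n ∈ Nat.smoothNumbers k).card : ℝ) ≤ T + x * ρ := by
  rw [← card_filter_add_card_filter_not (s := (Icc 1 ⌊x⌋₊).filter fun n : ℕ => n ∈ Nat.smoothNumbers k)
    (fun n : ℕ => (n : ℝ) ≤ T)]
  push_cast
  refine add_le_add ?_ ?_
  · have : (((Icc 1 ⌊x⌋₊).filter fun n : ℕ => n ∈ Nat.smoothNumbers k).filter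
        fun n : ℕ => (n : ℝ) ≤ T).card ≤ (Icc 1 ⌊T⌋₊).card := by
      refine card_le_card fun n hn => ?_
      simp only [mem_filter, mem_Icc] at hn ⊢
      exact ⟨hn.1.1.1, Nat.le_floor hn.2⟩
    rw [Nat.card_Icc, Nat.add_sub_cancel] at this
    exact le_trans (by exact_mod_cast this) (Nat.floor_le (by linarith))
  · set F := ((Icc 1 ⌊x⌋₊).filter fun n : ℕ => n ∈ Nat.smoothNumbers k).filter
        fun n : ℕ => ¬ (n : ℝ) ≤ T with hF
    have h := hρ F fun d hd => by
      simp only [hF, mem_filter] at hd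
      exact ⟨hd.1.2, not_le.mp hd.2⟩
    refine le_trans ?_ (mul_le_mul_of_nonneg_left h hx)
    rw [mul_sum, ← nsmul_one, ← sum_const]
    refine sum_le_sum fun d hd => ?_
    simp only [hF, mem_filter, mem_Icc] at hd
    have hd0 : (0:ℝ) < d := by exact_mod_cast hd.1.1.1
    rw [mul_one_div, le_div_iff₀ hd0, one_mul]
    exact (Nat.le_floor_iff hx).mp hd.1.1.2

-- A smooth integer above `T` is a multiple of some smooth `d` in `(T, T k]`. As `d q ≤ x`, the
-- multiples of `d` in the class number at most `2 x / (d q)`; this gains the factor `1 / q` needed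
-- for summing over the moduli.
open Classical in
lemma card_smooth_residue_class_le {k q : ℕ} (hq : 1 ≤ q) {x T ρ : ℝ} (hx : 0 ≤ x) (hT : 1 ≤ T)
    (hTk : T * k * q ≤ x)
    (hρ : ∀ F : Finset ℕ, (∀ d ∈ F, d ∈ Nat.smoothNumbers k ∧ T < d) → ∑ d ∈ F, 1 / (d : ℝ) ≤ ρ)
    (a : (ZMod q)ˣ) :
    (((Icc 1 ⌊x⌋₊).filter fun n : ℕ => (n : ZMod q) = a ∧ n ∈ Nat.smoothNumbers k).card : ℝ) ≤
      T + 2 * x * ρ / q := by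
  have hq0 : (0:ℝ) < q := by exact_mod_cast hq
  set G := (Icc 1 ⌊T * k⌋₊).filter fun d : ℕ => d ∈ Nat.smoothNumbers k ∧ T < (d:ℝ) with hG
  have hsub : ((Icc 1 ⌊x⌋₊).filter fun n : ℕ => (n : ZMod q) = a ∧ n ∈ Nat.smoothNumbers k) ⊆
      (Icc 1 ⌊T⌋₊) ∪ G.biUnion fun d => (Icc 1 ⌊x⌋₊).filter fun n : ℕ => (n : ZMod q) = a ∧ d ∣ n := by
    intro n hn
    simp only [mem_filter, mem_Icc] at hn
    rw [mem_union]
    rcases le_or_gt (n : ℝ) T with h | h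
    · exact Or.inl (mem_Icc.mpr ⟨hn.1.1, Nat.le_floor h⟩)
    · right
      obtain ⟨d, h1, h2, h3, h4⟩ := exists_smooth_divisor hT hn.2.2 h
      simp only [mem_biUnion, hG, mem_filter, mem_Icc]
      exact ⟨d, ⟨⟨Nat.one_le_iff_ne_zero.mpr h2.1, Nat.le_floor h4⟩, h2, h3⟩, hn.1, hn.2.1, h1⟩
  have h1 := (card_le_card hsub).trans ((card_union_le _ _).trans (add_le_add le_rfl card_biUnion_le))
  rw [Nat.card_Icc, Nat.add_sub_cancel] at h1
  have h2 : (((Icc 1 ⌊x⌋₊).filter fun n : ℕ => (n : ZMod q) = a ∧ n ∈ Nat.smoothNumbers k).card : ℝ) ≤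
      ⌊T⌋₊ + ∑ d ∈ G, (((Icc 1 ⌊x⌋₊).filter fun n : ℕ => (n : ZMod q) = a ∧ d ∣ n).card : ℝ) := by
    exact_mod_cast h1
  refine h2.trans (add_le_add (Nat.floor_le (by linarith)) ?_)
  have h3 : ∀ d ∈ G, (((Icc 1 ⌊x⌋₊).filter fun n : ℕ => (n : ZMod q) = a ∧ d ∣ n).card : ℝ) ≤
      2 * x / q * (1 / d) := by
    intro d hd
    simp only [hG, mem_filter, mem_Icc] at hd
    have hd0 : (0:ℝ) < d := by exact_mod_cast hd.1.1
    refine (card_multiples_residue_class_le hq hx hd.1.1 a).trans ?_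
    have hdT : (d:ℝ) ≤ T * k := (Nat.le_floor_iff (by positivity)).mp hd.1.2
    have h4 : 1 ≤ x / (d * q) := by
      rw [le_div_iff₀ (by positivity), one_mul]
      exact (mul_le_mul_of_nonneg_right hdT hq0.le).trans hTk
    have h5 : 2 * x / q * (1 / d) = 2 * (x / (d * q)) := by field_simp
    rw [h5]; linarith
  refine (sum_le_sum h3).trans ?_
  rw [← mul_sum]
  have h6 := hρ G fun d hd => (mem_filter.mp hd).2
  calc _ ≤ 2 * x / q * ρ := mul_le_mul_of_nonneg_left h6 (by positivity)
    _ = _ := by ring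

lemma card_chars_of_conductor_le (D : ℝ) (hD : 0 ≤ D) (q : ℕ) (hq : 1 ≤ q) :
    ((finite_inducedChars (primitiveCharsUpTo D) q).toFinset.card : ℝ) ≤ D ^ 2 := by
  classical
  have : NeZero q := ⟨by omega⟩
  have h : (finite_inducedChars (primitiveCharsUpTo D) q).toFinset.card ≤
      ((Icc 1 ⌊D⌋₊).sigma fun r => (univ : Finset (DirichletCharacter ℂ r))).card := by
    refine card_le_card_of_injOn (fun χ => ⟨χ.conductor, χ.primitiveCharacter⟩) ?_ ?_
    · intro χ hχ
      rw [Set.Finite.coe_toFinset, mem_inducedChars_primitiveCharsUpTo hq] at hχ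
      simp only [coe_sigma, Set.mem_sigma_iff, coe_Icc, Set.mem_Icc, coe_univ, Set.mem_univ, and_true]
      exact ⟨Nat.one_le_iff_ne_zero.mpr χ.conductor_ne_zero, Nat.le_floor hχ⟩
    · intro χ _ χ' _ h
      have := changeLevel_eq_of_sigma_eq χ.conductor_dvd_level χ'.conductor_dvd_level _ _ h
      rwa [χ.changeLevel_primitiveCharacter, χ'.changeLevel_primitiveCharacter] at this
  rw [card_sigma] at h
  have h2 : ∑ r ∈ Icc 1 ⌊D⌋₊, (univ : Finset (DirichletCharacter ℂ r)).card ≤ ⌊D⌋₊ * ⌊D⌋₊ := by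
    calc _ ≤ ∑ r ∈ Icc 1 ⌊D⌋₊, ⌊D⌋₊ := by
          refine sum_le_sum fun r hr => ?_
          have hr1 := mem_Icc.mp hr
          have : NeZero r := ⟨by omega⟩
          rw [card_univ, ← Nat.card_eq_fintype_card,
            DirichletCharacter.card_eq_totient_of_hasEnoughRootsOfUnity]
          exact (Nat.totient_le r).trans hr1.2
      _ = _ := by simp
  have h3 : ((finite_inducedChars (primitiveCharsUpTo D) q).toFinset.card : ℝ) ≤ (⌊D⌋₊ : ℝ) * ⌊D⌋₊ := by
    exact_mod_cast h.trans h2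
  have h4 := Nat.floor_le hD
  nlinarith [Nat.cast_nonneg (α := ℝ) ⌊D⌋₊]

/-- No cancellation is used: both the congruence sum and the at most `D ^ 2` character sums in the
main term are bounded by counts of smooth numbers. -/
lemma totalDiscrepancy_smooth_le {k : ℕ} {x Q D T ρ : ℝ} (hx : 0 ≤ x) (hD : 0 ≤ D) (hT : 1 ≤ T)
    (hTk : T * k * Q ≤ x)
    (hρ : ∀ F : Finset ℕ, (∀ d ∈ F, d ∈ Nat.smoothNumbers k ∧ T < d) → ∑ d ∈ F, 1 / (d : ℝ) ≤ ρ)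
    (f : ℕ → ℂ) (hf1 : ∀ n, ‖f n‖ ≤ 1) (hf : ∀ n, f n ≠ 0 → n ∈ Nat.smoothNumbers k) :
    totalDiscrepancy (primitiveCharsUpTo D) Q f x ≤
      ⌊Q⌋₊ * T + (2 * x * ρ + D ^ 2 * (T + x * ρ)) * (4 * (1 + Real.log ⌊Q⌋₊)) := by
  classical
  have hρ0 : 0 ≤ ρ := by simpa using hρ ∅ (by simp)
  have hsum : ∀ (F : Finset ℕ), ‖∑ n ∈ F, f n‖ ≤
      ((F.filter fun n => n ∈ Nat.smoothNumbers k).card : ℝ) := by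
    intro F
    refine (norm_sum_le _ _).trans ?_
    rw [card_filter]
    push_cast
    refine sum_le_sum fun n _ => ?_
    split_ifs with h
    · exact hf1 n
    · have : f n = 0 := by by_contra hc; exact h (hf n hc)
      rw [this, norm_zero]
  have hmain : ∀ q : ℕ, 1 ≤ q → (q : ℝ) ≤ Q → ∀ a : (ZMod q)ˣ,
      ‖discrepancy (primitiveCharsUpTo D) f x q a‖ ≤
        T + (2 * x * ρ + D ^ 2 * (T + x * ρ)) * (1 / q.totient) := by
    intro q hq hqQ a
    have hφ0 : (0:ℝ) < q.totient := by exact_mod_cast Nat.totient_pos.mpr (by omega)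
    unfold discrepancy
    refine (norm_sub_le _ _).trans ?_
    have h1 : ‖∑ n ∈ (Icc 1 ⌊x⌋₊).filter (fun n : ℕ => (n : ZMod q) = a), f n‖ ≤
        T + 2 * x * ρ * (1 / q.totient) := by
      refine (hsum _).trans ?_
      rw [filter_filter]
      refine (card_smooth_residue_class_le hq hx hT ?_ hρ a).trans ?_
      · exact (mul_le_mul_of_nonneg_left hqQ (by positivity)).trans hTk
      · rw [div_eq_mul_one_div]
        gcongr
        exact_mod_cast Nat.totient_le q
    have h2 : ‖(1 / (Nat.totient q : ℂ)) * ∑ᶠ χ ∈ inducedChars (primitiveCharsUpTo D) q,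
        χ a * charSum f x χ‖ ≤ D ^ 2 * (T + x * ρ) * (1 / q.totient) := by
      rw [norm_mul, mul_comm]
      have hn : ‖(1 / (q.totient : ℂ))‖ = 1 / (q.totient : ℝ) := by
        rw [norm_div, norm_one, Complex.norm_natCast]
      rw [hn]
      refine mul_le_mul_of_nonneg_right ?_ (by positivity)
      rw [finsum_mem_eq_finite_toFinset_sum _ (finite_inducedChars _ q)]
      refine (norm_sum_le_of_le _ (f := fun χ : DirichletCharacter ℂ q => χ a * charSum f x χ)
        (n := fun _ => T + x * ρ) fun χ _ => ?_).trans ?_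
      · rw [norm_mul, χ.unit_norm_eq_one, one_mul]
        refine le_trans ?_ (card_smooth_le hx hT hρ)
        unfold charSum
        refine (norm_sum_le _ _).trans ?_
        rw [card_filter]
        push_cast
        refine sum_le_sum fun n _ => ?_
        rw [norm_mul, Complex.norm_conj]
        split_ifs with h
        · exact mul_le_one₀ (hf1 n) (norm_nonneg _) (DirichletCharacter.norm_le_one χ _)
        · have : f n = 0 := by by_contra hc; exact h (hf n hc)
          rw [this, norm_zero, zero_mul]
      · rw [sum_const, nsmul_eq_mul]
        exact mul_le_mul_of_nonneg_right (card_chars_of_conductor_le D hD q hq) (by positivity)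
    calc _ ≤ _ := add_le_add h1 h2
      _ = _ := by ring
  refine (totalDiscrepancy_le _ hmain).trans ?_
  rw [sum_add_distrib, ← mul_sum, sum_const, Nat.card_Icc, Nat.add_sub_cancel, nsmul_eq_mul]
  refine add_le_add le_rfl (mul_le_mul_of_nonneg_left (sum_one_div_totient_le _) (by positivity))

/-! ### The contribution of integers with a prime factor of medium size -/

lemma sum_sqrt_two_pow_le (y : ℝ) (L : ℕ) :
    ∑ l ∈ (range L).filter (fun l => (2:ℝ) ^ l ≤ y), √((2:ℝ) ^ l) ≤ 4 * √y := by
  set S := (range L).filter (fun l => (2:ℝ) ^ l ≤ y) with hS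
  rcases S.eq_empty_or_nonempty with h | h
  · rw [h, sum_empty]; positivity
  set m := S.max' h
  have hm : (2:ℝ) ^ m ≤ y := (mem_filter.mp (S.max'_mem h)).2
  have hsub : S ⊆ range (m + 1) := fun l hl => mem_range.mpr (Nat.lt_succ_of_le (S.le_max' l hl))
  have hpow : ∀ l : ℕ, √((2:ℝ) ^ l) = (√2) ^ l := fun l => by
    induction l with
    | zero => simp
    | succ l ih => rw [pow_succ, Real.sqrt_mul (by positivity), ih, pow_succ]
  refine (sum_le_sum_of_subset_of_nonneg hsub fun _ _ _ => Real.sqrt_nonneg _).trans ?_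
  simp_rw [hpow]
  have h2 : (1.4:ℝ) ≤ √2 := Real.le_sqrt_of_sq_le (by norm_num)
  have h2' : √2 ^ 2 = (2:ℝ) := Real.sq_sqrt (by norm_num)
  rw [geom_sum_eq (by linarith)]
  have h3 : √2 ^ m ≤ √y := by rw [← hpow]; exact Real.sqrt_le_sqrt hm
  rw [div_le_iff₀ (by linarith), pow_succ]
  have h4 : 0 ≤ √2 ^ m := by positivity
  nlinarith

section MediumPrimes

variable {κ : ℕ → ℕ → ℂ} {P : ℕ → Prop}

lemma norm_primePowerCoeff_le (hκ : ∀ p i, p.Prime → 1 ≤ i → ‖κ p i‖ ≤ 1) {i : ℕ} (hi : 1 ≤ i) (e : ℕ) :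
    ‖primePowerCoeff κ P i e‖ ≤ 1 := by
  unfold primePowerCoeff
  split_ifs with h
  · exact hκ _ _ h.1 hi
  · simp

lemma of_dyadicPart_primePowerCoeff_ne_zero {i l e : ℕ}
    (h : dyadicPart (primePowerCoeff κ P i) l e ≠ 0) :
    2 ^ l ≤ e ∧ e < 2 ^ (l + 1) ∧ e.minFac.Prime ∧ P e.minFac ∧ e = e.minFac ^ i := by
  unfold dyadicPart primePowerCoeff at h
  split_ifs at h with h1 h2
  · have he : e ≠ 0 := by
      rw [h2.2.2]; exact (pow_pos h2.1.pos i).ne'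
    refine ⟨?_, ?_, h2⟩
    · rw [← h1]; exact Nat.pow_log_le_self 2 he
    · rw [← h1]; exact Nat.lt_pow_succ_log_self (by norm_num) e
  · exact absurd rfl h
  · exact absurd rfl h

lemma norm_dyadicPart_le (a : ℕ → ℂ) (l e : ℕ) : ‖dyadicPart a l e‖ ≤ ‖a e‖ := by
  unfold dyadicPart; split_ifs <;> simp

open Classical in
lemma sq_ell2Norm_dyadicPart_le (hκ : ∀ p i, p.Prime → 1 ≤ i → ‖κ p i‖ ≤ 1) {i : ℕ} (hi : 1 ≤ i)
    (l M : ℕ) : ell2Norm M (dyadicPart (primePowerCoeff κ P i) l) ^ 2 ≤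
      ((range M).filter fun e => dyadicPart (primePowerCoeff κ P i) l e ≠ 0).card := by
  rw [sq_ell2Norm, card_filter]
  push_cast
  refine sum_le_sum fun e _ => ?_
  split_ifs with h
  · have := (norm_dyadicPart_le (primePowerCoeff κ P i) l e).trans (norm_primePowerCoeff_le hκ hi e)
    exact pow_le_one₀ (norm_nonneg _) this
  · rw [not_not.mp h]; simp

lemma ell2Norm_dyadicPart_le (hκ : ∀ p i, p.Prime → 1 ≤ i → ‖κ p i‖ ≤ 1) {i : ℕ} (hi : 1 ≤ i)
    (l M : ℕ) : ell2Norm M (dyadicPart (primePowerCoeff κ P i) l) ≤ √((2:ℝ) ^ l) := by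
  classical
  refine Real.le_sqrt_of_sq_le ((sq_ell2Norm_dyadicPart_le hκ hi l M).trans ?_)
  have : ((range M).filter fun e => dyadicPart (primePowerCoeff κ P i) l e ≠ 0).card ≤
      (Ico (2 ^ l) (2 ^ (l + 1))).card := by
    refine card_le_card fun e he => ?_
    have h := of_dyadicPart_primePowerCoeff_ne_zero (mem_filter.mp he).2
    exact mem_Ico.mpr ⟨h.1, h.2.1⟩
  rw [Nat.card_Ico, pow_succ] at this
  have h2 : 2 ^ l * 2 - 2 ^ l = 2 ^ l := by omega
  rw [h2] at this
  exact_mod_cast this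

/-- An `i`-th power with `i ≥ 2` below `2 ^ (l + 1)` has base at most `√(2 ^ (l + 1))`, so the block
has few nonzero coefficients. -/
lemma ell2Norm_dyadicPart_le_of_two_le (hκ : ∀ p i, p.Prime → 1 ≤ i → ‖κ p i‖ ≤ 1) {i : ℕ} (hi : 2 ≤ i)
    (l M : ℕ) : ell2Norm M (dyadicPart (primePowerCoeff κ P i) l) ≤ √(√((2:ℝ) ^ (l + 1))) := by
  classical
  refine Real.le_sqrt_of_sq_le ((sq_ell2Norm_dyadicPart_le hκ (by omega) l M).trans ?_)
  have : ((range M).filter fun e => dyadicPart (primePowerCoeff κ P i) l e ≠ 0).card ≤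
      (Icc 1 (Nat.sqrt (2 ^ (l + 1)))).card := by
    refine card_le_card_of_injOn Nat.minFac ?_ ?_
    · intro e he
      obtain ⟨-, h2, h3, -, h5⟩ := of_dyadicPart_primePowerCoeff_ne_zero (mem_filter.mp he).2
      rw [coe_Icc, Set.mem_Icc]
      refine ⟨h3.one_lt.le, Nat.le_sqrt.mpr ?_⟩
      have : e.minFac ^ 2 ≤ e.minFac ^ i := Nat.pow_le_pow_right h3.pos hi
      rw [← h5, sq] at this
      omega
    · intro e he e' he' h
      obtain ⟨-, -, -, -, h5⟩ := of_dyadicPart_primePowerCoeff_ne_zero (mem_filter.mp he).2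
      obtain ⟨-, -, -, -, h5'⟩ := of_dyadicPart_primePowerCoeff_ne_zero (mem_filter.mp he').2
      rw [h5, h5', h]
  rw [Nat.card_Icc, Nat.add_sub_cancel] at this
  have h2 : ((Nat.sqrt (2 ^ (l + 1)) : ℕ) : ℝ) ≤ √((2:ℝ) ^ (l + 1)) := by
    refine Real.le_sqrt_of_sq_le ?_
    have := Nat.sqrt_le' (2 ^ (l + 1))
    exact_mod_cast this
  exact le_trans (by exact_mod_cast this) h2

lemma norm_cofactorCoeff_le {f : ℕ → ℂ} (hf : ∀ n, ‖f n‖ ≤ 1) (S : ℕ → Prop) {i : ℕ} (hi : 1 ≤ i)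
    (d : ℕ) : ‖cofactorCoeff f S P i d‖ ≤ 1 := by
  unfold cofactorCoeff
  split_ifs
  · rw [norm_div, Complex.norm_natCast]
    refine div_le_one_of_le₀ ((hf d).trans ?_) (by positivity)
    exact_mod_cast (by omega : 1 ≤ omegaOn P d + i)
  · simp

lemma cofactorCoeff_zero (f : ℕ → ℂ) (S : ℕ → Prop) (i : ℕ) : cofactorCoeff f S P i 0 = 0 := by
  simp [cofactorCoeff]

lemma ell2Norm_cofactorCoeff_le {f : ℕ → ℂ} (hf : ∀ n, ‖f n‖ ≤ 1) (S : ℕ → Prop) {i : ℕ} (hi : 1 ≤ i)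
    (N : ℕ) : ell2Norm (N + 1) (cofactorCoeff f S P i) ≤ √N := by
  refine Real.sqrt_le_sqrt ?_
  rw [sum_range_succ', cofactorCoeff_zero]
  simp only [norm_zero, ne_eq, OfNat.ofNat_ne_zero, not_false_eq_true, zero_pow, add_zero]
  calc _ ≤ ∑ d ∈ range N, (1:ℝ) := sum_le_sum fun d _ =>
        pow_le_one₀ (norm_nonneg _) (norm_cofactorCoeff_le hf S hi _)
    _ = N := by simp

lemma ell2Norm_eq_zero_of_forall {M : ℕ} {a : ℕ → ℂ} (h : ∀ e, a e = 0) : ell2Norm M a = 0 := by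
  unfold ell2Norm; simp [h]

/-- The contribution of a single dyadic block. -/
lemma largeConductorMean_block_le {D Q : ℝ} (hD : 1 ≤ D) {J : ℕ} (hJ1 : Q ≤ 2 ^ J * D)
    (hJ2 : 2 ^ J * D ≤ 2 * Q) {x : ℝ} (hx : 1 ≤ x) {L : ℕ} (hL : ⌊x⌋₊ + 1 < 2 ^ L)
    {f : ℕ → ℂ} (hf : ∀ n, ‖f n‖ ≤ 1) (S : ℕ → Prop) {i l : ℕ} (hi : 1 ≤ i) {α ℓ : ℝ}
    (hℓ : 1 + Real.log ⌊Q⌋₊ ≤ ℓ)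
    (hα : ell2Norm (2 ^ (l + 1)) (dyadicPart (primePowerCoeff κ P i) l) ≤ α * √((2:ℝ) ^ l)) :
    largeConductorMean D Q
      (dirichletConv (dyadicPart (primePowerCoeff κ P i) l) (cofactorCoeff f S P i)) x ≤
      if (2:ℝ) ^ l ≤ x then
        192 * ℓ * L * (2 * Q * √x + J * (√x * √((2:ℝ) ^ l) + x / √((2:ℝ) ^ l)) + x / D) * α else 0 := by
  have hQ : 0 ≤ Q := by
    have : 0 < 2 ^ J * D := by positivity
    linarith
  set E : ℝ := (2:ℝ) ^ l with hE
  have hE0 : 0 < E := by positivity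
  set a := dyadicPart (primePowerCoeff κ P i) l with ha
  set b := cofactorCoeff f S P i with hb
  set X := ⌊x⌋₊ with hX
  have ha0 : a 0 = 0 := by
    by_contra h
    have := of_dyadicPart_primePowerCoeff_ne_zero h
    have h2 : 0 < 2 ^ l := by positivity
    omega
  have haM : ∀ e, a e ≠ 0 → e < 2 ^ (l + 1) := fun e he =>
    (of_dyadicPart_primePowerCoeff_ne_zero he).2.1
  have hbN : ∀ e d, a e ≠ 0 → e * d ≤ X → d < X / 2 ^ l + 1 := by
    intro e d he hed
    have h1 := (of_dyadicPart_primePowerCoeff_ne_zero he).1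
    rw [Nat.lt_succ_iff, Nat.le_div_iff_mul_le (by positivity), mul_comm]
    exact (Nat.mul_le_mul_right d h1).trans hed
  have hmain := largeConductorMean_dirichletConv_le (by linarith : 1 / 2 ≤ D) hJ1 hJ2 a b x
    (2 ^ (l + 1)) (X / 2 ^ l + 1) L hL ha0 (cofactorCoeff_zero f S i) haM hbN
  have hbnorm := ell2Norm_cofactorCoeff_le (P := P) hf S hi (X / 2 ^ l)
  rw [← hb] at hbnorm
  have hl0 : 0 ≤ 1 + Real.log ⌊Q⌋₊ := by
    have := Real.log_natCast_nonneg ⌊Q⌋₊; linarith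
  split_ifs with hEx
  · have hXE : ((X / 2 ^ l : ℕ) : ℝ) ≤ x / E := by
      calc ((X / 2 ^ l : ℕ) : ℝ) ≤ (X : ℝ) / ((2 ^ l : ℕ) : ℝ) := Nat.cast_div_le
        _ ≤ x / E := by
          push_cast
          exact div_le_div_of_nonneg_right (Nat.floor_le (by linarith)) hE0.le
    have hb1 : ell2Norm (X / 2 ^ l + 1) b ≤ √x / √E := by
      rw [← Real.sqrt_div' _ hE0.le]
      exact hbnorm.trans (Real.sqrt_le_sqrt hXE)
    have hxE : 1 ≤ x / E := (one_le_div hE0).mpr hEx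
    have hsM : √((2 ^ (l + 1) : ℕ) : ℝ) ≤ 2 * √E := by
      rw [Real.sqrt_le_left (by positivity), mul_pow, Real.sq_sqrt hE0.le]
      push_cast; rw [pow_succ]; linarith
    have hsN : √((X / 2 ^ l + 1 : ℕ) : ℝ) ≤ 2 * (√x / √E) := by
      rw [← Real.sqrt_div' _ hE0.le, Real.sqrt_le_left (by positivity), mul_pow,
        Real.sq_sqrt (by positivity)]
      push_cast; linarith
    have hsE : 0 < √E := Real.sqrt_pos.mpr hE0
    have hsx : 0 < √x := Real.sqrt_pos.mpr (by linarith)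
    have hMN : √((2 ^ (l + 1) : ℕ) : ℝ) * √((X / 2 ^ l + 1 : ℕ) : ℝ) ≤ 2 * √x := by
      rw [← Real.sqrt_mul (by positivity), Real.sqrt_le_left (by positivity), mul_pow,
        Real.sq_sqrt (by linarith)]
      have h1 : ((2 ^ (l + 1) : ℕ) : ℝ) = 2 * E := by push_cast; rw [pow_succ]; ring
      have h2 : ((X / 2 ^ l + 1 : ℕ) : ℝ) ≤ 2 * (x / E) := by push_cast; linarith
      rw [h1]
      calc 2 * E * ((X / 2 ^ l + 1 : ℕ) : ℝ) ≤ 2 * E * (2 * (x / E)) := by gcongr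
        _ = 2 ^ 2 * x := by field_simp
    have hab : ell2Norm (2 ^ (l + 1)) a * ell2Norm (X / 2 ^ l + 1) b ≤ (α * √E) * (√x / √E) :=
      mul_le_mul hα hb1 (ell2Norm_nonneg _ _) ((ell2Norm_nonneg _ _).trans hα)
    have hα0 : 0 ≤ α := by
      have := (ell2Norm_nonneg _ _).trans hα
      by_contra hc
      have : α * √E < 0 := mul_neg_of_neg_of_pos (not_le.mp hc) hsE
      linarith
    have hab' : (α * √E) * (√x / √E) = α * √x := by field_simp
    rw [hab'] at hab
    refine hmain.trans ?_
    have hD0 : 0 < D := by linarith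
    calc _ ≤ 4 * ℓ * (24 * L * (4 * Q + J * (2 * √E + 2 * (√x / √E)) + 2 * √x / D) * (α * √x)) := by
          refine mul_le_mul (by linarith) ?_ ?_ (by linarith)
          · refine mul_le_mul ?_ hab (mul_nonneg (ell2Norm_nonneg _ _) (ell2Norm_nonneg _ _)) ?_
            · gcongr
            · positivity
          · have := ell2Norm_nonneg (2 ^ (l + 1)) a
            have := ell2Norm_nonneg (X / 2 ^ l + 1) b
            positivity
      _ = 192 * ℓ * L * (2 * Q * √x + J * (√x * √E + √x * √x / √E) + √x * √x / D) * α := by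
          field_simp; ring
      _ = _ := by rw [Real.mul_self_sqrt (by linarith)]
  -- If the block starts beyond `x`, the cofactor is confined to `d = 0`, where its coefficient
  -- vanishes.
  · have h0 : X / 2 ^ l = 0 := by
      refine Nat.div_eq_of_lt ?_
      have : (X : ℝ) < ((2 ^ l : ℕ) : ℝ) := by
        push_cast
        exact lt_of_le_of_lt (Nat.floor_le (by linarith)) (not_le.mp hEx)
      exact_mod_cast this
    rw [h0] at hbnorm hmain
    have hb0 : ell2Norm (0 + 1) b = 0 :=
      le_antisymm (by simpa using hbnorm) (ell2Norm_nonneg _ _)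
    rw [hb0, mul_zero, mul_zero, mul_zero] at hmain
    exact hmain

end MediumPrimes

open Classical in
/-- The restriction of `f` to the integers without prime factors exceeding `y`, and with a prime factor
exceeding `z`. -/
noncomputable def mediumPart (f : ℕ → ℂ) (y z : ℝ) : ℕ → ℂ := fun n =>
  if (∀ p, p.Prime → p ∣ n → (p : ℝ) ≤ y) ∧ ∃ p, p.Prime ∧ p ∣ n ∧ (z < (p : ℝ) ∧ (p : ℝ) ≤ y)
  then f n else 0

lemma IsClassC.largeConductorMean_mediumPart_le {f : ArithmeticFunction ℂ} (hf : IsClassC f)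
    {D Q : ℝ} (hD : 1 ≤ D) {J : ℕ} (hJ1 : Q ≤ 2 ^ J * D) (hJ2 : 2 ^ J * D ≤ 2 * Q)
    {x y z : ℝ} (hx : 1 ≤ x) (hz : 1 ≤ z) {L : ℕ} (hL : ⌊x⌋₊ + 1 < 2 ^ L)
    {ℓ : ℝ} (hℓ : 1 + Real.log ⌊Q⌋₊ ≤ ℓ) :
    largeConductorMean D Q (mediumPart f y z) x ≤ 192 * ℓ * L *
      (L * (2 * Q * √x + x / D + 2 * J * (x / √z)) + 4 * J * (√x * √y) +
        L * L * (4 * ((2 * Q * √x + x / D) / √z) + 2 * J * (√x * √√x) + 8 * J * (x / √z))) := by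
  classical
  obtain ⟨κ, hκ1, hκ2⟩ := hf.exists_local_coefficients
  set S : ℕ → Prop := fun p => (p : ℝ) ≤ y with hS
  set P : ℕ → Prop := fun p => z < (p : ℝ) ∧ (p : ℝ) ≤ y with hP
  have hQ : 0 ≤ Q := by
    have : 0 < 2 ^ J * D := by positivity
    linarith
  have hℓ0 : 0 ≤ ℓ := by
    have := Real.log_natCast_nonneg ⌊Q⌋₊; linarith
  have hsz : 0 < √z := Real.sqrt_pos.mpr (by linarith)
  have hsz1 : 1 ≤ √z := Real.one_le_sqrt.mpr hz
  have hD0 : 0 < D := by linarith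
  have hx0 : 0 < x := by linarith
  have hdecomp : ∀ n, 1 ≤ n → n ≤ ⌊x⌋₊ → mediumPart f y z n =
      ∑ j ∈ Icc 1 L ×ˢ range L,
        dirichletConv (dyadicPart (primePowerCoeff κ P j.1) j.2) (cofactorCoeff f S P j.1) n := by
    intro n hn hnx
    rw [sum_product, IsClassC.sum_dirichletConv_eq hκ2 S P (fun p hp => hp.2) (by omega) (by omega)]
    rfl
  refine (largeConductorMean_le_sum _ _ _ D Q x hdecomp).trans ?_
  rw [sum_product]
  have hf1 : ∀ n, ‖f n‖ ≤ 1 := hf.norm_le_one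
  set c := 192 * ℓ * L with hc
  have hc0 : 0 ≤ c := by positivity
  have hsqrt4 : ∀ {u v : ℝ}, 0 ≤ v → u ≤ 4 * v → √u ≤ 2 * √v := by
    intro u v hv huv
    rw [Real.sqrt_le_left (by positivity), mul_pow, Real.sq_sqrt hv]
    linarith
  -- first powers of primes
  have hone : ∀ l ∈ range L, largeConductorMean D Q
      (dirichletConv (dyadicPart (primePowerCoeff κ P 1) l) (cofactorCoeff f S P 1)) x ≤
      c * ((2 * Q * √x + x / D + 2 * J * (x / √z)) +
        J * √x * (if (2:ℝ) ^ l ≤ y then √((2:ℝ) ^ l) else 0)) := by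
    intro l _
    have hE0 : (0:ℝ) < 2 ^ l := by positivity
    have hnonneg : 0 ≤ c * ((2 * Q * √x + x / D + 2 * J * (x / √z)) +
        J * √x * (if (2:ℝ) ^ l ≤ y then √((2:ℝ) ^ l) else 0)) := by
      have : (0:ℝ) ≤ if (2:ℝ) ^ l ≤ y then √((2:ℝ) ^ l) else 0 := by split_ifs <;> positivity
      positivity
    -- Otherwise the block contains no prime in `(z, y]` and `α = 0` serves. The condition `2 ^ l ≤
    -- y` is kept so that `√(2 ^ l)` sums geometrically to `O(√y)`, without a factor `L`.
    by_cases hcond : (2:ℝ) ^ l ≤ y ∧ z < 2 ^ (l + 1)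
    · rw [if_pos hcond.1] at hnonneg ⊢
      refine (largeConductorMean_block_le hD hJ1 hJ2 hx hL hf1 S le_rfl (α := 1) hℓ
        (by rw [one_mul]; exact ell2Norm_dyadicPart_le hκ1 le_rfl l _)).trans ?_
      split_ifs with hEx
      · rw [mul_one, ← hc]
        refine mul_le_mul_of_nonneg_left ?_ hc0
        have h1 : √z ≤ 2 * √((2:ℝ) ^ l) := hsqrt4 hE0.le (by
          have := hcond.2; rw [pow_succ] at this; linarith)
        have h2 : x / √((2:ℝ) ^ l) ≤ 2 * (x / √z) := by
          rw [← mul_div_assoc, div_le_div_iff₀ (Real.sqrt_pos.mpr hE0) hsz]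
          nlinarith
        have h3 : (J:ℝ) * (x / √((2:ℝ) ^ l)) ≤ J * (2 * (x / √z)) := by gcongr
        rw [mul_add, ← mul_assoc (J:ℝ) √x]
        linarith
      · exact hnonneg
    · refine (largeConductorMean_block_le hD hJ1 hJ2 hx hL hf1 S le_rfl (α := 0) hℓ ?_).trans ?_
      · rw [ell2Norm_eq_zero_of_forall, zero_mul]
        intro e
        by_contra he
        obtain ⟨h1, h2, -, h4, h5⟩ := of_dyadicPart_primePowerCoeff_ne_zero he
        rw [pow_one] at h5
        rw [← h5] at h4
        apply hcond
        have h1' : (2:ℝ) ^ l ≤ e := by exact_mod_cast h1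
        have h2' : (e:ℝ) < 2 ^ (l + 1) := by exact_mod_cast h2
        exact ⟨h1'.trans h4.2, h4.1.trans h2'⟩
      · rw [mul_zero, ite_self]; exact hnonneg
  -- higher powers of primes
  set W := 4 * ((2 * Q * √x + x / D) / √z) + 2 * J * (√x * √√x) + 8 * J * (x / √z) with hW
  have hW0 : 0 ≤ W := by positivity
  have htwo : ∀ i l : ℕ, 2 ≤ i → largeConductorMean D Q
      (dirichletConv (dyadicPart (primePowerCoeff κ P i) l) (cofactorCoeff f S P i)) x ≤ c * W := by
    intro i l hi
    have hE0 : (0:ℝ) < 2 ^ l := by positivity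
    have hsE : 0 < √((2:ℝ) ^ l) := Real.sqrt_pos.mpr hE0
    have hssE : 0 < √√((2:ℝ) ^ l) := Real.sqrt_pos.mpr hsE
    have hss : √√((2:ℝ) ^ l) * √√((2:ℝ) ^ l) = √((2:ℝ) ^ l) := Real.mul_self_sqrt hsE.le
    -- A prime power `p ^ i` with `p > z` and `i ≥ 2` exceeds `z ^ 2`, but it may exceed `y` and be
    -- as large as `x`. Then the sparsity factor `α = 2 / (2 ^ l) ^ (1 / 4)` keeps `√x √(2 ^ l) α`
    -- at `O(x ^ (3 / 4))`.
    by_cases hcond : z ^ 2 < 2 ^ (l + 1)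
    · refine (largeConductorMean_block_le hD hJ1 hJ2 hx hL hf1 S (by omega)
        (α := 2 / √√((2:ℝ) ^ l)) hℓ ?_).trans ?_
      · refine (ell2Norm_dyadicPart_le_of_two_le hκ1 hi l _).trans ?_
        have h1 : √√((2:ℝ) ^ (l + 1)) ≤ 2 * √√((2:ℝ) ^ l) := by
          refine hsqrt4 hsE.le ((hsqrt4 hE0.le ?_).trans (by linarith))
          rw [pow_succ]; linarith
        refine h1.trans (le_of_eq ?_)
        rw [div_mul_eq_mul_div, eq_div_iff hssE.ne', mul_assoc, hss]
      · split_ifs with hEx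
        · rw [mul_assoc c]
          refine mul_le_mul_of_nonneg_left ?_ hc0
          have h1 : z ≤ 2 * √((2:ℝ) ^ l) := by
            have := hsqrt4 (u := z ^ 2) hE0.le (by
              have h2l : (2:ℝ) ^ (l + 1) = 2 * 2 ^ l := by rw [pow_succ]; ring
              linarith)
            rwa [Real.sqrt_sq (by linarith)] at this
          have h2 : √z ≤ 2 * √√((2:ℝ) ^ l) := hsqrt4 hsE.le (by linarith)
          have h3 : 2 / √√((2:ℝ) ^ l) ≤ 4 / √z := by
            rw [div_le_div_iff₀ hssE hsz]; linarith
          have h4 : √√((2:ℝ) ^ l) ≤ √√x := Real.sqrt_le_sqrt (Real.sqrt_le_sqrt hEx)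
          have h5 : x / √((2:ℝ) ^ l) ≤ 2 * x := by
            rw [div_le_iff₀ hsE]; nlinarith
          have e1 : (2 * Q * √x + J * (√x * √((2:ℝ) ^ l) + x / √((2:ℝ) ^ l)) + x / D) *
              (2 / √√((2:ℝ) ^ l)) = (2 * Q * √x + x / D) * (2 / √√((2:ℝ) ^ l)) +
              2 * J * (√x * √√((2:ℝ) ^ l)) + J * (x / √((2:ℝ) ^ l)) * (2 / √√((2:ℝ) ^ l)) := by
            have : √((2:ℝ) ^ l) * (2 / √√((2:ℝ) ^ l)) = 2 * √√((2:ℝ) ^ l) := by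
              rw [mul_div_assoc', div_eq_iff hssE.ne', mul_assoc, hss]; ring
            calc _ = (2 * Q * √x + x / D) * (2 / √√((2:ℝ) ^ l)) +
              J * √x * (√((2:ℝ) ^ l) * (2 / √√((2:ℝ) ^ l))) +
                J * (x / √((2:ℝ) ^ l)) * (2 / √√((2:ℝ) ^ l)) := by ring
              _ = _ := by rw [this]; ring
          rw [e1, hW]
          refine add_le_add (add_le_add ?_ ?_) ?_
          · calc _ ≤ (2 * Q * √x + x / D) * (4 / √z) := by gcongr
              _ = _ := by ring
          · gcongr
          · calc _ ≤ J * (2 * x) * (4 / √z) := by gcongr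
              _ = _ := by ring
        · positivity
    · refine (largeConductorMean_block_le hD hJ1 hJ2 hx hL hf1 S (by omega) (α := 0) hℓ ?_).trans ?_
      · rw [ell2Norm_eq_zero_of_forall, zero_mul]
        intro e
        by_contra he
        obtain ⟨h1, h2, h3, h4, h5⟩ := of_dyadicPart_primePowerCoeff_ne_zero he
        apply hcond
        have h6 : e.minFac ^ 2 ≤ e := by
          conv_rhs => rw [h5]
          exact Nat.pow_le_pow_right h3.pos hi
        have h6' : (e.minFac : ℝ) ^ 2 ≤ e := by exact_mod_cast h6
        have h2' : (e:ℝ) < 2 ^ (l + 1) := by exact_mod_cast h2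
        have h7 : z ^ 2 ≤ (e.minFac : ℝ) ^ 2 := pow_le_pow_left₀ (by linarith) h4.1.le 2
        linarith
      · rw [mul_zero, ite_self]; positivity
  have hsum1 : ∑ l ∈ range L, largeConductorMean D Q
      (dirichletConv (dyadicPart (primePowerCoeff κ P 1) l) (cofactorCoeff f S P 1)) x ≤
      c * (L * (2 * Q * √x + x / D + 2 * J * (x / √z)) + 4 * J * (√x * √y)) := by
    refine (sum_le_sum hone).trans ?_
    rw [← mul_sum, sum_add_distrib, ← mul_sum, sum_const, card_range, nsmul_eq_mul, ← sum_filter]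
    refine mul_le_mul_of_nonneg_left (add_le_add le_rfl ?_) hc0
    calc _ ≤ (J:ℝ) * √x * (4 * √y) := by
          gcongr; exact sum_sqrt_two_pow_le y L
      _ = _ := by ring
  have hLpos : 1 ≤ L := by
    by_contra h
    have : L = 0 := by omega
    subst this; simp at hL
  have hins : Icc 1 L = insert 1 (Icc 2 L) := by
    ext j; simp only [mem_insert, mem_Icc]; omega
  rw [hins, sum_insert (by simp)]
  have hsum2 : ∑ i ∈ Icc 2 L, ∑ l ∈ range L, largeConductorMean D Q
      (dirichletConv (dyadicPart (primePowerCoeff κ P i) l) (cofactorCoeff f S P i)) x ≤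
      c * (L * L * W) := by
    refine (sum_le_sum fun i hi => sum_le_sum fun l _ => htwo i l (mem_Icc.mp hi).1).trans ?_
    rw [sum_const, sum_const, card_range, Nat.card_Icc, nsmul_eq_mul, nsmul_eq_mul]
    have h1 : ((L + 1 - 2 : ℕ) : ℝ) ≤ L := by exact_mod_cast (by omega)
    calc _ ≤ (L:ℝ) * (L * (c * W)) := by gcongr
      _ = _ := by ring
  refine (add_le_add hsum1 hsum2).trans (le_of_eq ?_)
  rw [hc]; ring

/-! ### The contribution of integers with a large prime factor -/

/-- The restriction of `f` to the primes exceeding `y`. -/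
noncomputable def largePrimePart (f : ℕ → ℂ) (y : ℝ) : ℕ → ℂ := fun n =>
  if y < (n : ℝ) then restrictPrimes f n else 0

open Classical in
/-- The restriction of `f` to the integers without prime factors `≥ k`. -/
noncomputable def smoothPart (f : ℕ → ℂ) (k : ℕ) : ℕ → ℂ := fun n =>
  if n ∈ Nat.smoothNumbers k then f n else 0

lemma prime_of_largePrimePart_ne_zero {f : ℕ → ℂ} {y : ℝ} {n : ℕ} (h : largePrimePart f y n ≠ 0) :
    n.Prime ∧ y < n := by
  unfold largePrimePart restrictPrimes at h
  split_ifs at h with h1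
  · refine ⟨?_, h1⟩
    by_contra hn
    exact h (Set.indicator_of_notMem (s := {p : ℕ | p.Prime}) hn f)
  · exact absurd rfl h

lemma largePrimePart_of_prime {f : ℕ → ℂ} {y : ℝ} {p : ℕ} (hp : p.Prime) (h : y < p) :
    largePrimePart f y p = f p := by
  unfold largePrimePart restrictPrimes
  rw [if_pos h]
  exact Set.indicator_of_mem (s := {p : ℕ | p.Prime}) hp f

lemma dirichletConv_largePrimePart_of_forall_le {f : ℕ → ℂ} {y : ℝ} {n : ℕ}
    (h : ∀ p, p.Prime → p ∣ n → (p : ℝ) ≤ y) : dirichletConv f (largePrimePart f y) n = 0 := by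
  unfold dirichletConv
  refine sum_eq_zero fun d hd => ?_
  have hd' := Nat.mem_divisorsAntidiagonal.mp hd
  by_contra hc
  obtain ⟨hp, hy⟩ := prime_of_largePrimePart_ne_zero (right_ne_zero_of_mul hc)
  exact absurd (h _ hp ⟨d.1, by rw [mul_comm]; exact hd'.1.symm⟩) (not_le.mpr hy)

/-- The cofactor `m = n / p` is below `y` because `n < y ^ 2`. Hence `p` is the only prime above `y`
dividing `n`, it is coprime to `m`, and one term `f(m) f(p)` survives. -/
lemma dirichletConv_largePrimePart_of_dvd {f : ArithmeticFunction ℂ} (hf : f.IsMultiplicative)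
    {y : ℝ} (hy0 : 0 ≤ y) {n p : ℕ} (hn : n ≠ 0) (hny : (n : ℝ) < y ^ 2) (hp : p.Prime)
    (hpn : p ∣ n) (hpy : y < p) : dirichletConv f (largePrimePart f y) n = f n := by
  obtain ⟨m, rfl⟩ := hpn
  have hm0 : m ≠ 0 := right_ne_zero_of_mul hn
  have hmy : (m : ℝ) < y := by
    by_contra hc
    push_cast at hny
    nlinarith [not_lt.mp hc]
  have huniq : ∀ p' : ℕ, p'.Prime → p' ∣ p * m → y < p' → p' = p := by
    intro p' hp' hd hy'
    rcases (hp'.dvd_mul).mp hd with h | h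
    · exact (Nat.prime_dvd_prime_iff_eq hp' hp).mp h
    · have : (p' : ℝ) ≤ m := by exact_mod_cast Nat.le_of_dvd (Nat.pos_of_ne_zero hm0) h
      linarith
  unfold dirichletConv
  rw [sum_eq_single (m, p)]
  · rw [largePrimePart_of_prime hp hpy, mul_comm p m, hf.map_mul_of_coprime]
    refine ((Nat.Prime.coprime_iff_not_dvd hp).mpr fun h => ?_).symm
    have : (p : ℝ) ≤ m := by exact_mod_cast Nat.le_of_dvd (Nat.pos_of_ne_zero hm0) h
    linarith
  · rintro ⟨d, e⟩ hd hne
    have hd' := (Nat.mem_divisorsAntidiagonal.mp hd).1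
    simp only at hd'
    by_contra hc
    obtain ⟨he, hey⟩ := prime_of_largePrimePart_ne_zero (right_ne_zero_of_mul hc)
    have hep : e = p := huniq e he ⟨d, by rw [mul_comm e d]; exact hd'.symm⟩ hey
    subst hep
    apply hne
    rw [mul_comm] at hd'
    rw [Nat.eq_of_mul_eq_mul_left hp.pos hd']
  · intro h
    exact absurd (Nat.mem_divisorsAntidiagonal.mpr ⟨mul_comm _ _, hn⟩) h

/-- Decomposition according to the size of the largest prime factor. -/
lemma eq_dirichletConv_add_mediumPart_add_smoothPart {f : ArithmeticFunction ℂ}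
    (hf : f.IsMultiplicative) {x y z : ℝ} (hx : 0 ≤ x) (hz : 0 ≤ z) (hzy : z ≤ y) (hxy : x < y ^ 2)
    {n : ℕ} (hn : 1 ≤ n) (hnx : n ≤ ⌊x⌋₊) :
    f n = (dirichletConv f (largePrimePart f y) +
      (mediumPart f y z + smoothPart f (⌊z⌋₊ + 1))) n := by
  have hny : (n : ℝ) < y ^ 2 := lt_of_le_of_lt ((Nat.le_floor_iff hx).mp hnx) hxy
  have hiff : ∀ p : ℕ, p < ⌊z⌋₊ + 1 ↔ (p : ℝ) ≤ z := fun p => by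
    rw [Nat.lt_succ_iff, Nat.le_floor_iff hz]
  have hsm : n ∈ Nat.smoothNumbers (⌊z⌋₊ + 1) ↔ ∀ p, p.Prime → p ∣ n → (p : ℝ) ≤ z := by
    rw [Nat.mem_smoothNumbers']; simp_rw [hiff]
  simp only [Pi.add_apply]
  by_cases h : ∀ p, p.Prime → p ∣ n → (p : ℝ) ≤ y
  · rw [dirichletConv_largePrimePart_of_forall_le h]
    unfold mediumPart smoothPart
    by_cases h2 : ∃ p, p.Prime ∧ p ∣ n ∧ (z < (p : ℝ) ∧ (p : ℝ) ≤ y)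
    · rw [if_pos ⟨h, h2⟩, if_neg, add_zero, zero_add]
      obtain ⟨p, hp, hpn, hpz, -⟩ := h2
      rw [hsm]
      exact fun hc => absurd (hc p hp hpn) (not_le.mpr hpz)
    · rw [if_neg fun hc => h2 hc.2, if_pos, zero_add, zero_add]
      rw [hsm]
      intro p hp hpn
      by_contra hc
      exact h2 ⟨p, hp, hpn, not_le.mp hc, h p hp hpn⟩
  · have h' := h
    push Not at h
    obtain ⟨p, hp, hpn, hpy⟩ := h
    rw [dirichletConv_largePrimePart_of_dvd hf (hz.trans hzy) (by omega) hny hp hpn hpy]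
    unfold mediumPart smoothPart
    rw [if_neg fun hc => h' hc.1, if_neg, add_zero, add_zero]
    rw [hsm]
    exact fun hc => absurd (hc p hp hpn) (not_le.mpr (lt_of_le_of_lt hzy hpy))

/-- Only `m ≤ x / y` contribute, and then `y ≤ x / m ≤ x`, so the hypothesis applies at `x / m`.
Cutting off the primes up to `y` adds the discrepancy at `y`, in total at most `R y (x / y) = R x`.
-/
lemma totalDiscrepancy_dirichletConv_largePrimePart_le
    {Ξ : Set (Σ r : ℕ, DirichletCharacter ℂ r)} {Q : ℝ} {f : ℕ → ℂ} (hf : ∀ n, ‖f n‖ ≤ 1) {x y R : ℝ}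
    (hy : 0 < y) (hyx : y ≤ x) (hR : 0 ≤ R)
    (h : ∀ X, y ≤ X → X ≤ x → totalDiscrepancy Ξ Q (restrictPrimes f) X ≤ R * X) :
    totalDiscrepancy Ξ Q (dirichletConv f (largePrimePart f y)) x ≤
      R * (x * (2 + Real.log (x / y))) := by
  have hx : 0 < x := hy.trans_le hyx
  set V := ⌊x / y⌋₊ with hV
  have hterm : ∀ m ∈ Icc 1 ⌊x⌋₊, ‖f m‖ * totalDiscrepancy Ξ Q (largePrimePart f y) (x / m) ≤
      if m ≤ V then R * (x * (1 / m) + y) else 0 := by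
    intro m hm
    have hm1 := (mem_Icc.mp hm).1
    have hm0 : (1:ℝ) ≤ m := by exact_mod_cast hm1
    split_ifs with hmV
    · have hmV' : (m : ℝ) ≤ x / y := (Nat.le_floor_iff (by positivity)).mp hmV
      have hyX : y ≤ x / m := by
        rw [le_div_iff₀ (by linarith)]
        rw [le_div_iff₀ hy] at hmV'
        linarith
      have hXx : x / m ≤ x := div_le_self hx.le hm0
      have h1 := totalDiscrepancy_indicator_gt_le Ξ Q (restrictPrimes f) hy.le hyX
      have h2 := h _ hyX hXx
      have h3 := h y le_rfl hyx
      have h4 := totalDiscrepancy_nonneg Ξ Q (largePrimePart f y) (x / m)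
      calc _ ≤ 1 * totalDiscrepancy Ξ Q (largePrimePart f y) (x / m) :=
            mul_le_mul_of_nonneg_right (hf m) h4
        _ ≤ R * (x / m) + R * y := by rw [one_mul]; exact h1.trans (add_le_add h2 h3)
        _ = _ := by ring
    · have hzero : totalDiscrepancy Ξ Q (largePrimePart f y) (x / m) ≤ 0 := by
        rw [totalDiscrepancy_congr (g := fun _ => 0)]
        · refine (totalDiscrepancy_le (fun _ => 0) fun q _ _ a => ?_).trans (by simp)
          rw [discrepancy_eq_sum]; simp
        · intro n _ hnX
          unfold largePrimePart
          rw [if_neg]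
          rw [not_lt]
          refine ((Nat.le_floor_iff (by positivity)).mp hnX).trans ?_
          have : x / y < m := (Nat.floor_lt (by positivity)).mp (not_le.mp hmV)
          rw [div_lt_iff₀ hy] at this
          rw [div_le_iff₀ (by linarith)]
          linarith
      exact mul_nonpos_of_nonneg_of_nonpos (norm_nonneg _) hzero
  refine (totalDiscrepancy_dirichletConv_le Ξ Q f _ x).trans ((sum_le_sum hterm).trans ?_)
  rw [← sum_filter]
  have hsub : (Icc 1 ⌊x⌋₊).filter (fun m => m ≤ V) ⊆ Icc 1 V := fun m hm => by
    simp only [mem_filter, mem_Icc] at hm ⊢; omega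
  refine (sum_le_sum_of_subset_of_nonneg hsub fun m _ _ => by positivity).trans ?_
  rw [← mul_sum, sum_add_distrib, ← mul_sum, sum_const, Nat.card_Icc, Nat.add_sub_cancel, nsmul_eq_mul]
  refine mul_le_mul_of_nonneg_left ?_ hR
  have hV' : (V : ℝ) ≤ x / y := Nat.floor_le (by positivity)
  have hV1 : 1 ≤ V := Nat.le_floor (by rw [Nat.cast_one]; exact (one_le_div hy).mpr hyx)
  have h5 : ∑ m ∈ Icc 1 V, 1 / (m : ℝ) ≤ 1 + Real.log (x / y) :=
    (sum_one_div_le_one_add_log V).trans (by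
      have := Real.log_le_log (by exact_mod_cast hV1) hV'
      linarith)
  have h6 : (V : ℝ) * y ≤ x := by rwa [le_div_iff₀ hy] at hV'
  nlinarith

/-! ### Estimates in powers of the logarithm -/

/-- Trivial bound for bounded `x`: at most `φ(q)` characters, each with a sum of size at most `x`,
against the weight `1 / φ(q)`. -/
lemma totalDiscrepancy_le_mul (D : ℝ) {Q x : ℝ} (hQ : 0 ≤ Q) (hx : 0 ≤ x) {f : ℕ → ℂ}
    (hf : ∀ n, ‖f n‖ ≤ 1) : totalDiscrepancy (primitiveCharsUpTo D) Q f x ≤ Q * x := by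
  have hS : ∀ (q : ℕ) (χ : DirichletCharacter ℂ q), ‖charSum f x χ‖ ≤ x := fun q χ => by
    unfold charSum
    refine (norm_sum_le _ _).trans ((sum_le_card_nsmul _ _ 1 fun n _ => ?_).trans ?_)
    · rw [norm_mul, RCLike.norm_conj]
      exact mul_le_one₀ (hf n) (norm_nonneg _) (DirichletCharacter.norm_le_one χ _)
    · rw [Nat.card_Icc, Nat.add_sub_cancel, nsmul_eq_mul, mul_one]
      exact Nat.floor_le hx
  refine (totalDiscrepancy_le (fun _ => x) fun q hq _ a => ?_).trans ?_
  · have : NeZero q := ⟨by omega⟩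
    have hφ : (0:ℝ) < q.totient := by exact_mod_cast Nat.totient_pos.mpr (by omega)
    rw [discrepancy_eq_sum_charsAbove, norm_mul, norm_div, norm_one, Complex.norm_natCast]
    have hcard : ((charsAbove D q).card : ℝ) ≤ q.totient := by
      have := card_le_univ (charsAbove D q)
      rw [← Nat.card_eq_fintype_card,
        DirichletCharacter.card_eq_totient_of_hasEnoughRootsOfUnity] at this
      exact_mod_cast this
    have hsum : ‖∑ χ ∈ charsAbove D q, χ (a : ZMod q) * charSum f x χ‖ ≤ q.totient * x := by
      refine (norm_sum_le _ _).trans ((sum_le_card_nsmul _ _ x fun χ _ => ?_).trans ?_)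
      · rw [norm_mul]
        exact (mul_le_of_le_one_left (norm_nonneg _) (DirichletCharacter.norm_le_one χ _)).trans (hS q χ)
      · rw [nsmul_eq_mul]; gcongr
    rw [one_div, inv_mul_le_iff₀ hφ]
    exact hsum
  · rw [sum_const, Nat.card_Icc, Nat.add_sub_cancel, nsmul_eq_mul]
    exact mul_le_mul_of_nonneg_right (Nat.floor_le hQ) hx

lemma exists_dyadic_ratio {Q D ℓ : ℝ} (hD : 1 ≤ D) (hDQ : D ≤ Q) (hℓ : 2 ≤ ℓ)
    (hQ : Real.log Q ≤ ℓ) : ∃ J : ℕ, Q ≤ 2 ^ J * D ∧ 2 ^ J * D ≤ 2 * Q ∧ (J : ℝ) ≤ 4 * ℓ := by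
  obtain ⟨n, h1, h2⟩ := exists_nat_pow_near ((one_le_div (by linarith)).mpr hDQ) (one_lt_two (α := ℝ))
  rw [le_div_iff₀ (by linarith)] at h1
  rw [div_lt_iff₀ (by linarith)] at h2
  refine ⟨n + 1, h2.le, by rw [pow_succ]; linarith, ?_⟩
  have h3 : (2:ℝ) ^ n ≤ Q := by
    have : (0:ℝ) < 2 ^ n := by positivity
    nlinarith
  have h4 := (Real.log_le_log (by positivity) h3).trans hQ
  rw [Real.log_pow] at h4
  have h5 := Real.log_two_gt_d9
  push_cast
  nlinarith [Nat.cast_nonneg (α := ℝ) n]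

lemma exists_dyadic_length {x : ℝ} (hx : 1 ≤ x) (hℓ : 2 ≤ Real.log x) :
    ∃ L : ℕ, ⌊x⌋₊ + 1 < 2 ^ L ∧ (L : ℝ) ≤ 4 * Real.log x := by
  refine ⟨Nat.log 2 (⌊x⌋₊ + 1) + 1, Nat.lt_pow_succ_log_self (by norm_num) _, ?_⟩
  set n := Nat.log 2 (⌊x⌋₊ + 1)
  have h1 : (2:ℝ) ^ n ≤ 2 * x := by
    have h : (2:ℝ) ^ n ≤ (⌊x⌋₊ : ℝ) + 1 := by
      exact_mod_cast Nat.pow_log_le_self 2 (Nat.succ_ne_zero ⌊x⌋₊)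
    have := Nat.floor_le (by linarith : 0 ≤ x)
    linarith
  have h2 := Real.log_le_log (by positivity) h1
  rw [Real.log_pow, Real.log_mul (by norm_num) (by linarith)] at h2
  have h3 := Real.log_two_gt_d9
  push_cast
  nlinarith [Nat.cast_nonneg (α := ℝ) n]

/-- Counts logarithms, with `ℓ`, `L` and `J` each worth one. The term `e` carries only three of
them, so it may be larger than the others by `ℓ ^ 2`. -/
lemma medium_bound {ℓ L J v a b c d e s : ℝ} (hℓ : 1 ≤ ℓ) (hL0 : 0 ≤ L) (hL : L ≤ 4 * ℓ) (hJ0 : 0 ≤ J)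
    (hJ : J ≤ 4 * ℓ) (hv : 0 ≤ v) (hs : 1 ≤ s) (ha0 : 0 ≤ a) (hb0 : 0 ≤ b) (hc0 : 0 ≤ c) (hd0 : 0 ≤ d)
    (he0 : 0 ≤ e)
    (ha : a ≤ v) (hb : b ≤ v) (hc : c ≤ v) (hd : d ≤ v) (he : e ≤ v * ℓ ^ 2) :
    192 * ℓ * L * (L * (2 * a + b + 2 * J * c) + 4 * J * e +
      L * L * (4 * ((2 * a + b) / s) + 2 * J * d + 8 * J * c)) ≤ 700000 * (v * ℓ ^ 5) := by
  have hq : (2 * a + b) / s ≤ 3 * v := (div_le_self (by linarith) hs).trans (by linarith)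
  have hq0 : 0 ≤ (2 * a + b) / s := by positivity
  calc _ ≤ 192 * ℓ * (4 * ℓ) * ((4 * ℓ) * (2 * v + v + 2 * (4 * ℓ) * v) + 4 * (4 * ℓ) * (v * ℓ ^ 2) +
      (4 * ℓ) * (4 * ℓ) * (4 * (3 * v) + 2 * (4 * ℓ) * v + 8 * (4 * ℓ) * v)) := by gcongr
    _ = 768 * v * (12 * ℓ ^ 3 + 32 * ℓ ^ 4 + 16 * ℓ ^ 5 + 192 * ℓ ^ 4 + 640 * ℓ ^ 5) := by ring
    _ ≤ 768 * v * (12 * ℓ ^ 5 + 32 * ℓ ^ 5 + 16 * ℓ ^ 5 + 192 * ℓ ^ 5 + 640 * ℓ ^ 5) := by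
        gcongr <;> first | exact hℓ | norm_num
    _ ≤ _ := by
        have : 0 ≤ v * ℓ ^ 5 := by positivity
        linarith

/-- With `w = ℓ ^ (1 / 4)` and `log ℓ ≤ 4 w`, the left side is at most a constant times `w ^ 2 =
√ℓ`. -/
lemma smooth_exponent_le {ℓ a M c : ℝ} (hℓ : 1 ≤ ℓ) (ha : 0 ≤ a) (hM : 0 ≤ M) (hc : 0 < c)
    (h : (16 + 32 * a + 4 * M) / c ≤ √ℓ) :
    8 * ℓ ^ (1 / 4 : ℝ) * (2 + a * Real.log ℓ) + M * Real.log ℓ ≤ c * ℓ := by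
  have hℓ0 : 0 ≤ ℓ := by linarith
  set w := ℓ ^ (1 / 4 : ℝ) with hw
  have hw1 : 1 ≤ w := Real.one_le_rpow hℓ (by norm_num)
  have hww : w * w = √ℓ := by
    rw [hw, ← Real.rpow_add (by linarith), Real.sqrt_eq_rpow]; norm_num
  have hlog : Real.log ℓ ≤ 4 * w := by
    have := Real.log_le_rpow_div hℓ0 (show (0:ℝ) < 1 / 4 by norm_num)
    rw [← hw] at this; linarith
  rw [div_le_iff₀ hc] at h
  have hss : √ℓ * √ℓ = ℓ := Real.mul_self_sqrt hℓ0
  calc _ ≤ 8 * w * (2 + a * (4 * w)) + M * (4 * w) := by gcongr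
    _ = 16 * w + 32 * a * (w * w) + 4 * M * w := by ring
    _ ≤ 16 * (w * w) + 32 * a * (w * w) + 4 * M * (w * w) := by
        have : w ≤ w * w := by nlinarith
        gcongr
    _ = (16 + 32 * a + 4 * M) * √ℓ := by rw [hww]; ring
    _ ≤ √ℓ * c * √ℓ := by gcongr
    _ = c * ℓ := by rw [← hss]; ring_nf; rw [Real.sq_sqrt (by positivity)]

/-- Rankin's bound for the reciprocals of smooth numbers with smoothness a power of `log x`. -/
lemma sum_smooth_recip_le_log_rpow {ℓ a M η : ℝ} (hℓ : 1 ≤ ℓ) (ha : 1 ≤ a) (hM : 0 ≤ M)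
    (hη : η = 1 / (4 * a)) (h : (16 + 32 * a + 4 * M) / (η / 4) ≤ √ℓ) (F : Finset ℕ)
    (hF : ∀ d ∈ F, d ∈ Nat.smoothNumbers (⌊ℓ ^ a⌋₊ + 1) ∧ Real.exp (ℓ / 4) < d) :
    ∑ d ∈ F, 1 / (d : ℝ) ≤ ℓ ^ (-M) := by
  have hℓ0 : 0 < ℓ := by linarith
  have hη0 : 0 < η := by rw [hη]; positivity
  have hη2 : η ≤ 1 / 2 := by
    rw [hη, div_le_div_iff₀ (by positivity) (by norm_num)]; linarith
  refine (sum_smooth_recip_le (by omega) hη0 hη2 (Real.exp_pos _) F hF).trans ?_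
  have hz1 : 1 ≤ ℓ ^ a := Real.one_le_rpow hℓ (by linarith)
  have hk : ((⌊ℓ ^ a⌋₊ + 1 : ℕ) : ℝ) ≤ 2 * ℓ ^ a := by
    push_cast
    have := Nat.floor_le (by linarith : 0 ≤ ℓ ^ a)
    linarith
  have hk1 : (1:ℝ) ≤ ((⌊ℓ ^ a⌋₊ + 1 : ℕ) : ℝ) := by exact_mod_cast (by omega)
  set k := ⌊ℓ ^ a⌋₊ + 1
  -- The choice `η = 1 / (4 a)` makes `(ℓ ^ a) ^ η = ℓ ^ (1 / 4)`. The Euler product then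
  -- contributes `o(ℓ)` to the exponent, against the gain `η ℓ / 4`.
  have hkη : (k : ℝ) ^ η ≤ 2 * ℓ ^ (1 / 4 : ℝ) := by
    calc (k : ℝ) ^ η ≤ (2 * ℓ ^ a) ^ η := Real.rpow_le_rpow (by linarith) hk hη0.le
      _ = 2 ^ η * ℓ ^ (1 / 4 : ℝ) := by
          rw [Real.mul_rpow (by norm_num) (by linarith), ← Real.rpow_mul hℓ0.le]
          congr 2
          rw [hη]; field_simp
      _ ≤ 2 ^ (1:ℝ) * ℓ ^ (1 / 4 : ℝ) := by
          gcongr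
          · norm_num
          · linarith
      _ = _ := by rw [Real.rpow_one]
  have hlogk : 1 + Real.log k ≤ 2 + a * Real.log ℓ := by
    have h1 := Real.log_le_log (by linarith) hk
    rw [Real.log_mul (by norm_num) (by linarith), Real.log_rpow hℓ0] at h1
    have := Real.log_two_lt_d9
    linarith
  have hlogk0 : 0 ≤ 1 + Real.log k := by
    have := Real.log_nonneg hk1; linarith
  have hmain := smooth_exponent_le hℓ (by linarith : 0 ≤ a) hM (by positivity : 0 < η / 4) h
  rw [← Real.exp_mul, ← Real.exp_add, Real.rpow_def_of_pos hℓ0]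
  refine Real.exp_le_exp.mpr ?_
  have h2 : (k : ℝ) ^ η * (1 + Real.log k) ≤ 2 * ℓ ^ (1 / 4 : ℝ) * (2 + a * Real.log ℓ) := by
    gcongr
  nlinarith

/-- The inequalities satisfied by large `x`, in terms of `ℓ = log x`. -/
lemma exists_log_threshold (M N : ℝ) :
    ∃ ℓ₀ : ℝ, 2 ≤ ℓ₀ ∧ ∀ ℓ, ℓ₀ ≤ ℓ → ℓ ^ M ≤ Real.exp (ℓ / 4) ∧ N ≤ √ℓ := by
  have h1 := (isLittleO_rpow_exp_pos_mul_atTop M (show (0:ℝ) < 1 / 4 by norm_num)).bound one_pos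
  have h2 := Real.tendsto_sqrt_atTop.eventually_ge_atTop N
  obtain ⟨ℓ₁, h⟩ := Filter.eventually_atTop.mp (h1.and h2)
  refine ⟨max ℓ₁ 2, le_max_right _ _, fun ℓ hℓ => ?_⟩
  obtain ⟨h3, h4⟩ := h ℓ ((le_max_left _ _).trans hℓ)
  refine ⟨?_, h4⟩
  rw [one_mul, Real.norm_eq_abs, Real.norm_eq_abs, Real.abs_exp] at h3
  refine (le_abs_self _).trans (h3.trans (le_of_eq ?_))
  congr 1; ring

/-! ### Assembly of the three ranges and the bounded case. -/

set_option maxHeartbeats 1000000 in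
lemma IsClassC.totalDiscrepancy_le_of_large {A B γ K : ℝ} (hA : 0 ≤ A) (hB : A + 5 < B)
    (hγ : 2 * A + 6 < γ) {f : ArithmeticFunction ℂ} (hf : IsClassC f) {x ℓ : ℝ} (hx : 0 < x)
    (hℓ : Real.log x = ℓ) (hℓ2 : 2 ≤ ℓ) (hpow : ℓ ^ (A + 2 * B + 2 * γ + 5) ≤ Real.exp (ℓ / 4))
    (hexp : (16 + 32 * (γ + 4) + 4 * (A + 2 * B + 2)) / (1 / (4 * (γ + 4)) / 4) ≤ √ℓ)
    {Q y : ℝ} (hQ : Q = √x / ℓ ^ B) (hy : y = x / ℓ ^ γ)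
    (h : ∀ X : ℝ, y ≤ X → X ≤ x →
      totalDiscrepancy (primitiveCharsUpTo (ℓ ^ B)) Q (restrictPrimes f) X ≤
        K * (X / (ℓ ^ A * Real.log (x / y)))) :
    totalDiscrepancy (primitiveCharsUpTo (ℓ ^ B)) Q f x ≤ (3 * |K| + 700017) * (x / ℓ ^ A) := by
  have hℓ0 : 0 < ℓ := by linarith
  have hℓ1 : 1 ≤ ℓ := by linarith
  have hexpx : Real.exp ℓ = x := by rw [← hℓ, Real.exp_log hx]
  have hx1 : 1 ≤ x := by rw [← hexpx]; exact Real.one_le_exp hℓ0.le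
  have hmono : ∀ {s t : ℝ}, s ≤ t → ℓ ^ s ≤ ℓ ^ t := fun h => Real.rpow_le_rpow_of_exponent_le hℓ1 h
  have hge1 : ∀ {s : ℝ}, 0 ≤ s → 1 ≤ ℓ ^ s := fun h => Real.one_le_rpow hℓ1 h
  have hpos : ∀ s : ℝ, 0 < ℓ ^ s := fun s => Real.rpow_pos_of_pos hℓ0 s
  have hadd : ∀ s t : ℝ, ℓ ^ s * ℓ ^ t = ℓ ^ (s + t) := fun s t => (Real.rpow_add hℓ0 s t).symm
  -- `T = x ^ (1 / 4)` dominates every power of `ℓ` that occurs and is the Rankin cut-off; roots of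
  -- `x` become products of `T`.
  set T := Real.exp (ℓ / 4) with hT
  have hT0 : 0 < T := Real.exp_pos _
  have hT1 : 1 ≤ T := Real.one_le_exp (by linarith)
  have hTx : T * T * (T * T) = x := by
    rw [← hexpx, hT, ← Real.exp_add, ← Real.exp_add]; congr 1; ring
  have hsx : √x = T * T := by rw [← hTx, Real.sqrt_mul_self (by positivity)]
  have hssx : √√x = T := by rw [hsx, Real.sqrt_mul_self hT0.le]
  have hTT : 1 ≤ T * T := one_le_mul_of_one_le_of_one_le hT1 hT1
  have hpowT : ∀ {s : ℝ}, s ≤ A + 2 * B + 2 * γ + 5 → ℓ ^ s ≤ T := fun h => (hmono h).trans hpow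
  set D := ℓ ^ B with hD
  have hD0 : 0 < D := hpos B
  have hD1 : 1 ≤ D := hge1 (by linarith)
  -- The shift by 4 gives `x / √z = x ℓ ^ (-γ / 2 - 2) ≤ x ℓ ^ (-A - 5)` because `γ > 2 A + 6`.
  set z := ℓ ^ (γ + 4) with hz
  have hz1 : 1 ≤ z := hge1 (by linarith)
  set u := x / ℓ ^ A with hu
  have hu0 : 0 < u := div_pos hx (hpos A)
  have hxu : x = u * ℓ ^ A := by rw [hu, div_mul_cancel₀ _ (hpos A).ne']
  have hy0 : 0 < y := by rw [hy]; exact div_pos hx (hpos γ)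
  have hyx : y ≤ x := by rw [hy]; exact div_le_self hx.le (hge1 (by linarith))
  have hxy : x / y = ℓ ^ γ := by rw [hy]; field_simp
  have hyγ : y * ℓ ^ γ = x := by rw [hy, div_mul_cancel₀ _ (hpos γ).ne']
  have hQ0 : 0 < Q := by rw [hQ, hsx]; positivity
  have hQD : Q * D = T * T := by rw [hQ, hsx, div_mul_cancel₀ _ hD0.ne']
  have hQT : Q ≤ T * T := by rw [← hQD]; exact le_mul_of_one_le_right hQ0.le hD1
  have hlogT : Real.log T = ℓ / 4 := Real.log_exp _
  have hlogQ : Real.log Q ≤ ℓ / 2 := by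
    have := Real.log_le_log hQ0 hQT
    rw [Real.log_mul hT0.ne' hT0.ne', hlogT] at this
    linarith
  have hDQ : D ≤ Q := by
    have h1 : D * D ≤ T := by rw [hD, hadd]; exact hpowT (by linarith)
    refine le_of_mul_le_mul_right ?_ hD0
    rw [hQD]
    exact h1.trans (le_mul_of_one_le_left hT0.le hT1)
  have hQ1 : 1 ≤ Q := hD1.trans hDQ
  have hlogfloor : 1 + Real.log ⌊Q⌋₊ ≤ ℓ := by
    have h1 : (1:ℝ) ≤ (⌊Q⌋₊ : ℝ) := by exact_mod_cast Nat.le_floor (by simpa using hQ1)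
    have := Real.log_le_log (by linarith) (Nat.floor_le hQ0.le)
    linarith
  have hxT : T * ℓ ^ γ ≤ y := by
    have h1 : ℓ ^ γ * ℓ ^ γ ≤ T := by rw [hadd]; exact hpowT (by linarith)
    rw [hy, le_div_iff₀ (hpos γ), ← hTx]
    calc T * ℓ ^ γ * ℓ ^ γ = T * (ℓ ^ γ * ℓ ^ γ) := by ring
      _ ≤ T * T := by gcongr
      _ ≤ T * T * (T * T) := le_mul_of_one_le_right (by positivity) hTT
  have hzT : z ≤ T := hpowT (by linarith)
  have hγ1 : 1 ≤ ℓ ^ γ := hge1 (by linarith)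
  have hzy : z ≤ y := hzT.trans ((le_mul_of_one_le_right hT0.le hγ1).trans hxT)
  have hxyy : x < y ^ 2 := by
    have h2 : 1 < T := Real.one_lt_exp_iff.mpr (by linarith)
    have h3 : ℓ ^ γ < y := (lt_mul_of_one_lt_left (hpos γ) h2).trans_le hxT
    calc x = y * ℓ ^ γ := hyγ.symm
      _ < y * y := by gcongr
      _ = y ^ 2 := by ring
  have hlg : 1 ≤ Real.log (x / y) := by
    rw [hxy, Real.log_rpow hℓ0]
    have h1 := Real.log_le_log (by norm_num) hℓ2
    have h2 := Real.log_two_gt_d9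
    have h3 : 6 * (1 / 2) ≤ γ * Real.log ℓ := by gcongr <;> linarith
    linarith
  have hf1 : ∀ n, ‖f n‖ ≤ 1 := hf.norm_le_one
  -- large primes
  have hp1 : totalDiscrepancy (primitiveCharsUpTo D) Q (dirichletConv f (largePrimePart f y)) x ≤
      3 * |K| * u := by
    set g := Real.log (x / y) with hg
    have hg0 : 0 < g := by linarith
    refine (totalDiscrepancy_dirichletConv_largePrimePart_le (R := |K| / (ℓ ^ A * g)) hf1 hy0 hyx
      (div_nonneg (abs_nonneg K) (mul_pos (hpos A) hg0).le) fun X h1 h2 => (h X h1 h2).trans ?_).trans ?_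
    · rw [div_mul_eq_mul_div, mul_div_assoc]
      exact mul_le_mul_of_nonneg_right (le_abs_self K)
        (div_nonneg (hy0.le.trans h1) (mul_pos (hpos A) hg0).le)
    · have h1 : (2 + g) / g ≤ 3 := by rw [div_le_iff₀ hg0]; linarith
      calc |K| / (ℓ ^ A * g) * (x * (2 + g)) = |K| * u * ((2 + g) / g) := by
            rw [hu]; have := (hpos A).ne'; field_simp
        _ ≤ |K| * u * 3 := by gcongr
        _ = _ := by ring
  -- medium primes
  have hp2 : totalDiscrepancy (primitiveCharsUpTo D) Q (mediumPart f y z) x ≤ 700000 * u := by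
    obtain ⟨J, hJ1, hJ2, hJ⟩ := exists_dyadic_ratio hD1 hDQ hℓ2 (by linarith)
    obtain ⟨L, hL1, hL⟩ := exists_dyadic_length hx1 (by rw [hℓ]; exact hℓ2)
    rw [hℓ] at hL
    refine (totalDiscrepancy_le_largeConductorMean D Q _ x).trans ?_
    refine (hf.largeConductorMean_mediumPart_le hD1 hJ1 hJ2 hx1 hz1 hL1 hlogfloor).trans ?_
    -- Five logarithms are lost in the medium range. Thus `x / D` must be at most `x ℓ ^ (-A - 5)`,
    -- which is where `B > A + 5` enters.
    set v := u * ℓ ^ (-5 : ℝ) with hv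
    have hv0 : 0 < v := mul_pos hu0 (hpos _)
    have hvx : v = x * ℓ ^ (-A - 5) := by
      rw [hxu, hv, mul_assoc, hadd]; congr 2; ring
    have hvu : v * ℓ ^ 5 = u := by
      rw [hv, mul_assoc, ← Real.rpow_natCast, hadd]; norm_num
    have hxs : ∀ s : ℝ, x / ℓ ^ s = x * ℓ ^ (-s) := fun s => by
      rw [Real.rpow_neg hℓ0.le, div_eq_mul_inv]
    have hsqrt : ∀ s : ℝ, √(ℓ ^ s) = ℓ ^ (s / 2) := fun s => by
      rw [Real.sqrt_eq_rpow, ← Real.rpow_mul hℓ0.le]; congr 1; ring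
    have hQx : Q * √x = x / D := by
      rw [hQ, div_mul_eq_mul_div, Real.mul_self_sqrt hx.le]
    have hxD : x / D ≤ v := by
      rw [hvx, hD, hxs]
      exact mul_le_mul_of_nonneg_left (hmono (by linarith)) hx.le
    have hxz : x / √z ≤ v := by
      rw [hvx, hz, hsqrt, hxs]
      exact mul_le_mul_of_nonneg_left (hmono (by linarith)) hx.le
    have hxx : √x * √√x ≤ v := by
      rw [hssx, hsx, hvx, show -A - 5 = -(A + 5) by ring, ← hxs, le_div_iff₀ (hpos _), ← hTx, mul_assoc]
      have : ℓ ^ (A + 5) ≤ T := hpowT (by linarith)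
      gcongr
    -- Here `√(x y) = x ℓ ^ (-γ / 2)` must be at most `x ℓ ^ (-A - 3)`, which follows from `γ > 2 A
    -- + 6`.
    have hxyv : √x * √y ≤ v * ℓ ^ 2 := by
      rw [hy, Real.sqrt_div hx.le, ← mul_div_assoc, Real.mul_self_sqrt hx.le, hsqrt, hxs, hvx, mul_assoc,
        ← Real.rpow_natCast, hadd]
      refine mul_le_mul_of_nonneg_left (hmono ?_) hx.le
      push_cast; linarith
    have := medium_bound (e := √x * √y) (s := √z) (a := Q * √x) (b := x / D) (c := x / √z)
      (d := √x * √√x) hℓ1 (Nat.cast_nonneg L) hL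
      (Nat.cast_nonneg J) hJ hv0.le (Real.one_le_sqrt.mpr hz1) (by positivity) (by positivity)
      (by positivity) (by positivity) (by positivity) (by rw [hQx]; exact hxD) hxD hxz hxx hxyv
    rw [hvu] at this
    refine le_trans (le_of_eq ?_) this
    ring
  -- smooth numbers
  have hp3 : totalDiscrepancy (primitiveCharsUpTo D) Q (smoothPart f (⌊z⌋₊ + 1)) x ≤ 17 * u := by
    have hk : ((⌊z⌋₊ + 1 : ℕ) : ℝ) ≤ T := by
      push_cast
      have h1 := Nat.floor_le (by linarith : 0 ≤ z)
      have h2 : ℓ ^ (γ + 4) * ℓ ^ (1:ℝ) ≤ T := by rw [hadd]; exact hpowT (by linarith)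
      rw [← hz, Real.rpow_one] at h2
      have h3 : z * 2 ≤ z * ℓ := by gcongr
      linarith
    have hTk : T * ((⌊z⌋₊ + 1 : ℕ) : ℝ) * Q ≤ x := by
      rw [← hTx]; gcongr
    set ρ := ℓ ^ (-(A + 2 * B + 2)) with hρ
    have hρ0 : 0 < ρ := hpos _
    refine (totalDiscrepancy_smooth_le (ρ := ρ) hx.le hD0.le hT1 hTk
      (fun F hF => sum_smooth_recip_le_log_rpow hℓ1 (by linarith : 1 ≤ γ + 4)
        (by linarith : 0 ≤ A + 2 * B + 2) rfl hexp F hF)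
      (smoothPart f _) (fun n => ?_) fun n hn => ?_).trans ?_
    · unfold smoothPart; split_ifs
      · exact hf1 n
      · simp
    · unfold smoothPart at hn
      by_contra hc
      exact hn (if_neg hc)
    · have h1 : (⌊Q⌋₊ : ℝ) * T ≤ u := by
        have h2 : ℓ ^ A ≤ T := hpowT (by linarith)
        rw [hu, le_div_iff₀ (hpos A), ← hTx]
        calc (⌊Q⌋₊ : ℝ) * T * ℓ ^ A ≤ T * T * T * T := by
              gcongr
              exact (Nat.floor_le hQ0.le).trans hQT
          _ = _ := by ring
      have h2 : x * ρ * (D ^ 2 * ℓ) ≤ u := by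
        have e1 : D ^ 2 * ℓ = ℓ ^ (2 * B + 1) := by
          rw [Real.rpow_add hℓ0, Real.rpow_one, hD, ← Real.rpow_natCast, ← Real.rpow_mul hℓ0.le]
          congr 2; push_cast; ring
        rw [e1, hxu, hρ, mul_assoc, mul_assoc, hadd, hadd]
        refine mul_le_of_le_one_right hu0.le (Real.rpow_le_one_of_one_le_of_nonpos hℓ1 ?_)
        linarith
      have h3 : x * ρ * ℓ ≤ u := by
        refine le_trans ?_ h2
        gcongr
        exact le_mul_of_one_le_left hℓ0.le (one_le_pow₀ hD1)
      have h4 : D ^ 2 * T * ℓ ≤ u := by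
        have e1 : D ^ 2 * ℓ * ℓ ^ A ≤ T := by
          have : D ^ 2 * ℓ * ℓ ^ A = ℓ ^ (2 * B + 1 + A) := by
            rw [Real.rpow_add hℓ0, Real.rpow_add hℓ0, Real.rpow_one, hD, ← Real.rpow_natCast,
              ← Real.rpow_mul hℓ0.le]
            congr 3; push_cast; ring
          rw [this]; exact hpowT (by linarith)
        rw [hu, le_div_iff₀ (hpos A), ← hTx]
        calc D ^ 2 * T * ℓ * ℓ ^ A = (D ^ 2 * ℓ * ℓ ^ A) * T := by ring
          _ ≤ T * T := by gcongr
          _ ≤ T * T * (T * T) := le_mul_of_one_le_right (by positivity) hTT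
      calc _ ≤ ⌊Q⌋₊ * T + (2 * x * ρ + D ^ 2 * (T + x * ρ)) * (4 * ℓ) := by gcongr
        _ = ⌊Q⌋₊ * T + 8 * (x * ρ * ℓ) + 4 * (D ^ 2 * T * ℓ) + 4 * (x * ρ * (D ^ 2 * ℓ)) := by ring
        _ ≤ u + 8 * u + 4 * u + 4 * u := by gcongr
        _ = _ := by ring
  rw [totalDiscrepancy_congr fun n hn hnx =>
    eq_dirichletConv_add_mediumPart_add_smoothPart hf.isMultiplicative hx.le (by linarith) hzy hxyy hn hnx]
  refine (totalDiscrepancy_add_le _ _ _ _ _).trans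
    ((add_le_add hp1 ((totalDiscrepancy_add_le _ _ _ _ _).trans (add_le_add hp2 hp3))).trans (le_of_eq ?_))
  ring

theorem corollary7p1 (A B γ K : ℝ) (hA : 0 ≤ A) (hB : A + 5 < B) (hγ : 2 * A + 6 < γ) :
    ∃ C : ℝ, 0 < C ∧ ∀ (x Q y : ℝ) (f : ArithmeticFunction ℂ), 2 ≤ x →
      Q = x ^ (1 / 2 : ℝ) / Real.log x ^ B →
      y = x / Real.log x ^ γ →
      IsClassC f →
      (∀ X : ℝ, y ≤ X → X ≤ x →
        totalDiscrepancy (primitiveCharsUpTo (Real.log x ^ B)) Q (restrictPrimes f) X ≤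
          K * (X / (Real.log x ^ A * Real.log (x / y)))) →
      totalDiscrepancy (primitiveCharsUpTo (Real.log x ^ B)) Q f x ≤
        C * (x / Real.log x ^ A) := by
  obtain ⟨ℓ₀, hℓ₀, hlarge⟩ := exists_log_threshold (A + 2 * B + 2 * γ + 5)
    ((16 + 32 * (γ + 4) + 4 * (A + 2 * B + 2)) / (1 / (4 * (γ + 4)) / 4))
  have hlog2 : 0 < Real.log 2 := Real.log_pos (by norm_num)
  -- Bounds `Q (log x) ^ A` for `log 2 ≤ log x ≤ ℓ₀`. As `ℓ₀ ≥ 2`, the degenerate value `x = e` lies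
  -- in this range, where the hypothesis on primes plays no role.
  set C₁ := √(Real.exp ℓ₀) / Real.log 2 ^ B * ℓ₀ ^ A with hC₁
  have hC₁0 : 0 < C₁ := by positivity
  refine ⟨max (3 * |K| + 700017) C₁, lt_max_of_lt_right hC₁0, fun x Q y f hx hQ hy hf h => ?_⟩
  have hx0 : 0 < x := by linarith
  rw [← Real.sqrt_eq_rpow] at hQ
  have hlogx : Real.log 2 ≤ Real.log x := Real.log_le_log (by norm_num) hx
  have hlog0 : 0 < Real.log x := by linarith
  have hu0 : 0 ≤ x / Real.log x ^ A := by positivity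
  rcases le_total ℓ₀ (Real.log x) with hcase | hcase
  · obtain ⟨h1, h2⟩ := hlarge _ hcase
    refine (hf.totalDiscrepancy_le_of_large hA hB hγ hx0 rfl (hℓ₀.trans hcase) h1 h2 hQ hy h).trans ?_
    exact mul_le_mul_of_nonneg_right (le_max_left _ _) hu0
  · have hQ0 : 0 ≤ Q := by rw [hQ]; positivity
    refine (totalDiscrepancy_le_mul _ hQ0 hx0.le hf.norm_le_one).trans ?_
    have hQle : Q ≤ √(Real.exp ℓ₀) / Real.log 2 ^ B := by
      rw [hQ]
      have h1 : x ≤ Real.exp ℓ₀ := (Real.log_le_iff_le_exp hx0).mp hcase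
      have h2 : Real.log 2 ^ B ≤ Real.log x ^ B := Real.rpow_le_rpow hlog2.le hlogx (by linarith)
      gcongr
    calc Q * x = Q * Real.log x ^ A * (x / Real.log x ^ A) := by field_simp
      _ ≤ C₁ * (x / Real.log x ^ A) := by
          refine mul_le_mul_of_nonneg_right ?_ hu0
          rw [hC₁]
          have : Real.log x ^ A ≤ ℓ₀ ^ A := Real.rpow_le_rpow hlog0.le hcase hA
          gcongr
      _ ≤ _ := mul_le_mul_of_nonneg_right (le_max_right _ _) hu0
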